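/- There is a deterministic dynamic algorithm with the following properties. Let $n,t,\Delta_{\max}\in\mathbb N$ with $t\ge 1$, let $0<\varepsilon<1$ be real, and assume $$\frac{\Delta_{\max}}{t}\ \ge\ \frac{10^4\,\log^2 n}{\varepsilon^2}.$$ Let $G$ be a dynamic simple graph on $n$ vertices that is initially edgeless and is subject to insertions of absent edges and deletions of present edges, presented one at a time, such that the maximum degree of $G$ never exceeds $\Delta_{\max}$. The algorithm is given $n$, $t$, $\Delta_{\max}$ and $\lceil 1/\varepsilon\rceil$. It maintains an edge-colouring $c\colon E(G)\to[t]$ (not necessarily proper) such that after every update, for every colour $i\in[t]$, the graph $G[i]$ formed by the edges of colour $i$ has maximum degree at most $$(1+\varepsilon)\,\frac{\Delta_{\max}}{t}.$$ Its amortised update time is $O(t^3\varepsilon^{-4}\log^3 m)$ and its amortised recourse is $O\!\left(\frac{\log n}{\varepsilon^2}\right)$, with absolute constants in both bounds. That is, over any sequence of $\sigma$ updates as above, the total number of steps is at most $C\,\sigma\,t^3\varepsilon^{-4}\log^3 (\max\{m,2\})$, where $m$ is the largest number of edges of $G$ at any time in the sequence, and the total number of colour assignments to single edges (initial colours of inserted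 edges included) is at most $C\,\sigma\,\frac{\log n}{\varepsilon^2}$, where $C$ does not depend on $n,t,\Delta_{\max},\varepsilon$ or the sequence. Here $\log$ is the natural logarithm. The model of computation is the word RAM, with memory that is initially zero except for the parameters, and with words of any length $w$ satisfying $2^w\ge(n+t+\Delta_{\max}+\lceil 1/\varepsilon\rceil+2)^a$ for an absolute constant $a$. The algorithm is one fixed program, independent of $n,t,\Delta_{\max},\varepsilon$ and $w$; it explicitly outputs every assignment of a colour to an edge. -/

import Mathlib

/-! ## A deterministic word RAM with a step count -/

namespace WordRAM

/-- The binary operations of the machine. -/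
inductive BinOp
  | add | sub | mul | div | mod | and | or | xor | shl | shr | lt | eq

/-- Value of a binary operation on `w`-bit words, i.e. on natural numbers below `2 ^ w`.
Arithmetic is modulo `2 ^ w`; `lt` and `eq` return `1` for true and `0` for false. -/
def BinOp.eval (w : ℕ) : BinOp → ℕ → ℕ → ℕ
  | .add, x, y => (x + y) % 2 ^ w
  | .sub, x, y => (x + (2 ^ w - y)) % 2 ^ w
  | .mul, x, y => (x * y) % 2 ^ w
  | .div, x, y => (x / y) % 2 ^ w
  | .mod, x, y => (x % y) % 2 ^ w
  | .and, x, y => (x &&& y) % 2 ^ w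
  | .or, x, y => (x ||| y) % 2 ^ w
  | .xor, x, y => (x ^^^ y) % 2 ^ w
  | .shl, x, y => (x <<< y) % 2 ^ w
  | .shr, x, y => (x >>> y) % 2 ^ w
  | .lt, x, y => (if x < y then 1 else 0) % 2 ^ w
  | .eq, x, y => (if x = y then 1 else 0) % 2 ^ w

/-- Instructions. The arguments `a b c` are addresses of memory cells, `M[a]` is the content
of cell `a`, and `l` is a line number of the program.
* `const a k`: `M[a] := k`
* `op o a b c`: `M[a] := M[b] o M[c]`
* `load a b`: `M[a] := M[M[b]]`
* `store a b`: `M[M[a]] := M[b]`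
* `jump l`: go to line `l`
* `jumpZero a l`: go to line `l` if `M[a] = 0`
* `report a b c`: output the triple `(M[a], M[b], M[c])`, read as
  "the edge with end vertices `M[a]` and `M[b]` has from now on the colour `M[c]`". -/
inductive Instr
  | const (a k : ℕ)
  | op (o : BinOp) (a b c : ℕ)
  | load (a b : ℕ)
  | store (a b : ℕ)
  | jump (l : ℕ)
  | jumpZero (a l : ℕ)
  | report (a b c : ℕ)

/-- A program is a finite list of instructions. -/
abbrev Program := List Instr

/-- The memory: one word per address. -/
abbrev Mem := ℕ → ℕ

/-- A machine state: the program counter, the memory, and the triples output so far. -/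
structure State where
  pc : ℕ
  mem : Mem
  out : List (ℕ × ℕ × ℕ)

/-- Effect of a single instruction. -/
def Instr.exec (w : ℕ) (s : State) : Instr → State
  | .const a k => ⟨s.pc + 1, Function.update s.mem a (k % 2 ^ w), s.out⟩
  | .op o a b c => ⟨s.pc + 1, Function.update s.mem a (o.eval w (s.mem b) (s.mem c)), s.out⟩
  | .load a b => ⟨s.pc + 1, Function.update s.mem a (s.mem (s.mem b)), s.out⟩
  | .store a b => ⟨s.pc + 1, Function.update s.mem (s.mem a) (s.mem b), s.out⟩
  | .jump l => ⟨l, s.mem, s.out⟩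
  | .jumpZero a l => ⟨if s.mem a = 0 then l else s.pc + 1, s.mem, s.out⟩
  | .report a b c => ⟨s.pc + 1, s.mem, s.out ++ [(s.mem a, s.mem b, s.mem c)]⟩

/-- One step; `none` means that the machine has halted (there is no instruction at line `pc`). -/
def step (w : ℕ) (p : Program) (s : State) : Option State :=
  (p[s.pc]?).map fun i => i.exec w s

/-- `Run w p s T s'`: started in `s`, the program `p` halts in state `s'` after exactly
`T` steps, with words of `w` bits. -/
inductive Run (w : ℕ) (p : Program) : State → ℕ → State → Prop
  | halt {s : State} : step w p s = none → Run w p s 0 s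
  | step {s s' s'' : State} {T : ℕ} :
      step w p s = some s' → Run w p s' T s'' → Run w p s (T + 1) s''

end WordRAM

/-! ## Dynamic graphs -/

namespace DynGraph

/-- An update of a graph on the vertex set `Fin n`. -/
inductive Update (n : ℕ)
  | insert (u v : Fin n)
  | delete (u v : Fin n)

namespace Update

variable {n : ℕ}

/-- The edge that is inserted or deleted. -/
def edge : Update n → Sym2 (Fin n)
  | insert u v => s(u, v)
  | delete u v => s(u, v)

/-- The graph after the update. -/
def apply (G : SimpleGraph (Fin n)) : Update n → SimpleGraph (Fin n)
  | insert u v => G ⊔ SimpleGraph.edge u v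
  | delete u v => G.deleteEdges {s(u, v)}

/-- Only absent edges (and no loops) are inserted, and only present edges are deleted. -/
def Legal (G : SimpleGraph (Fin n)) : Update n → Prop
  | insert u v => u ≠ v ∧ ¬ G.Adj u v
  | delete u v => G.Adj u v

/-- How an update is handed to the machine: cell `0` receives `1` for an insertion and `0` for
a deletion, cells `1` and `2` receive the end vertices. The rest of the memory is kept. -/
def feed (M : WordRAM.Mem) : Update n → WordRAM.Mem
  | insert u v => Function.update (Function.update (Function.update M 0 1) 1 u) 2 v
  | delete u v => Function.update (Function.update (Function.update M 0 0) 1 u) 2 v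

end Update

open scoped Classical in
/-- The maximum degree of a graph on `Fin n`. -/
noncomputable def maxDeg {n : ℕ} (G : SimpleGraph (Fin n)) : ℕ := G.maxDegree

/-- The graph after a sequence of updates, starting from the graph without edges. -/
def graphAfter {n : ℕ} (us : List (Update n)) : SimpleGraph (Fin n) :=
  us.foldl (fun G u => u.apply G) ⊥

/-- Started from `G`, all updates in the sequence are legal, and the maximum degree is at
most `Δ` after every update. -/
def Valid {n : ℕ} (Δ : ℕ) : SimpleGraph (Fin n) → List (Update n) → Prop
  | _, [] => True
  | G, u :: us => u.Legal G ∧ maxDeg (u.apply G) ≤ Δ ∧ Valid Δ (u.apply G) us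

/-- The largest number of edges at any time during the sequence of updates, started from `G`. -/
noncomputable def peakEdges {n : ℕ} : SimpleGraph (Fin n) → List (Update n) → ℕ
  | G, [] => G.edgeSet.ncard
  | G, u :: us => max G.edgeSet.ncard (peakEdges (u.apply G) us)

/-- A colour table: the colour, if any, of each unordered pair of vertices. -/
abbrev Table := Sym2 ℕ → Option ℕ

/-- The colour table after an update on which the machine has output the triples `rs`:
the colour of the inserted or deleted edge is erased, and then the triples are entered in order. -/
def Table.refresh {n : ℕ} (c : Table) (u : Update n) (rs : List (ℕ × ℕ × ℕ)) : Table :=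
  rs.foldl (fun c r => Function.update c s(r.1, r.2.1) (some r.2.2))
    (Function.update c (u.edge.map Fin.val) none)

/-- The initial memory: cells `3, 4, 5, 6` hold the parameters, all others are zero. -/
def initMem (n t Δ k : ℕ) : WordRAM.Mem := fun a =>
  if a = 3 then n else if a = 4 then t else if a = 5 then Δ else if a = 6 then k else 0

/-- `Maintains p w M₀ us M c T R`: on the updates `us`, presented one after the other, the
program `p`, run with `w`-bit words from the initial memory `M₀`, halts after each update;
after the last one the memory is `M` and the colour table is `c`, and altogether `T` steps have
been made and `R` triples (colour assignments of single edges) have been output. After each update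
the program is restarted at its first line on the memory that it left behind. -/
inductive Maintains {n : ℕ} (p : WordRAM.Program) (w : ℕ) (M₀ : WordRAM.Mem) :
    List (Update n) → WordRAM.Mem → Table → ℕ → ℕ → Prop
  | init : Maintains p w M₀ [] M₀ (fun _ => none) 0 0
  | update {us : List (Update n)} {M : WordRAM.Mem} {c : Table} {T R : ℕ}
      (u : Update n) {T' : ℕ} {s : WordRAM.State} :
      Maintains p w M₀ us M c T R →
      WordRAM.Run w p ⟨0, u.feed M, []⟩ T' s →
      Maintains p w M₀ (us ++ [u]) s.mem (c.refresh u s.out) (T + T') (R + s.out.length)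

/-- The colour table `c` holds a (not necessarily proper) `t`-edge-colouring of `G` in which
every colour class has maximum degree at most `b`. Colours are numbered from `0`. -/
def IsSplitter {n : ℕ} (G : SimpleGraph (Fin n)) (t : ℕ) (b : ℝ) (c : Table) : Prop :=
  ∃ χ : G.EdgeLabeling (Fin t),
    (∀ e : G.edgeSet, c ((e : Sym2 (Fin n)).map Fin.val) = some (χ e : ℕ)) ∧
    ∀ i : Fin t, (maxDeg (χ.labelGraph i) : ℝ) ≤ b

end DynGraph

/-!
The algorithm is a local search. Let `q = ⌈1 / ε⌉`, let `L = l + 1` be the bit length of the largest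
number of edges so far, and let `θ` be the integer part of `Δ / (32 t q² L)`. Say that an edge `xy`
of colour `i` gains `g` from colour `j` if the number of edges of colour `i` at `x` plus that at `y`
exceeds the corresponding sum for `j` by `g`. The algorithm sees to it that, between updates, no
edge gains more than `2θ`.

*Such colourings are balanced* (`balanced_of_local`). Suppose that the degrees in two colours `i`
and `j` differ by more than `Δ / (t q)` at some vertex. Starting there, follow edges of colour `i`
and of colour `j` in turn. Because no edge gains much, the difference of the two degrees keeps its
size, up to small losses, and changes sign with every step. The number of edges at the set of
vertices reached therefore grows by a constant factor in every `q` rounds, and exceeds the number of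
edges of the graph before the losses add up to half of the difference. So all colour degrees at a
vertex are within `Δ / (t q) ≤ ε Δ / t` of their mean, which is at most `Δ / t`
(`Rest.isSplitter`).

*Keeping gains small with bounded work.* One cannot look at all edges at a vertex whenever a colour
degree changes there. Instead, the vertex goes on a stack, and the entry later pays for
`K = 128 t q² L` checks of edges at this vertex, made in round-robin order by a pointer that runs
through `Δ` slots. A check recolours the edge with the best colour if this gains more than `θ`.
A change of a colour degree raises gains by at most `2`, and an edge is checked again within `Δ`
checks at either end, that is, within about `Δ / K` stack entries of that end. So between updates its
gain is at most `θ + 4Δ / K`, about `2θ`. The invariant that says this in the midst of the work is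
`Aged`, with the allowances `allow`; `check_spec` and `drain_spec` preserve it.

*The number of recolourings.* The potential `∑ v, (t ∑ i, dᵢ² - (∑ i, dᵢ)²)`, where `dᵢ` is the
number of edges of colour `i` at `v`, drops by at least `t θ` with each recolouring
(`pot_recoloured`). Because the colour degrees are balanced, an update raises it by at most
`2 (2 t ⌊Δ / (t q)⌋ + t)` (`pot_inserted`, `pot_deleted`). Hence there are `O(q L)` recolourings per
update, where `L = O(log n)`, and each causes two stack entries, that is, `2 K` checks of `O(t)`
steps (`History.recolourings_le`, `History.reports_le`, `History.time_le`). The lower bound on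
`Δ / t` is needed only to have `2 ≤ θ`.

*The peak edge number is not known in advance.* When the number of edges reaches the next power of
two, `L` grows, `θ` and `K` are recomputed, and all edges are checked once (`rescan_spec`). There
are at most `log₂` of the peak edge number many such rescans, and each takes `O(σ t)` steps if `σ`
updates have been made.

*The machine.* The program is written in a small structured language with registers and
two-dimensional arrays, and compiled to the word RAM with an exact count of the steps
(`run_compile`). All values stay below `S ^ 10`, where `S = n + t + Δ + q + 2`, and all addresses
below `S ^ 13`, so that no operation overflows. The registers are used as follows:

* `0`, `1`, `2`: the update; `3`, `4`, `5`, `6`: the parameters `n`, `t`, `Δ`, `q`;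
* `7`: the row length `n + t` of the arrays; `15`, `16`: the constants zero and one;
* `8`, `9`: `l` and `2 ^ (l + 1) - 2`; `10`: the number of edges;
* `11`, `12`: `θ` and `K`; `13`: the height of the stack; `14`: the number of touched vertices;
* `20`, `21`: the vertex and the slot for a check; from `22` on: local variables.

The arrays are

* `0`: the colour matrix, with entry `0` for a non-edge and `i + 1` for an edge of colour `i`;
* `1`: the slot of a neighbour; `2`: the neighbour in a slot;
* `3`: the colour degrees; `4`: the degrees;
* `5`: the pointers; `6`, `7`: marks and list of the touched vertices; `8`: the stack.
-/

/-! ### A structured language on top of the word RAM -/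

namespace Imp

open WordRAM

/-- Commands of a structured language with scalar registers and two-dimensional arrays. The
numbers `a b c x y` are register names and `k` is the name of an array:
`get a k x y` is `a := arr k [x, y]` and `put k x y b` is `arr k [x, y] := b`. -/
inductive Cmd
  | const (a k : ℕ)
  | mov (a b : ℕ)
  | op (o : BinOp) (a b c : ℕ)
  | get (a k x y : ℕ)
  | put (k x y b : ℕ)
  | report (a b c : ℕ)
  | seq (c d : Cmd)
  | ite (a : ℕ) (c d : Cmd)
  | loop (a : ℕ) (c : Cmd)

infixr:67 " ;; " => Cmd.seq

/-- A state of the structured language: registers, arrays, triples output so far, and the number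
of machine steps made so far. -/
structure St where
  reg : ℕ → ℕ
  arr : ℕ → ℕ → ℕ → ℕ
  out : List (ℕ × ℕ × ℕ)
  tm : ℕ

/-- Values of the operations on natural numbers, without reduction modulo the word size. -/
def opVal : BinOp → ℕ → ℕ → ℕ
  | .add, x, y => x + y
  | .sub, x, y => x - y
  | .mul, x, y => x * y
  | .div, x, y => x / y
  | .mod, x, y => x % y
  | .lt, x, y => if x < y then 1 else 0
  | .eq, x, y => if x = y then 1 else 0
  | _, _, _ => 0

/-- Conditions under which an operation on words gives the value on natural numbers, for any
word size `w` with `B ≤ 2 ^ w`. -/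
def opOk (B : ℕ) : BinOp → ℕ → ℕ → Prop
  | .add, x, y => x + y < B
  | .sub, x, y => y ≤ x ∧ x < B
  | .mul, x, y => x * y < B
  | .div, x, _ => x < B
  | .mod, x, _ => x < B
  | .lt, _, _ => True
  | .eq, _, _ => True
  | _, _, _ => False

/-- Array `k` of `A` with the entry at `[x, y]` replaced by `v`. -/
def upd (A : ℕ → ℕ → ℕ → ℕ) (k x y v : ℕ) : ℕ → ℕ → ℕ → ℕ :=
  fun k' x' y' => if k' = k ∧ x' = x ∧ y' = y then v else A k' x' y'

/-- Big-step semantics. `N` is the row length of all arrays, which has to be kept in register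
`7`, and `B` bounds all values and row numbers. The third component of a state counts the steps of
the compiled code. -/
inductive Ev (N B : ℕ) : Cmd → St → St → Prop
  | const {a k s} : k < B →
      Ev N B (.const a k) s ⟨Function.update s.reg a k, s.arr, s.out, s.tm + 1⟩
  | mov {a b s} : s.reg b < B →
      Ev N B (.mov a b) s ⟨Function.update s.reg a (s.reg b), s.arr, s.out, s.tm + 2⟩
  | op {o a b c s} : opOk B o (s.reg b) (s.reg c) →
      Ev N B (.op o a b c) s
        ⟨Function.update s.reg a (opVal o (s.reg b) (s.reg c)), s.arr, s.out, s.tm + 1⟩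
  | get {a k x y s} : s.reg 7 = N → s.reg x < B → s.reg y < N →
      Ev N B (.get a k x y) s
        ⟨Function.update s.reg a (s.arr k (s.reg x) (s.reg y)), s.arr, s.out, s.tm + 7⟩
  | put {k x y b s} : s.reg 7 = N → s.reg x < B → s.reg y < N →
      Ev N B (.put k x y b) s
        ⟨s.reg, upd s.arr k (s.reg x) (s.reg y) (s.reg b), s.out, s.tm + 7⟩
  | report {a b c s} :
      Ev N B (.report a b c) s
        ⟨s.reg, s.arr, s.out ++ [(s.reg a, s.reg b, s.reg c)], s.tm + 1⟩
  | seq {c d s s' s''} : Ev N B c s s' → Ev N B d s' s'' → Ev N B (.seq c d) s s''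
  | iteTrue {a c d s s'} : s.reg a ≠ 0 →
      Ev N B c ⟨s.reg, s.arr, s.out, s.tm + 2⟩ s' → Ev N B (.ite a c d) s s'
  | iteFalse {a c d s s'} : s.reg a = 0 →
      Ev N B d ⟨s.reg, s.arr, s.out, s.tm + 1⟩ s' → Ev N B (.ite a c d) s s'
  | loopStop {a c s} : s.reg a = 0 →
      Ev N B (.loop a c) s ⟨s.reg, s.arr, s.out, s.tm + 1⟩
  | loopStep {a c s s' s''} : s.reg a ≠ 0 →
      Ev N B c ⟨s.reg, s.arr, s.out, s.tm + 2⟩ s' → Ev N B (.loop a c) s' s'' →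
      Ev N B (.loop a c) s s''

/-- Registers and arrays are within the range that the compiled code sets aside for them. -/
def Cmd.WF : Cmd → Bool
  | .const a _ => decide (a < 60)
  | .mov a b => decide (a < 60 ∧ b < 60)
  | .op _ a b c => decide (a < 60 ∧ b < 60 ∧ c < 60)
  | .get a k x y => decide (a < 60 ∧ k < 16 ∧ x < 60 ∧ y < 60)
  | .put k x y b => decide (b < 60 ∧ k < 16 ∧ x < 60 ∧ y < 60)
  | .report a b c => decide (a < 60 ∧ b < 60 ∧ c < 60)
  | .seq c d => c.WF && d.WF
  | .ite a c d => decide (a < 60) && (c.WF && d.WF)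
  | .loop a c => decide (a < 60) && c.WF

/-- Code that puts the address of `arr k [x, y]` into cell `60`. -/
def addrCode (k x y : ℕ) : Program :=
  [.op .mul 60 x 7, .op .add 60 60 y, .const 61 16, .op .mul 60 60 61, .const 61 (64 + k),
    .op .add 60 60 61]

/-- Number of instructions of the compiled code. -/
def Cmd.len : Cmd → ℕ
  | .const _ _ => 1
  | .mov _ _ => 2
  | .op _ _ _ _ => 1
  | .get _ _ _ _ => 7
  | .put _ _ _ _ => 7
  | .report _ _ _ => 1
  | .seq c d => c.len + d.len
  | .ite _ c d => c.len + d.len + 2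
  | .loop _ c => c.len + 2

/-- Compilation to machine code whose first instruction stands at line `o`. Cells `60` and `61`
serve as scratch space. -/
def compile (o : ℕ) : Cmd → Program
  | .const a k => [.const a k]
  | .mov a b => [.const 60 0, .op .add a b 60]
  | .op b x y z => [.op b x y z]
  | .get a k x y => addrCode k x y ++ [.load a 60]
  | .put k x y b => addrCode k x y ++ [.store 60 b]
  | .report a b c => [.report a b c]
  | .seq c d => compile o c ++ compile (o + c.len) d
  | .ite a c d =>
      .jumpZero a (o + c.len + 2) :: (compile (o + 1) c ++
        (.jump (o + c.len + d.len + 2) :: compile (o + c.len + 2) d))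
  | .loop a c => .jumpZero a (o + c.len + 2) :: (compile (o + 1) c ++ [.jump o])

theorem length_compile (c : Cmd) (o : ℕ) : (compile o c).length = c.len := by
  induction c generalizing o <;> simp_all [compile, Cmd.len, addrCode]
  all_goals omega

/-- The program `p` has the code `l` from line `o` on. -/
def CodeAt (p : Program) : ℕ → Program → Prop
  | _, [] => True
  | o, x :: l => p[o]? = some x ∧ CodeAt p (o + 1) l

theorem codeAt_append (p l₁ l₂ : Program) (o : ℕ) :
    CodeAt p o (l₁ ++ l₂) ↔ CodeAt p o l₁ ∧ CodeAt p (o + l₁.length) l₂ := by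
  induction l₁ generalizing o with
  | nil => simp [CodeAt]
  | cons x l ih =>
    simp only [List.cons_append, CodeAt, ih, List.length_cons, and_assoc]
    rw [show o + 1 + l.length = o + (l.length + 1) by omega]

theorem codeAt_of_append (l l' : Program) : CodeAt (l' ++ l) l'.length l := by
  induction l generalizing l' with
  | nil => trivial
  | cons x l ih =>
    refine ⟨by simp, ?_⟩
    have := ih (l' ++ [x])
    simpa using this

/-- Whatever the machine does from `s'`, it does from `s` with `k` more steps. -/
def Reach (w : ℕ) (p : Program) (k : ℕ) (s s' : State) : Prop :=
  ∀ T s'', Run w p s' T s'' → Run w p s (T + k) s''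

theorem Reach.trans {w : ℕ} {p : Program} {k l : ℕ} {s s' s'' : State}
    (h : Reach w p k s s') (h' : Reach w p l s' s'') : Reach w p (k + l) s s'' := by
  intro T r hr
  have := h _ _ (h' _ _ hr)
  rwa [add_assoc, add_comm l k] at this

theorem Reach.single {w : ℕ} {p : Program} {o : ℕ} {M : Mem} {out : List (ℕ × ℕ × ℕ)} {i : Instr}
    {s' : State} (h : p[o]? = some i) (hs : i.exec w ⟨o, M, out⟩ = s') :
    Reach w p 1 ⟨o, M, out⟩ s' := by
  intro T r hr
  exact Run.step (by simp [WordRAM.step, h, hs]) hr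

/-- The memory `M` represents the state `s`: registers `r < 60` are cells, and the entry `[x, y]`
of array `k < 16` is the cell `64 + 16 * (x * N + y) + k`. -/
structure Rep (N : ℕ) (M : Mem) (s : St) : Prop where
  reg : ∀ r < 60, M r = s.reg r
  arr : ∀ k < 16, ∀ x y, y < N → M (64 + 16 * (x * N + y) + k) = s.arr k x y

theorem addr_injective {N k x y k' x' y' : ℕ} (hk : k < 16) (hk' : k' < 16) (hy : y < N)
    (hy' : y' < N) :
    64 + 16 * (x * N + y) + k = 64 + 16 * (x' * N + y') + k' ↔ k = k' ∧ x = x' ∧ y = y' := by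
  constructor
  · intro h
    have h1 : k = k' := by omega
    have h2 : x * N + y = x' * N + y' := by omega
    have h3 : (x * N + y) / N = (x' * N + y') / N := by rw [h2]
    have hN : 0 < N := by omega
    rw [mul_comm x, mul_comm x', Nat.mul_add_div hN, Nat.mul_add_div hN, Nat.div_eq_of_lt hy,
      Nat.div_eq_of_lt hy'] at h3
    have h4 : x = x' := by omega
    subst h4
    exact ⟨h1, rfl, by omega⟩
  · rintro ⟨rfl, rfl, rfl⟩; rfl

theorem Rep.setReg {N : ℕ} {M : Mem} {s : St} (h : Rep N M s) {a v : ℕ} (ha : a < 60)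
    {out : List (ℕ × ℕ × ℕ)} {tm : ℕ} :
    Rep N (Function.update M a v) ⟨Function.update s.reg a v, s.arr, out, tm⟩ := by
  constructor
  · intro r hr
    by_cases hra : r = a
    · subst hra; simp
    · simp [hra, h.reg r hr]
  · intro k hk x y hy
    rw [Function.update_of_ne (by omega)]
    exact h.arr k hk x y hy

theorem Rep.setScratch {N : ℕ} {M : Mem} {s : St} (h : Rep N M s) {a v : ℕ} (ha : 60 ≤ a)
    (ha' : a < 64) : Rep N (Function.update M a v) s := by
  constructor
  · intro r hr
    rw [Function.update_of_ne (by omega)]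
    exact h.reg r hr
  · intro k hk x y hy
    rw [Function.update_of_ne (by omega)]
    exact h.arr k hk x y hy

theorem Rep.setArr {N : ℕ} {M : Mem} {s : St} (h : Rep N M s) {k x y v : ℕ} (hk : k < 16)
    (hy : y < N) {out : List (ℕ × ℕ × ℕ)} {tm : ℕ} :
    Rep N (Function.update M (64 + 16 * (x * N + y) + k) v)
      ⟨s.reg, upd s.arr k x y v, out, tm⟩ := by
  constructor
  · intro r hr
    rw [Function.update_of_ne (by omega)]
    exact h.reg r hr
  · intro k' hk' x' y' hy'
    simp only [Function.update_apply, addr_injective hk' hk hy' hy, upd]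
    split_ifs
    · rfl
    · exact h.arr k' hk' x' y' hy'

theorem Rep.ext {N : ℕ} {M : Mem} {s s' : St} (h : Rep N M s) (hr : s'.reg = s.reg)
    (ha : s'.arr = s.arr) : Rep N M s' :=
  ⟨by rw [hr]; exact h.reg, by rw [ha]; exact h.arr⟩

/-- Word operations agree with the operations on natural numbers as long as nothing overflows. -/
theorem eval_eq_opVal {w B : ℕ} (hB : B ≤ 2 ^ w) (hw : 2 ≤ 2 ^ w) {o : BinOp} {x y : ℕ}
    (h : opOk B o x y) : o.eval w x y = opVal o x y := by
  cases o <;> simp only [opOk] at h <;> simp only [BinOp.eval, opVal]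
  · exact Nat.mod_eq_of_lt (by omega)
  · rw [show x + (2 ^ w - y) = x - y + 2 ^ w by omega, Nat.add_mod_right]
    exact Nat.mod_eq_of_lt (by omega)
  · exact Nat.mod_eq_of_lt (by omega)
  · exact Nat.mod_eq_of_lt ((Nat.div_le_self _ _).trans_lt (by omega))
  · exact Nat.mod_eq_of_lt ((Nat.mod_le _ _).trans_lt (by omega))
  · split_ifs <;> exact Nat.mod_eq_of_lt (by omega)
  · split_ifs <;> exact Nat.mod_eq_of_lt (by omega)

theorem reach_addrCode {w : ℕ} {p : Program} {N B o k x y : ℕ} {M : Mem} {s : St}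
    {out : List (ℕ × ℕ × ℕ)} (hB : 64 + 16 * (B * N + N) + 16 ≤ 2 ^ w)
    (hc : CodeAt p o (addrCode k x y)) (h : Rep N M s) (hk : k < 16) (hx : x < 60) (hy : y < 60)
    (h7 : s.reg 7 = N) (hxB : s.reg x < B) (hyN : s.reg y < N) :
    ∃ M', Rep N M' s ∧ M' 60 = 64 + 16 * (s.reg x * N + s.reg y) + k ∧
      Reach w p 6 ⟨o, M, out⟩ ⟨o + 6, M', out⟩ := by
  simp only [addrCode, CodeAt] at hc
  obtain ⟨h1, h2, h3, h4, h5, h6, -⟩ := hc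
  have hmul : s.reg x * N ≤ B * N := Nat.mul_le_mul_right _ hxB.le
  have e1 : s.reg x * N % 2 ^ w = s.reg x * N := Nat.mod_eq_of_lt (by omega)
  have e2 : (s.reg x * N + s.reg y) % 2 ^ w = s.reg x * N + s.reg y :=
    Nat.mod_eq_of_lt (by omega)
  have e3 : (s.reg x * N + s.reg y) * 16 % 2 ^ w = (s.reg x * N + s.reg y) * 16 :=
    Nat.mod_eq_of_lt (by omega)
  have e4 : 16 % 2 ^ w = 16 := Nat.mod_eq_of_lt (by omega)
  have e5 : (64 + k) % 2 ^ w = 64 + k := Nat.mod_eq_of_lt (by omega)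
  have e6 : ((s.reg x * N + s.reg y) * 16 + (64 + k)) % 2 ^ w
    = (s.reg x * N + s.reg y) * 16 + (64 + k) := Nat.mod_eq_of_lt (by omega)
  have hMx := h.reg x hx
  have hMy := h.reg y hy
  have hM7 := h.reg 7 (by omega)
  refine ⟨_, ?_, ?_, (Reach.single h1 rfl).trans ((Reach.single h2 rfl).trans
    ((Reach.single h3 rfl).trans ((Reach.single h4 rfl).trans ((Reach.single h5 rfl).trans
      (Reach.single h6 rfl)))))⟩
  · repeat apply Rep.setScratch _ (by omega) (by omega)
    exact h
  · simp only [BinOp.eval, Function.update_self, Function.update_of_ne (show y ≠ 60 by omega),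
      Function.update_of_ne (show (60 : ℕ) ≠ 61 by omega), hMx, hMy, hM7, h7, e1, e2, e3, e4, e5,
      e6]
    omega

/-- The compiled code simulates the structured program, step count included. -/
theorem reach_compile {w : ℕ} {p : Program} {N B : ℕ} (hB : 64 + 16 * (B * N + N) + 16 ≤ 2 ^ w)
    (hBw : B ≤ 2 ^ w) {c : Cmd} {s s' : St} (h : Ev N B c s s') :
    c.WF = true → ∀ o M, Rep N M s → CodeAt p o (compile o c) →
    ∃ M' k, Rep N M' s' ∧ s'.tm = s.tm + k ∧
      Reach w p k ⟨o, M, s.out⟩ ⟨o + c.len, M', s'.out⟩ := by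
  induction h with
  | @const a k s hk =>
    intro hwf o M hM hc
    simp only [Cmd.WF, decide_eq_true_eq] at hwf
    simp only [compile, CodeAt] at hc
    refine ⟨_, 1, hM.setReg hwf, rfl, Reach.single hc.1 ?_⟩
    simp [Instr.exec, Cmd.len, Nat.mod_eq_of_lt (hk.trans_le hBw)]
  | @mov a b s hb =>
    intro hwf o M hM hc
    simp only [Cmd.WF, decide_eq_true_eq] at hwf
    simp only [compile, CodeAt] at hc
    refine ⟨_, 2, (hM.setScratch (a := 60) (v := 0) le_rfl (by omega)).setReg hwf.1, rfl,
      (Reach.single hc.1 rfl).trans (Reach.single hc.2.1 ?_)⟩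
    simp [Instr.exec, Cmd.len, BinOp.eval, Function.update_of_ne (show b ≠ 60 by omega),
      hM.reg b hwf.2, Nat.mod_eq_of_lt (hb.trans_le hBw)]
  | @op f a b c s hf =>
    intro hwf o M hM hc
    simp only [Cmd.WF, decide_eq_true_eq] at hwf
    simp only [compile, CodeAt] at hc
    refine ⟨_, 1, hM.setReg hwf.1, rfl, Reach.single hc.1 ?_⟩
    simp [Instr.exec, Cmd.len, hM.reg b hwf.2.1, hM.reg c hwf.2.2,
      eval_eq_opVal hBw (by omega) hf]
  | @get a k x y s h7 hx hy =>
    intro hwf o M hM hc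
    simp only [Cmd.WF, decide_eq_true_eq] at hwf
    simp only [compile, codeAt_append] at hc
    obtain ⟨M₁, hM₁, ha, hr⟩ := reach_addrCode (out := s.out) hB hc.1 hM hwf.2.1 hwf.2.2.1
      hwf.2.2.2 h7 hx hy
    refine ⟨_, 7, hM₁.setReg hwf.1, rfl, hr.trans (Reach.single hc.2.1 ?_)⟩
    simp [Instr.exec, Cmd.len, ha, hM₁.arr k hwf.2.1 _ _ hy]
  | @put k x y b s h7 hx hy =>
    intro hwf o M hM hc
    simp only [Cmd.WF, decide_eq_true_eq] at hwf
    simp only [compile, codeAt_append] at hc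
    obtain ⟨M₁, hM₁, ha, hr⟩ := reach_addrCode (out := s.out) hB hc.1 hM hwf.2.1 hwf.2.2.1
      hwf.2.2.2 h7 hx hy
    refine ⟨_, 7, hM₁.setArr hwf.2.1 hy, rfl, hr.trans (Reach.single hc.2.1 ?_)⟩
    simp [Instr.exec, Cmd.len, ha, hM₁.reg b hwf.1]
  | @report a b c s =>
    intro hwf o M hM hc
    simp only [Cmd.WF, decide_eq_true_eq] at hwf
    simp only [compile, CodeAt] at hc
    refine ⟨_, 1, hM.ext rfl rfl, rfl, Reach.single hc.1 ?_⟩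
    simp [Instr.exec, Cmd.len, hM.reg a hwf.1, hM.reg b hwf.2.1, hM.reg c hwf.2.2]
  | @seq c d s s' s'' _ _ ih₁ ih₂ =>
    intro hwf o M hM hc
    simp only [Cmd.WF, Bool.and_eq_true] at hwf
    simp only [compile, codeAt_append, length_compile] at hc
    obtain ⟨M₁, k₁, hM₁, ht₁, hr₁⟩ := ih₁ hwf.1 o M hM hc.1
    obtain ⟨M₂, k₂, hM₂, ht₂, hr₂⟩ := ih₂ hwf.2 _ M₁ hM₁ hc.2
    refine ⟨M₂, k₁ + k₂, hM₂, by omega, hr₁.trans ?_⟩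
    simpa [Cmd.len, add_assoc] using hr₂
  | @iteTrue a c d s s' ha _ ih =>
    intro hwf o M hM hc
    simp only [Cmd.WF, Bool.and_eq_true, decide_eq_true_eq] at hwf
    simp only [compile, CodeAt, codeAt_append, length_compile] at hc
    obtain ⟨M₁, k₁, hM₁, ht₁, hr₁⟩ := ih hwf.2.1 (o + 1) M (hM.ext rfl rfl) hc.2.1
    refine ⟨M₁, 1 + (k₁ + 1), hM₁, by dsimp only at ht₁; omega,
      (Reach.single hc.1 ?_).trans (hr₁.trans (Reach.single hc.2.2.1 ?_))⟩
    · simp [Instr.exec, hM.reg a hwf.1, ha]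
    · simp [Instr.exec, Cmd.len, add_assoc]
  | @iteFalse a c d s s' ha _ ih =>
    intro hwf o M hM hc
    simp only [Cmd.WF, Bool.and_eq_true, decide_eq_true_eq] at hwf
    simp only [compile, CodeAt, codeAt_append, length_compile] at hc
    have hc' := hc.2.2.2
    rw [show o + 1 + c.len + 1 = o + c.len + 2 by omega] at hc'
    obtain ⟨M₁, k₁, hM₁, ht₁, hr₁⟩ := ih hwf.2.2 (o + c.len + 2) M (hM.ext rfl rfl) hc'
    refine ⟨M₁, 1 + k₁, hM₁, by dsimp only at ht₁; omega, (Reach.single hc.1 ?_).trans (s' :=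
      ⟨o + c.len + 2, M, s.out⟩) ?_⟩
    · simp [Instr.exec, hM.reg a hwf.1, ha]
    · simpa [Cmd.len, show o + c.len + 2 + d.len = o + (c.len + d.len + 2) by omega] using hr₁
  | @loopStop a c s ha =>
    intro hwf o M hM hc
    simp only [Cmd.WF, Bool.and_eq_true, decide_eq_true_eq] at hwf
    simp only [compile, CodeAt, codeAt_append, length_compile] at hc
    refine ⟨M, 1, hM.ext rfl rfl, rfl, Reach.single hc.1 ?_⟩
    simp [Instr.exec, hM.reg a hwf.1, ha, Cmd.len, add_assoc]
  | @loopStep a c s s' s'' ha _ _ ih₁ ih₂ =>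
    intro hwf o M hM hc
    have hwf' := hwf
    have hc' := hc
    simp only [Cmd.WF, Bool.and_eq_true, decide_eq_true_eq] at hwf
    simp only [compile, CodeAt, codeAt_append, length_compile] at hc
    obtain ⟨M₁, k₁, hM₁, ht₁, hr₁⟩ := ih₁ hwf.2 (o + 1) M (hM.ext rfl rfl) hc.2.1
    obtain ⟨M₂, k₂, hM₂, ht₂, hr₂⟩ := ih₂ hwf' o M₁ hM₁ hc'
    refine ⟨M₂, 1 + (k₁ + (1 + k₂)), hM₂, by dsimp only at ht₁; omega,
      (Reach.single hc.1 ?_).trans (hr₁.trans ((Reach.single hc.2.2.1 ?_).trans hr₂))⟩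
    · simp [Instr.exec, hM.reg a hwf.1, ha]
    · simp [Instr.exec]

/-- A whole structured program, run as a machine program. -/
theorem run_compile {w : ℕ} {N B : ℕ} (hB : 64 + 16 * (B * N + N) + 16 ≤ 2 ^ w)
    (hBw : B ≤ 2 ^ w) {c : Cmd} (hc : c.WF = true) {s s' : St} (h : Ev N B c s s')
    (hs : s.out = []) {M : Mem} (hM : Rep N M s) :
    ∃ M' k pc, Rep N M' s' ∧ s'.tm = s.tm + k ∧
      Run w (compile 0 c) ⟨0, M, []⟩ k ⟨pc, M', s'.out⟩ := by
  have hcode : CodeAt (compile 0 c) 0 (compile 0 c) := by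
    simpa using codeAt_of_append (compile 0 c) []
  obtain ⟨M', k, hM', ht, hr⟩ := reach_compile hB hBw h hc 0 M hM hcode
  refine ⟨M', k, 0 + c.len, hM', ht, ?_⟩
  rw [hs] at hr
  have := hr 0 _ (Run.halt (by simp [WordRAM.step, length_compile]))
  simpa using this

/-! ### Total correctness -/

/-- Started in `s`, the command `c` ends in a state that satisfies `Q`. -/
def Spec (N B : ℕ) (c : Cmd) (s : St) (Q : St → Prop) : Prop := ∃ s', Ev N B c s s' ∧ Q s'

section rules

variable {N B : ℕ} {s : St} {Q : St → Prop}

theorem spec_const {a k : ℕ} : Spec N B (.const a k) s Q ↔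
    k < B ∧ Q ⟨Function.update s.reg a k, s.arr, s.out, s.tm + 1⟩ := by
  constructor
  · rintro ⟨_, ⟨⟩, h⟩; exact ⟨by assumption, h⟩
  · rintro ⟨hk, h⟩; exact ⟨_, .const hk, h⟩

theorem spec_mov {a b : ℕ} : Spec N B (.mov a b) s Q ↔
    s.reg b < B ∧ Q ⟨Function.update s.reg a (s.reg b), s.arr, s.out, s.tm + 2⟩ := by
  constructor
  · rintro ⟨_, ⟨⟩, h⟩; exact ⟨by assumption, h⟩
  · rintro ⟨hk, h⟩; exact ⟨_, .mov hk, h⟩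

theorem spec_op {o : BinOp} {a b c : ℕ} : Spec N B (.op o a b c) s Q ↔
    opOk B o (s.reg b) (s.reg c) ∧
      Q ⟨Function.update s.reg a (opVal o (s.reg b) (s.reg c)), s.arr, s.out, s.tm + 1⟩ := by
  constructor
  · rintro ⟨_, ⟨⟩, h⟩; exact ⟨by assumption, h⟩
  · rintro ⟨hk, h⟩; exact ⟨_, .op hk, h⟩

theorem spec_get {a k x y : ℕ} : Spec N B (.get a k x y) s Q ↔
    (s.reg 7 = N ∧ s.reg x < B ∧ s.reg y < N) ∧
      Q ⟨Function.update s.reg a (s.arr k (s.reg x) (s.reg y)), s.arr, s.out, s.tm + 7⟩ := by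
  constructor
  · rintro ⟨_, ⟨⟩, h⟩; exact ⟨⟨by assumption, by assumption, by assumption⟩, h⟩
  · rintro ⟨⟨h7, hx, hy⟩, h⟩; exact ⟨_, .get h7 hx hy, h⟩

theorem spec_put {k x y b : ℕ} : Spec N B (.put k x y b) s Q ↔
    (s.reg 7 = N ∧ s.reg x < B ∧ s.reg y < N) ∧
      Q ⟨s.reg, upd s.arr k (s.reg x) (s.reg y) (s.reg b), s.out, s.tm + 7⟩ := by
  constructor
  · rintro ⟨_, ⟨⟩, h⟩; exact ⟨⟨by assumption, by assumption, by assumption⟩, h⟩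
  · rintro ⟨⟨h7, hx, hy⟩, h⟩; exact ⟨_, .put h7 hx hy, h⟩

theorem spec_report {a b c : ℕ} : Spec N B (.report a b c) s Q ↔
    Q ⟨s.reg, s.arr, s.out ++ [(s.reg a, s.reg b, s.reg c)], s.tm + 1⟩ := by
  constructor
  · rintro ⟨_, ⟨⟩, h⟩; exact h
  · intro h; exact ⟨_, .report, h⟩

theorem spec_seq {c d : Cmd} :
    Spec N B (.seq c d) s Q ↔ Spec N B c s fun s' => Spec N B d s' Q := by
  constructor
  · rintro ⟨_, ⟨⟩, h⟩
    exact ⟨_, by assumption, _, by assumption, h⟩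
  · rintro ⟨_, h₁, s'', h₂, h₃⟩
    exact ⟨s'', .seq h₁ h₂, h₃⟩

theorem spec_ite {a : ℕ} {c d : Cmd} : Spec N B (.ite a c d) s Q ↔
    (s.reg a ≠ 0 → Spec N B c ⟨s.reg, s.arr, s.out, s.tm + 2⟩ Q) ∧
      (s.reg a = 0 → Spec N B d ⟨s.reg, s.arr, s.out, s.tm + 1⟩ Q) := by
  constructor
  · rintro ⟨_, ⟨⟩, h⟩
    · exact ⟨fun _ => ⟨_, by assumption, h⟩, fun h' => absurd h' (by assumption)⟩
    · exact ⟨fun h' => absurd (by assumption) h', fun _ => ⟨_, by assumption, h⟩⟩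
  · rintro ⟨ht, hf⟩
    by_cases ha : s.reg a = 0
    · obtain ⟨s', h₁, h₂⟩ := hf ha
      exact ⟨s', .iteFalse ha h₁, h₂⟩
    · obtain ⟨s', h₁, h₂⟩ := ht ha
      exact ⟨s', .iteTrue ha h₁, h₂⟩

/-- The rule for loops: `I` is an invariant indexed by a variant that goes down in every round. -/
theorem spec_loop {a : ℕ} {c : Cmd} (I : ℕ → St → Prop) {m : ℕ} (h₀ : I m s)
    (hstep : ∀ m s, I m s → s.reg a ≠ 0 →
      Spec N B c ⟨s.reg, s.arr, s.out, s.tm + 2⟩ fun s' => ∃ m' < m, I m' s')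
    (hexit : ∀ m s, I m s → s.reg a = 0 → Q ⟨s.reg, s.arr, s.out, s.tm + 1⟩) :
    Spec N B (.loop a c) s Q := by
  induction m using Nat.strong_induction_on generalizing s with
  | _ m ih =>
    by_cases ha : s.reg a = 0
    · exact ⟨_, .loopStop ha, hexit m s h₀ ha⟩
    · obtain ⟨s', h₁, m', hm', h₂⟩ := hstep m s h₀ ha
      obtain ⟨s'', h₃, h₄⟩ := ih m' hm' h₂
      exact ⟨s'', .loopStep ha h₁ h₃, h₄⟩

end rules

end Imp

/-! ### Locally optimal colourings are balanced -/

namespace Splitter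

open Finset

/-- The number of edges of colour `i` at `v`. A coloured graph on the vertices `0, …, n - 1` is a
matrix `C`: the entry `C u v` is `0` if `uv` is not an edge, and `i + 1` if `uv` is an edge of
colour `i`. -/
def cdeg (n : ℕ) (C : ℕ → ℕ → ℕ) (v i : ℕ) : ℕ := #{u ∈ range n | C v u = i + 1}

/-- If all edges of colour `i` that start in `A` end in `B`, then `B` meets at least as many edges
of colour `i` as `A`. -/
theorem sum_cdeg_le {n : ℕ} {C : ℕ → ℕ → ℕ} (hC : ∀ u v, C u v = C v u) {i : ℕ} {A B : Finset ℕ}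
    (hA : A ⊆ range n) (h : ∀ v ∈ A, ∀ u < n, C v u = i + 1 → u ∈ B) :
    ∑ v ∈ A, cdeg n C v i ≤ ∑ v ∈ B, cdeg n C v i := by
  simp only [cdeg, card_filter]
  calc ∑ v ∈ A, ∑ u ∈ range n, (if C v u = i + 1 then 1 else 0)
      = ∑ u ∈ range n, ∑ v ∈ A, (if C v u = i + 1 then 1 else 0) := sum_comm
    _ = ∑ u ∈ range n ∩ B, ∑ v ∈ A, (if C v u = i + 1 then 1 else 0) := by
        symm
        refine sum_subset inter_subset_left fun u hu hu' => sum_eq_zero fun v hv => if_neg ?_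
        intro hvu
        exact hu' (mem_inter.2 ⟨hu, h v hv u (mem_range.1 hu) hvu⟩)
    _ ≤ ∑ u ∈ B, ∑ v ∈ A, (if C v u = i + 1 then 1 else 0) :=
        sum_le_sum_of_subset inter_subset_right
    _ ≤ ∑ u ∈ B, ∑ v ∈ range n, (if C u v = i + 1 then 1 else 0) := by
        refine sum_le_sum fun u _ => ?_
        simp only [hC u]
        exact sum_le_sum_of_subset hA

theorem two_mul_pow_self_le {Q : ℕ} (hQ : 0 < Q) : 2 * Q ^ Q ≤ (Q + 1) ^ Q := by
  have h := one_add_mul_le_pow (a := (1 / Q : ℝ)) (by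
    have : (0 : ℝ) ≤ 1 / Q := by positivity
    linarith) Q
  have hQ' : (Q : ℝ) ≠ 0 := by positivity
  have h2 : (2 : ℝ) * Q ^ Q ≤ (1 + 1 / Q) ^ Q * Q ^ Q := by
    refine mul_le_mul_of_nonneg_right ?_ (by positivity)
    calc (2 : ℝ) = 1 + Q * (1 / Q) := by field_simp; norm_num
      _ ≤ _ := h
  rw [← mul_pow, add_mul, one_mul, div_mul_cancel₀ _ hQ'] at h2
  exact_mod_cast h2

/-- In a colouring in which no edge gains more than `2 * θ` from a change of its colour, any two
colour degrees at a vertex differ by at most `Δ / (t * q)`. Suppose that `d i - d j = X` is larger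
at some vertex. Following edges of colour `i` and of colour `j` in turn, one passes between sets of
vertices where `d i - d j` is at least about `X / 2` and at most about `-X / 2`, and the number of
edges at these sets grows by a constant factor in every `q` rounds, until it exceeds the number of
edges of the graph. -/
theorem balanced_of_local {n t q L θ Δ : ℕ} {C : ℕ → ℕ → ℕ} (ht : 0 < t) (hq : 2 ≤ q) (hL : 0 < L)
    (hC : ∀ u v, C u v = C v u) (hΔ : ∀ v < n, ∑ i ∈ range t, cdeg n C v i ≤ Δ)
    (hm : ∑ v ∈ range n, ∑ i ∈ range t, cdeg n C v i < 2 ^ (L + 1))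
    (hθ : 32 * t * q ^ 2 * L * θ ≤ Δ)
    (hloc : ∀ x < n, ∀ y < n, ∀ i < t, C x y = i + 1 → ∀ j < t,
      cdeg n C x i + cdeg n C y i ≤ cdeg n C x j + cdeg n C y j + 2 * θ)
    {v i j : ℕ} (hv : v < n) (hi : i < t) (hj : j < t) :
    t * q * cdeg n C v i ≤ t * q * cdeg n C v j + Δ := by
  set d : ℕ → ℕ → ℕ := cdeg n C with hd
  obtain ⟨⟨v₀, i₀, j₀⟩, hmem, hmax⟩ := exists_max_image (range n ×ˢ range t ×ˢ range t)
    (fun p => (d p.1 p.2.1 : ℤ) - d p.1 p.2.2)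
    ⟨(v, i, j), by simp [hv, hi, hj]⟩
  simp only [mem_product, mem_range] at hmem hmax
  obtain ⟨hv₀, hi₀, hj₀⟩ := hmem
  by_contra hcon
  push Not at hcon
  set X : ℤ := (d v₀ i₀ : ℤ) - d v₀ j₀ with hX
  have hXΔ : (Δ : ℤ) < t * q * X := by
    have h1 : (d v i : ℤ) - d v j ≤ X := hmax (v, i, j) ⟨hv, hi, hj⟩
    have h2 : ((t * q : ℕ) : ℤ) * ((d v i : ℤ) - d v j) ≤ (t * q : ℕ) * X :=
      mul_le_mul_of_nonneg_left h1 (by positivity)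
    have h3 : ((t * q * d v j + Δ : ℕ) : ℤ) < (t * q * d v i : ℕ) := by exact_mod_cast hcon
    push_cast at h2 h3
    linarith
  have htq : (0 : ℤ) < t * q := by positivity
  have hX0 : 0 < X := by
    by_contra h
    have : (t : ℤ) * q * X ≤ 0 := mul_nonpos_of_nonneg_of_nonpos htq.le (by omega)
    have : (0 : ℤ) ≤ Δ := by positivity
    omega
  -- Every colour degree is at most `(q + 1) * X`.
  have hdle : ∀ u < n, ∀ k < t, (d u k : ℤ) ≤ (q + 1) * X := by
    intro u hu k hk
    have h1 : ∑ l ∈ range t, ((d u k : ℤ) - d u l) ≤ ∑ l ∈ range t, X :=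
      sum_le_sum fun l hl => hmax (u, k, l) ⟨hu, hk, mem_range.1 hl⟩
    have h2 : ((∑ l ∈ range t, d u l : ℕ) : ℤ) ≤ Δ := by exact_mod_cast hΔ u hu
    rw [sum_sub_distrib, sum_const, sum_const, card_range] at h1
    push_cast at h2
    simp only [nsmul_eq_mul] at h1
    have h3 : (t : ℤ) * d u k < t * ((q + 1) * X) := by linarith
    exact (lt_of_mul_lt_mul_left h3 (by positivity)).le
  set Q : ℕ := 2 * (q + 1) with hQ
  -- The number of rounds, and the slack that they use up.
  set N : ℕ := (q + 1) * (L + 1) with hN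
  have hslack : (8 * N * θ : ℤ) ≤ X := by
    have h1 : ((32 * t * q ^ 2 * L * θ : ℕ) : ℤ) ≤ Δ := by exact_mod_cast hθ
    have h2 : (t : ℤ) * q * (32 * q * L * θ) < t * q * X := by
      push_cast at h1; linarith
    have h3 : (32 * q * L * θ : ℤ) < X := lt_of_mul_lt_mul_left h2 htq.le
    have h4 : N ≤ 3 * q * L := by rw [hN]; nlinarith
    have h5 : 8 * N * θ ≤ 32 * q * L * θ := Nat.mul_le_mul_right _ (by nlinarith)
    have h6 : ((8 * N * θ : ℕ) : ℤ) ≤ (32 * q * L * θ : ℕ) := by exact_mod_cast h5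
    push_cast at h6
    linarith
  let A : ℕ → Finset ℕ := fun k =>
    {u ∈ range n | X - 4 * k * θ ≤ (d u i₀ : ℤ) - d u j₀}
  let B : ℕ → Finset ℕ := fun k =>
    {u ∈ range n | (d u i₀ : ℤ) - d u j₀ ≤ -X + (4 * k + 2) * θ}
  -- One edge from a large difference: the colour degree drops by the factor `Q / (Q + 1)`.
  have hpt : ∀ x y : ℤ, 0 ≤ x → 2 * (x - y) ≤ -X → y ≤ (q + 1) * X → (Q + 1) * x ≤ Q * y := by
    intro x y hx h1 h2
    have h3 : x ≤ (q + 1) * (2 * (y - x)) := by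
      have : ((q : ℤ) + 1) * X ≤ (q + 1) * (2 * (y - x)) :=
        mul_le_mul_of_nonneg_left (by linarith) (by positivity)
      linarith
    rw [hQ]; push_cast; linarith
  have hstep : ∀ k < N, (Q + 1) ^ 2 * ∑ u ∈ A k, d u i₀ ≤ Q ^ 2 * ∑ u ∈ A (k + 1), d u i₀ := by
    intro k hk
    have hkN : (8 * (k + 1) * θ : ℤ) ≤ X := by
      have : 8 * (k + 1) * θ ≤ 8 * N * θ := Nat.mul_le_mul_right _ (by omega)
      have : ((8 * (k + 1) * θ : ℕ) : ℤ) ≤ (8 * N * θ : ℕ) := by exact_mod_cast this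
      push_cast at this
      linarith
    have hθ0 : (0 : ℤ) ≤ θ := by positivity
    have h1 : ∑ u ∈ A k, d u i₀ ≤ ∑ u ∈ B k, d u i₀ := by
      refine sum_cdeg_le hC (filter_subset _ _) fun x hx y hy hxy => ?_
      simp only [A, B, mem_filter, mem_range] at hx ⊢
      have := hloc x hx.1 y hy i₀ hi₀ hxy j₀ hj₀
      refine ⟨hy, ?_⟩
      zify at this
      linarith
    have h2 : (Q + 1) * ∑ u ∈ B k, d u i₀ ≤ Q * ∑ u ∈ B k, d u j₀ := by
      rw [mul_sum, mul_sum]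
      refine sum_le_sum fun u hu => ?_
      simp only [B, mem_filter, mem_range] at hu
      have := hpt (d u i₀) (d u j₀) (by positivity) (by linarith) (hdle u hu.1 _ hj₀)
      exact_mod_cast this
    have h3 : ∑ u ∈ B k, d u j₀ ≤ ∑ u ∈ A (k + 1), d u j₀ := by
      refine sum_cdeg_le hC (filter_subset _ _) fun x hx y hy hxy => ?_
      simp only [A, B, mem_filter, mem_range] at hx ⊢
      have := hloc x hx.1 y hy j₀ hj₀ hxy i₀ hi₀
      refine ⟨hy, ?_⟩
      zify at this
      push_cast
      linarith
    have h4 : (Q + 1) * ∑ u ∈ A (k + 1), d u j₀ ≤ Q * ∑ u ∈ A (k + 1), d u i₀ := by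
      rw [mul_sum, mul_sum]
      refine sum_le_sum fun u hu => ?_
      simp only [A, mem_filter, mem_range] at hu
      push_cast at hu
      have := hpt (d u j₀) (d u i₀) (by positivity) (by linarith) (hdle u hu.1 _ hi₀)
      exact_mod_cast this
    calc (Q + 1) ^ 2 * ∑ u ∈ A k, d u i₀ ≤ (Q + 1) ^ 2 * ∑ u ∈ B k, d u i₀ := by gcongr
      _ = (Q + 1) * ((Q + 1) * ∑ u ∈ B k, d u i₀) := by ring
      _ ≤ (Q + 1) * (Q * ∑ u ∈ B k, d u j₀) := by gcongr
      _ ≤ (Q + 1) * (Q * ∑ u ∈ A (k + 1), d u j₀) := by gcongr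
      _ = Q * ((Q + 1) * ∑ u ∈ A (k + 1), d u j₀) := by ring
      _ ≤ Q * (Q * ∑ u ∈ A (k + 1), d u i₀) := by gcongr
      _ = _ := by ring
  have hind : ∀ k ≤ N,
      (Q + 1) ^ (2 * k) * ∑ u ∈ A 0, d u i₀ ≤ Q ^ (2 * k) * ∑ u ∈ A k, d u i₀ := by
    intro k
    induction k with
    | zero => intro _; simp
    | succ k ih =>
      intro hk
      calc (Q + 1) ^ (2 * (k + 1)) * ∑ u ∈ A 0, d u i₀
          = (Q + 1) ^ 2 * ((Q + 1) ^ (2 * k) * ∑ u ∈ A 0, d u i₀) := by ring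
        _ ≤ (Q + 1) ^ 2 * (Q ^ (2 * k) * ∑ u ∈ A k, d u i₀) := by
            gcongr (Q + 1) ^ 2 * ?_; exact ih (by omega)
        _ = Q ^ (2 * k) * ((Q + 1) ^ 2 * ∑ u ∈ A k, d u i₀) := by ring
        _ ≤ Q ^ (2 * k) * (Q ^ 2 * ∑ u ∈ A (k + 1), d u i₀) := by
            gcongr Q ^ (2 * k) * ?_; exact hstep k (by omega)
        _ = _ := by ring
  have h0 : 1 ≤ ∑ u ∈ A 0, d u i₀ := by
    have h1 : v₀ ∈ A 0 := by simp [A, hv₀, hX]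
    have h2 : 1 ≤ d v₀ i₀ := by omega
    exact h2.trans (single_le_sum (f := fun u => d u i₀) (fun _ _ => Nat.zero_le _) h1)
  have hlast : ∑ u ∈ A N, d u i₀ < 2 ^ (L + 1) := by
    refine lt_of_le_of_lt ?_ hm
    calc ∑ u ∈ A N, d u i₀ ≤ ∑ u ∈ range n, d u i₀ := sum_le_sum_of_subset (filter_subset _ _)
      _ ≤ _ := sum_le_sum fun u _ =>
        single_le_sum (f := fun k => d u k) (fun _ _ => Nat.zero_le _) (mem_range.2 hi₀)
  have hgrow : 2 ^ (L + 1) * Q ^ (2 * N) ≤ (Q + 1) ^ (2 * N) := by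
    have h1 : 2 * N = Q * (L + 1) := by rw [hN, hQ]; ring
    rw [h1, pow_mul Q Q (L + 1), pow_mul (Q + 1) Q (L + 1), ← mul_pow]
    exact Nat.pow_le_pow_left (two_mul_pow_self_le (by omega)) _
  have h5 := hind N le_rfl
  have h6 : Q ^ (2 * N) * ∑ u ∈ A N, d u i₀ < Q ^ (2 * N) * 2 ^ (L + 1) :=
    Nat.mul_lt_mul_of_pos_left hlast (by positivity)
  have h7 : (Q + 1) ^ (2 * N) ≤ (Q + 1) ^ (2 * N) * ∑ u ∈ A 0, d u i₀ :=
    Nat.le_mul_of_pos_right _ h0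
  have := hgrow.trans (h7.trans h5)
  rw [mul_comm] at this
  omega

/-! ### The potential -/

/-- The square deviation of `f 0, …, f (t - 1)` from their mean, times `t`. -/
def dev (t : ℕ) (f : ℕ → ℕ) : ℤ := t * ∑ i ∈ range t, (f i : ℤ) ^ 2 - (∑ i ∈ range t, (f i : ℤ)) ^ 2

theorem dev_nonneg (t : ℕ) (f : ℕ → ℕ) : 0 ≤ dev t f := by
  have := sq_sum_le_card_mul_sum_sq (s := range t) (f := fun i => (f i : ℤ))
  rw [card_range] at this
  unfold dev
  linarith

theorem sum_update {t : ℕ} {f g : ℕ → ℤ} {i : ℕ} (hi : i < t) (hg : ∀ k < t, k ≠ i → g k = f k) :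
    ∑ k ∈ range t, g k = ∑ k ∈ range t, f k + (g i - f i) := by
  have hi' := mem_range.2 hi
  rw [← add_sum_erase _ g hi', ← add_sum_erase _ f hi']
  have : ∑ k ∈ (range t).erase i, g k = ∑ k ∈ (range t).erase i, f k :=
    sum_congr rfl fun k hk => hg k (mem_range.1 (mem_erase.1 hk).2) (mem_erase.1 hk).1
  linarith

theorem dev_update {t : ℕ} {f g : ℕ → ℕ} {i : ℕ} (hi : i < t) (hg : ∀ k < t, k ≠ i → g k = f k) :
    dev t g = dev t f + t * ((g i : ℤ) ^ 2 - (f i : ℤ) ^ 2)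
      - (((∑ k ∈ range t, (f k : ℤ)) + (g i - f i)) ^ 2 - (∑ k ∈ range t, (f k : ℤ)) ^ 2) := by
  unfold dev
  rw [sum_update (f := fun k => (f k : ℤ)) (g := fun k => (g k : ℤ)) hi
      fun k hk h => by rw [hg k hk h],
    sum_update (f := fun k => (f k : ℤ) ^ 2) (g := fun k => (g k : ℤ) ^ 2) hi
      fun k hk h => by rw [hg k hk h]]
  ring

/-- Moving one edge from colour `i` to colour `j`. -/
theorem dev_move {t : ℕ} {f g : ℕ → ℕ} {i j : ℕ} (hi : i < t) (hj : j < t) (hij : i ≠ j)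
    (hgi : g i + 1 = f i) (hgj : g j = f j + 1) (hg : ∀ k < t, k ≠ i → k ≠ j → g k = f k) :
    dev t g = dev t f + 2 * t * ((f j : ℤ) - f i + 1) := by
  have h1 := dev_update (f := f) (g := fun k => if k = i then g i else f k) hi
    (fun k _ hk => by simp [hk])
  have h2 := dev_update (f := fun k => if k = i then g i else f k) (g := g) hj
    (fun k hk hkj => by
      by_cases hki : k = i
      · simp [hki]
      · simp [hki, hg k hk hki hkj])
  have h3 := sum_update (f := fun k => (f k : ℤ))
    (g := fun k => ((if k = i then g i else f k : ℕ) : ℤ)) hi (fun k _ hk => by simp [hk])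
  simp only [if_true, if_neg hij.symm] at h1 h2 h3
  rw [h2, h1, h3, hgj, ← hgi]
  push_cast
  ring

/-- A change of one colour degree by one raises the potential by little if the colour degrees are
balanced. -/
theorem dev_update_le {t X : ℕ} {f g : ℕ → ℕ} {i : ℕ} (hi : i < t)
    (hg : ∀ k < t, k ≠ i → g k = f k) (hgi : g i = f i + 1 ∨ g i + 1 = f i)
    (hX : ∀ k < t, ∀ l < t, f k ≤ f l + X) : dev t g ≤ dev t f + (2 * t * X + t) := by
  rw [dev_update hi hg]
  set S := ∑ k ∈ range t, (f k : ℤ)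
  have h1 : (t : ℤ) * f i - S ≤ t * X := by
    have : ∑ k ∈ range t, ((f i : ℤ) - f k) ≤ ∑ k ∈ range t, (X : ℤ) := by
      refine sum_le_sum fun k hk => ?_
      have := hX i hi k (mem_range.1 hk)
      omega
    rwa [sum_sub_distrib, sum_const, sum_const, card_range, nsmul_eq_mul, nsmul_eq_mul] at this
  have h2 : S - t * f i ≤ t * X := by
    have : ∑ k ∈ range t, ((f k : ℤ) - f i) ≤ ∑ k ∈ range t, (X : ℤ) := by
      refine sum_le_sum fun k hk => ?_
      have := hX k (mem_range.1 hk) i hi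
      omega
    rwa [sum_sub_distrib, sum_const, sum_const, card_range, nsmul_eq_mul, nsmul_eq_mul] at this
  rcases hgi with h | h
  · rw [h]; push_cast; nlinarith
  · rw [← h] at h1 h2 ⊢; push_cast at h1 h2 ⊢; nlinarith

/-- The potential of the table `d` of colour degrees. -/
def pot (n t : ℕ) (d : ℕ → ℕ → ℕ) : ℤ := ∑ v ∈ range n, dev t (d v)

theorem pot_nonneg (n t : ℕ) (d : ℕ → ℕ → ℕ) : 0 ≤ pot n t d :=
  sum_nonneg fun _ _ => dev_nonneg _ _

/-- Only the summands of two vertices change if their rows change. -/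
theorem pot_update {n t : ℕ} {d d' : ℕ → ℕ → ℕ} {u v : ℕ} (hu : u < n) (hv : v < n) (huv : u ≠ v)
    (h : ∀ x < n, x ≠ u → x ≠ v → d' x = d x) :
    pot n t d' = pot n t d + (dev t (d' u) - dev t (d u)) + (dev t (d' v) - dev t (d v)) := by
  unfold pot
  have h1 := sum_update (f := fun x => dev t (d x)) (g := fun x => if x = u then dev t (d' u) else
    dev t (d x)) hu (fun k _ hk => by simp [hk])
  have h2 := sum_update (g := fun x => dev t (d' x)) (f := fun x => if x = u then dev t (d' u) else
    dev t (d x)) hv (fun k hk hkv => by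
      by_cases hku : k = u
      · simp [hku]
      · simp [hku, h k hk hku hkv])
  simp only [if_true, if_neg huv.symm] at h1 h2
  rw [h2, h1]

end Splitter

/-! ### The arrays of the data structure -/

namespace Splitter

open Finset Imp

section upd

variable (A : ℕ → ℕ → ℕ → ℕ) {k x y v k' x' : ℕ}

theorem upd_ne (h : k' ≠ k) : upd A k x y v k' = A k' := by
  funext a b; simp [upd, h]

theorem upd_row : upd A k x y v k x = Function.update (A k x) y v := by
  funext b; simp [upd, Function.update_apply]

theorem upd_row_ne (h : x' ≠ x) : upd A k x y v k x' = A k x' := by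
  funext b; simp [upd, h]

end upd

/-- The number of entries `w` among the first `n` entries of `f`. -/
def rowCount (n : ℕ) (f : ℕ → ℕ) (w : ℕ) : ℕ := #{y ∈ range n | f y = w}

theorem rowCount_update_old {n u w : ℕ} {f : ℕ → ℕ} (hu : u < n) (hw : w ≠ f u) :
    rowCount n (Function.update f u w) (f u) + 1 = rowCount n f (f u) := by
  have : ({y ∈ range n | Function.update f u w y = f u} : Finset ℕ)
      = ({y ∈ range n | f y = f u} : Finset ℕ).erase u := by
    ext y
    by_cases hy : y = u
    · subst hy; simp [hw]
    · simp [hy]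
  unfold rowCount
  rw [this]
  exact card_erase_add_one (by simp [hu])

theorem rowCount_update_new {n u w : ℕ} {f : ℕ → ℕ} (hu : u < n) (hw : w ≠ f u) :
    rowCount n (Function.update f u w) w = rowCount n f w + 1 := by
  have h := rowCount_update_old (f := Function.update f u w) (w := f u) hu (by simp [hw.symm])
  simpa using h.symm

theorem rowCount_update_ne {n u w z : ℕ} {f : ℕ → ℕ} (hw : z ≠ w) (hz : z ≠ f u) :
    rowCount n (Function.update f u w) z = rowCount n f z := by
  unfold rowCount
  congr 1
  ext y
  by_cases hy : y = u
  · subst hy; simp [hw.symm, hz.symm]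
  · simp [hy]

theorem rowCount_le (n : ℕ) (f : ℕ → ℕ) (w : ℕ) : rowCount n f w ≤ n :=
  (card_filter_le _ _).trans_eq (card_range n)

/-- The data kept for one vertex: `C` is the row of the colour matrix, `D` counts the edges of each
colour, `g` is the degree, `S` lists the neighbours in the slots `0, …, g - 1`, and `P` gives the
slot of each neighbour. -/
structure Row (n t : ℕ) (C P S D : ℕ → ℕ) (g : ℕ) : Prop where
  le : ∀ u, C u ≤ t
  supp : ∀ u, C u ≠ 0 → u < n
  dcol : ∀ i < t, D i = rowCount n C (i + 1)
  deg : g + rowCount n C 0 = n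
  slot : ∀ a < g, C (S a) ≠ 0 ∧ P (S a) = a
  pos : ∀ u, C u ≠ 0 → P u < g ∧ S (P u) = u

theorem Row.recolour {n t g u c j : ℕ} {C P S D : ℕ → ℕ} (h : Row n t C P S D g)
    (hu : C u = c + 1) (hcj : c ≠ j) (hj : j < t) :
    Row n t (Function.update C u (j + 1)) P S
      (Function.update (Function.update D c (D c - 1)) j (D j + 1)) g := by
  have hun : u < n := h.supp u (by omega)
  have hne : ∀ y, Function.update C u (j + 1) y ≠ 0 ↔ C y ≠ 0 := by
    intro y
    by_cases hy : y = u
    · subst hy; simp [hu]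
    · simp [hy]
  have h1 := rowCount_update_old (f := C) (w := j + 1) hun (by omega)
  have h2 := rowCount_update_new (f := C) (w := j + 1) hun (by omega)
  rw [hu] at h1
  have hc : c < t := by have := h.le u; omega
  refine ⟨fun y => ?_, fun y hy => h.supp y ((hne y).1 hy), fun i hi => ?_, ?_, fun a ha => ?_,
    fun y hy => h.pos y ((hne y).1 hy)⟩
  · by_cases hy : y = u
    · subst hy; simp; omega
    · simp [hy, h.le y]
  · by_cases hij : i = j
    · subst hij; simp [h2, h.dcol i hi]
    · by_cases hic : i = c
      · subst hic
        rw [Function.update_of_ne hij, Function.update_self, h.dcol i hi]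
        omega
      · rw [Function.update_of_ne hij, Function.update_of_ne hic, h.dcol i hi,
          rowCount_update_ne (by omega) (by omega)]
  · rw [rowCount_update_ne (by omega) (by omega)]
    exact h.deg
  · exact ⟨(hne _).2 (h.slot a ha).1, (h.slot a ha).2⟩

theorem Row.insert {n t g u : ℕ} {C P S D : ℕ → ℕ} (h : Row n t C P S D g)
    (hu : C u = 0) (hun : u < n) (ht : 0 < t) :
    Row n t (Function.update C u 1) (Function.update P u g) (Function.update S g u)
      (Function.update D 0 (D 0 + 1)) (g + 1) := by
  have h1 := rowCount_update_old (f := C) (w := 1) hun (by omega)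
  have h2 := rowCount_update_new (f := C) (w := 1) hun (by omega)
  rw [hu] at h1
  refine ⟨fun y => ?_, fun y hy => ?_, fun i hi => ?_, ?_, fun a ha => ?_, fun y hy => ?_⟩
  · by_cases hy : y = u
    · subst hy; simp; omega
    · simp [hy, h.le y]
  · by_cases hyu : y = u
    · omega
    · exact h.supp y (by simpa [hyu] using hy)
  · by_cases hi0 : i = 0
    · subst hi0; simp [h2, h.dcol 0 hi]
    · rw [Function.update_of_ne hi0, h.dcol i hi, rowCount_update_ne (by omega) (by omega)]
  · have := h.deg
    omega
  · by_cases hag : a = g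
    · subst hag; simp
    · have := h.slot a (by omega)
      have hne : S a ≠ u := fun h' => this.1 (by rw [h', hu])
      simp [hag, hne, this]
  · by_cases hyu : y = u
    · subst hyu; simp
    · have := h.pos y (by simpa [hyu] using hy)
      have hne : P y ≠ g := by omega
      simp [hyu, hne, this]
      omega

theorem Row.delete {n t g u c : ℕ} {C P S D : ℕ → ℕ} (h : Row n t C P S D g)
    (hu : C u = c + 1) :
    Row n t (Function.update C u 0) (Function.update P (S (g - 1)) (P u))
      (Function.update S (P u) (S (g - 1))) (Function.update D c (D c - 1)) (g - 1) := by
  have hun : u < n := h.supp u (by omega)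
  have h1 := rowCount_update_old (f := C) (w := 0) hun (by omega)
  have h2 := rowCount_update_new (f := C) (w := 0) hun (by omega)
  rw [hu] at h1
  have hpu := h.pos u (by omega)
  refine ⟨fun y => ?_, fun y hy => ?_, fun i hi => ?_, ?_, fun a ha => ?_, fun y hy => ?_⟩
  · by_cases hy : y = u
    · subst hy; simp
    · simp [hy, h.le y]
  · by_cases hyu : y = u
    · subst hyu; simp at hy
    · exact h.supp y (by simpa [hyu] using hy)
  · by_cases hic : i = c
    · subst hic
      rw [Function.update_self, h.dcol i hi]
      omega
    · rw [Function.update_of_ne hic, h.dcol i hi, rowCount_update_ne (by omega) (by omega)]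
  · have := h.deg
    omega
  · have hlast := h.slot (g - 1) (by omega)
    by_cases hap : a = P u
    · have hne : S (g - 1) ≠ u := by
        intro h'
        have := hlast.2
        rw [h'] at this
        omega
      subst hap
      simp [hne, hlast]
    · have hs := h.slot a (by omega)
      have hne : S a ≠ u := fun h' => hap (by rw [← h']; exact hs.2.symm)
      have hne' : S a ≠ S (g - 1) := by
        intro h'
        have := hs.2
        rw [h', hlast.2] at this
        omega
      simp [hap, hne, hne', hs]
  · have hyu : y ≠ u := by rintro rfl; simp at hy
    have hy' : C y ≠ 0 := by simpa [hyu] using hy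
    have hpy := h.pos y hy'
    by_cases hyl : y = S (g - 1)
    · have : P y = g - 1 := by rw [hyl]; exact (h.slot (g - 1) (by omega)).2
      have hne : P u ≠ g - 1 := by
        intro h'
        apply hyu
        rw [hyl, ← h', hpu.2]
      rw [hyl]
      simp
      omega
    · have hne : P y ≠ P u := by
        intro h'
        apply hyu
        rw [← hpy.2, h', hpu.2]
      have hne' : P y ≠ g - 1 := by
        intro h'
        apply hyl
        rw [← h', hpy.2]
      rw [Function.update_of_ne hyl, Function.update_of_ne hne]
      exact ⟨by omega, hpy.2⟩

theorem Row.congr {n t g g' : ℕ} {C P S D C' P' S' D' : ℕ → ℕ} (h : Row n t C P S D g)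
    (hC : C' = C) (hP : P' = P) (hS : S' = S) (hD : D' = D) (hg : g' = g) :
    Row n t C' P' S' D' g' := by
  subst hC hP hS hD hg; exact h

/-- The sum of the colour degrees is the degree. -/
theorem sum_rowCount {n t : ℕ} {C : ℕ → ℕ} (h : ∀ u, C u ≤ t) :
    (∑ i ∈ range t, rowCount n C (i + 1)) + rowCount n C 0 = n := by
  have h1 : ∑ i ∈ range (t + 1), rowCount n C i = n := by
    have := card_eq_sum_card_fiberwise (s := range n) (t := range (t + 1)) (f := C)
      (fun x _ => by simpa [Nat.lt_succ_iff] using h x)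
    rw [card_range] at this
    exact this.symm
  rwa [sum_range_succ'] at h1

/-- The arrays describe a coloured graph: `0` is the colour matrix, `1` the slots, `2` the
neighbours in the slots, `3` the colour degrees and `4` the degrees. -/
structure Core (n t : ℕ) (A : ℕ → ℕ → ℕ → ℕ) : Prop where
  symm : ∀ u v, A 0 u v = A 0 v u
  irrefl : ∀ u, A 0 u u = 0
  supp : ∀ u v, A 0 u v ≠ 0 → u < n
  row : ∀ v < n, Row n t (A 0 v) (A 1 v) (A 2 v) (A 3 v) (A 4 v 0)

/-- A colour that occurs at a vertex has positive colour degree there. -/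
theorem Core.dcol_pos {n t v u c : ℕ} {A : ℕ → ℕ → ℕ → ℕ} (h : Core n t A)
    (hvu : A 0 v u = c + 1) : 0 < A 3 v c := by
  have hv : v < n := h.supp v u (by omega)
  have hu : u < n := h.supp u v (by rw [h.symm]; omega)
  have hc : c < t := by
    have := (h.row v hv).le u
    omega
  rw [(h.row v hv).dcol c hc]
  exact card_pos.2 ⟨u, by simp [hu, hvu]⟩

/-- The number of stack entries `x`. The stack is array `8` and has height `p`. -/
def pend (A : ℕ → ℕ → ℕ → ℕ) (p x : ℕ) : ℕ := #{k ∈ range p | A 8 k 0 = x}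

theorem pend_congr {A A' : ℕ → ℕ → ℕ → ℕ} {p : ℕ} (h : ∀ k < p, A' 8 k 0 = A 8 k 0) (x : ℕ) :
    pend A' p x = pend A p x := by
  unfold pend
  congr 1
  exact filter_congr fun k hk => by rw [h k (mem_range.1 hk)]

theorem pend_succ (A : ℕ → ℕ → ℕ → ℕ) (p x : ℕ) :
    pend A (p + 1) x = pend A p x + if x = A 8 p 0 then 1 else 0 := by
  unfold pend
  simp only [card_filter, sum_range_succ]
  congr 1
  simp only [eq_comm]

/-- Every edge `xy` gains at most `θ` from a change of its colour, up to the allowance `W x y` and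
an allowance of two for every change at its ends for which an entry is still on the stack. All
quantities except `W` are multiplied by `K`; `C` is the colour matrix, `d` the table of
colour degrees and `p` counts stack entries. -/
def Aged (t θ K : ℕ) (W C d : ℕ → ℕ → ℕ) (p : ℕ → ℕ) : Prop :=
  ∀ x y, C x y ≠ 0 → ∀ j < t, K * (d x (C x y - 1) + d y (C x y - 1)) ≤
    K * (d x j + d y j) + K * θ + W x y + 2 * K * (p x + p y)

/-- A change of the colour degrees that is small compared with the number of stack entries that it
adds keeps edges within their allowances. -/
theorem Aged.step {t θ K : ℕ} {W W' C C' d d' : ℕ → ℕ → ℕ} {p p' : ℕ → ℕ}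
    (h : Aged t θ K W C d p) (hC : ∀ x y, C x y ≤ t)
    (hd : ∀ x, ∀ i < t, ∀ j < t, d' x i + d x j + 2 * p x ≤ d x i + d' x j + 2 * p' x)
    (hW : ∀ x y, C' x y ≠ 0 → (C' x y = C x y ∧ W x y ≤ W' x y) ∨
      ∃ V, K * V ≤ W' x y ∧ ∀ j < t,
        d' x (C' x y - 1) + d' y (C' x y - 1) ≤ d' x j + d' y j + θ + 2 * (p' x + p' y) + V) :
    Aged t θ K W' C' d' p' := by
  intro x y hxy j hj
  rcases hW x y hxy with ⟨h1, h2⟩ | ⟨V, h0, h1⟩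
  · rw [h1] at hxy ⊢
    have h3 := h x y hxy j hj
    have hi : C x y - 1 < t := by have := hC x y; omega
    set i := C x y - 1
    have h4 := Nat.mul_le_mul_left K (hd x i hi j hj)
    have h5 := Nat.mul_le_mul_left K (hd y i hi j hj)
    nlinarith
  · have := Nat.mul_le_mul_left K (h1 j hj)
    nlinarith

/-- The arrays after the recolouring of the edge `vu` from colour `c` to colour `j`; `p` is the
height of the stack. -/
def recoloured (A : ℕ → ℕ → ℕ → ℕ) (v u c j p : ℕ) : ℕ → ℕ → ℕ → ℕ :=
  let A := upd (upd A 0 v u (j + 1)) 0 u v (j + 1)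
  let A := upd (upd A 3 v c (A 3 v c - 1)) 3 u c (A 3 u c - 1)
  let A := upd (upd A 3 v j (A 3 v j + 1)) 3 u j (A 3 u j + 1)
  upd (upd A 8 p 0 v) 8 (p + 1) 0 u

section recoloured

variable {n t : ℕ} {A : ℕ → ℕ → ℕ → ℕ} {v u c j p : ℕ}

theorem recoloured_ne {k : ℕ} (h0 : k ≠ 0) (h3 : k ≠ 3) (h8 : k ≠ 8) :
    recoloured A v u c j p k = A k := by
  simp [recoloured, upd_ne, h0, h3, h8]

theorem recoloured_zero (x y : ℕ) : recoloured A v u c j p 0 x y =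
    if (x = v ∧ y = u) ∨ (x = u ∧ y = v) then j + 1 else A 0 x y := by
  simp only [recoloured, upd]
  grind

theorem recoloured_three (huv : v ≠ u) (hcj : c ≠ j) (x i : ℕ) :
    recoloured A v u c j p 3 x i =
      if x = v ∨ x = u then
        if i = c then A 3 x c - 1 else if i = j then A 3 x j + 1 else A 3 x i
      else A 3 x i := by
  simp only [recoloured, upd]
  grind

theorem recoloured_eight {k : ℕ} (hk : k < p) : recoloured A v u c j p 8 k 0 = A 8 k 0 := by
  simp only [recoloured, upd]
  grind

theorem pend_recoloured (huv : v ≠ u) (x : ℕ) :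
    pend (recoloured A v u c j p) (p + 2) x = pend A p x + if x = v ∨ x = u then 1 else 0 := by
  rw [pend_succ, pend_succ, pend_congr (A := A) (fun k hk => recoloured_eight hk)]
  simp only [recoloured, upd]
  grind

theorem Core.recolour (h : Core n t A) (hvu : A 0 v u = c + 1) (hj : j < t)
    (hcj : c ≠ j) : Core n t (recoloured A v u c j p) := by
  have huv : v ≠ u := by rintro rfl; have := h.irrefl v; omega
  have hc : c < t := by
    have := (h.row v (h.supp v u (by omega))).le u
    omega
  refine ⟨fun x y => ?_, fun x => ?_, fun x y hxy => ?_, fun x hx => ?_⟩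
  · rw [recoloured_zero, recoloured_zero, h.symm x y]
    congr 1
    grind
  · rw [recoloured_zero, if_neg (by grind)]
    exact h.irrefl x
  · rw [recoloured_zero] at hxy
    split_ifs at hxy with h'
    · rcases h' with ⟨rfl, rfl⟩ | ⟨rfl, rfl⟩
      · exact h.supp x y (by omega)
      · exact h.supp x y (by rw [h.symm]; omega)
    · exact h.supp x y hxy
  · have e1 : recoloured A v u c j p 1 = A 1 := recoloured_ne (by omega) (by omega) (by omega)
    have e2 : recoloured A v u c j p 2 = A 2 := recoloured_ne (by omega) (by omega) (by omega)
    have e4 : recoloured A v u c j p 4 = A 4 := recoloured_ne (by omega) (by omega) (by omega)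
    rw [e1, e2, e4]
    have key : ∀ z, A 0 x z = c + 1 → (x = v ∧ z = u ∨ x = u ∧ z = v) →
        Row n t (recoloured A v u c j p 0 x) (A 1 x) (A 2 x) (recoloured A v u c j p 3 x)
          (A 4 x 0) := by
      intro z hz hxz
      refine ((h.row x hx).recolour hz hcj hj).congr ?_ rfl rfl ?_ rfl
      · funext y
        rw [recoloured_zero, Function.update_apply]
        grind
      · funext i
        rw [recoloured_three huv hcj, Function.update_apply, Function.update_apply]
        grind
    by_cases hxv : x = v
    · exact key u (by rw [hxv, hvu]) (by simp [hxv])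
    · by_cases hxu : x = u
      · exact key v (by rw [hxu, h.symm, hvu]) (by simp [hxu])
      · refine (h.row x hx).congr ?_ rfl rfl ?_ rfl
        · funext y; rw [recoloured_zero, if_neg (by grind)]
        · funext i; rw [recoloured_three huv hcj, if_neg (by grind)]

/-- Recolouring an edge that gains more than `θ` lowers the potential. -/
theorem pot_recoloured {θ : ℕ} (h : Core n t A) (hvu : A 0 v u = c + 1)
    (hj : j < t) (hcj : c ≠ j) (hθ : 2 ≤ θ)
    (hlt : A 3 v j + A 3 u j + θ < A 3 v c + A 3 u c) :
    pot n t (recoloured A v u c j p 3) + t * θ ≤ pot n t (A 3) := by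
  have huv : v ≠ u := by rintro rfl; have := h.irrefl v; omega
  have hv : v < n := h.supp v u (by omega)
  have huv' : A 0 u v = c + 1 := by rw [h.symm, hvu]
  have hu : u < n := h.supp u v (by omega)
  have hc : c < t := by
    have := (h.row v hv).le u
    omega
  have hd := recoloured_three (A := A) (p := p) huv hcj
  rw [pot_update hv hu huv (d := A 3) (fun x _ h1 h2 => by funext i; rw [hd, if_neg (by grind)])]
  have h1 := h.dcol_pos hvu
  have h2 := h.dcol_pos huv'
  rw [dev_move (f := A 3 v) (g := recoloured A v u c j p 3 v) hc hj hcj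
      (by rw [hd]; grind) (by rw [hd]; grind)
      (fun k _ h1 h2 => by rw [hd]; grind),
    dev_move (f := A 3 u) (g := recoloured A v u c j p 3 u) hc hj hcj
      (by rw [hd]; grind) (by rw [hd]; grind)
      (fun k _ h1 h2 => by rw [hd]; grind)]
  zify at hlt hθ
  have : (t : ℤ) * (A 3 v j + A 3 u j + θ + 1) ≤ t * (A 3 v c + A 3 u c) :=
    mul_le_mul_of_nonneg_left (by linarith) (by positivity)
  have : (t : ℤ) * 2 ≤ t * θ := mul_le_mul_of_nonneg_left hθ (by positivity)
  linarith

theorem Aged.recolour {θ K : ℕ} {W W' : ℕ → ℕ → ℕ} (h : Core n t A) (hvu : A 0 v u = c + 1)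
    (hj : j < t) (hcj : c ≠ j) (hθ : 2 ≤ θ)
    (ha : Aged t θ K W (A 0) (A 3) (pend A p))
    (hlt : A 3 v j + A 3 u j + θ < A 3 v c + A 3 u c)
    (hmin : ∀ i < t, A 3 v j + A 3 u j ≤ A 3 v i + A 3 u i)
    (hW : ∀ x y, A 0 x y ≠ 0 → ¬ (x = v ∧ y = u) → ¬ (x = u ∧ y = v) → W x y ≤ W' x y) :
    Aged t θ K W' (recoloured A v u c j p 0) (recoloured A v u c j p 3)
      (pend (recoloured A v u c j p) (p + 2)) := by
  have huv : v ≠ u := by rintro rfl; have := h.irrefl v; omega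
  have hpv := h.dcol_pos hvu
  have hpu := h.dcol_pos (show A 0 u v = c + 1 by rw [h.symm, hvu])
  have hd := recoloured_three (A := A) (p := p) huv hcj
  refine ha.step (fun x y => ?_) (fun x i _ k _ => ?_) (fun x y hxy => ?_)
  · by_cases hx : A 0 x y = 0
    · omega
    · exact (h.row x (h.supp x y hx)).le y
  · rw [pend_recoloured huv, hd, hd]
    by_cases hx : x = v ∨ x = u
    · simp only [hx, if_true]
      split_ifs <;> grind
    · simp only [hx, if_false]
      omega
  · rw [recoloured_zero] at hxy ⊢
    by_cases h' : (x = v ∧ y = u) ∨ (x = u ∧ y = v)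
    · right
      refine ⟨0, by simp, fun i hi => ?_⟩
      rw [if_pos h']
      have := hmin i hi
      rcases h' with ⟨rfl, rfl⟩ | ⟨rfl, rfl⟩
      all_goals
        simp only [hd, Nat.add_sub_cancel, true_or, or_true, if_true, if_neg hcj.symm]
        split_ifs <;> grind
    · left
      rw [if_neg h'] at hxy ⊢
      push Not at h'
      exact ⟨rfl, hW x y hxy (by grind) (by grind)⟩

end recoloured

end Splitter

/-! ### Checking one edge -/

namespace Splitter

open Finset Imp WordRAM

/-- The colour table after the output `out`, started from the table `base`. -/
def tableAfter (base : DynGraph.Table) (out : List (ℕ × ℕ × ℕ)) : DynGraph.Table :=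
  out.foldl (fun c r => Function.update c s(r.1, r.2.1) (some r.2.2)) base

/-- The parameters of the algorithm during one update: number of vertices, number of colours, degree
bound, threshold for recolouring, number of checks per stack entry, row length of the arrays, bound
for all values, bound for the height of the stack, and the colour table before any output. -/
structure Par where
  n : ℕ
  t : ℕ
  Δ : ℕ
  θ : ℕ
  K : ℕ
  N : ℕ
  B : ℕ
  H : ℕ
  base : DynGraph.Table

/-- The parameters fit together. The bound `B` leaves room for sums of two colour degrees and for
the threshold, and for the height of the stack. -/
structure Par.Ok (P : Par) : Prop where
  t_pos : 0 < P.t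
  two_le : 2 ≤ P.θ
  K_pos : 0 < P.K
  Δ_pos : 0 < P.Δ
  le_N : P.n + P.t ≤ P.N
  le_B : 2 * P.n + P.t + P.Δ + P.θ + P.K + 3 ≤ P.B
  H_le : P.H + 3 ≤ P.B

/-- What holds at all times while edges are checked. Register `13` is the height of the stack. Its
sum with the potential does not increase, since a recolouring adds two stack entries and lowers the
potential by at least `t * θ ≥ 2`; this bounds the addresses used for the stack. -/
structure Inv (P : Par) (s : St) : Prop where
  r3 : s.reg 3 = P.n
  r4 : s.reg 4 = P.t
  r5 : s.reg 5 = P.Δ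
  r7 : s.reg 7 = P.N
  r11 : s.reg 11 = P.θ
  r12 : s.reg 12 = P.K
  r15 : s.reg 15 = 0
  r16 : s.reg 16 = 1
  core : Core P.n P.t s.arr
  stk : ∀ k < s.reg 13, s.arr 8 k 0 < P.n
  height : (s.reg 13 : ℤ) + pot P.n P.t (s.arr 3) ≤ P.H
  table : ∀ u v, s.arr 0 u v ≠ 0 → tableAfter P.base s.out s(u, v) = some (s.arr 0 u v - 1)

theorem Core.congr {n t : ℕ} {A A' : ℕ → ℕ → ℕ → ℕ} (h : Core n t A)
    (hA : ∀ k ≤ 4, A' k = A k) : Core n t A' := by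
  constructor
  · rw [hA 0 (by omega)]; exact h.symm
  · rw [hA 0 (by omega)]; exact h.irrefl
  · rw [hA 0 (by omega)]; exact h.supp
  · rw [hA 0 (by omega), hA 1 (by omega), hA 2 (by omega), hA 3 (by omega), hA 4 (by omega)]
    exact h.row

theorem Inv.congr {P : Par} {s s' : St} (h : Inv P s)
    (hr : ∀ k, 3 ≤ k → k < 20 → k ≠ 8 → k ≠ 9 → k ≠ 10 → k ≠ 14 → s'.reg k = s.reg k)
    (hA : ∀ k, k ≤ 4 ∨ k = 8 → s'.arr k = s.arr k) (ho : s'.out = s.out) : Inv P s' := by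
  have e : ∀ k, 3 ≤ k ∧ k < 20 ∧ k ≠ 8 ∧ k ≠ 9 ∧ k ≠ 10 ∧ k ≠ 14 → s'.reg k = s.reg k :=
    fun k ⟨h1, h2, h3, h4, h5, h6⟩ => hr k h1 h2 h3 h4 h5 h6
  exact ⟨(e 3 (by omega)).trans h.r3, (e 4 (by omega)).trans h.r4, (e 5 (by omega)).trans h.r5,
    (e 7 (by omega)).trans h.r7, (e 11 (by omega)).trans h.r11, (e 12 (by omega)).trans h.r12,
    (e 15 (by omega)).trans h.r15, (e 16 (by omega)).trans h.r16,
    h.core.congr fun k hk => hA k (Or.inl hk),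
    by rw [e 13 (by omega), hA 8 (by omega)]; exact h.stk,
    by rw [e 13 (by omega), hA 3 (by omega)]; exact h.height,
    by rw [hA 0 (by omega), ho]; exact h.table⟩

/-- The allowances of a state, see `Aged`. -/
abbrev AgedSt (P : Par) (W : ℕ → ℕ → ℕ) (s : St) : Prop :=
  Aged P.t P.θ P.K W (s.arr 0) (s.arr 3) (pend s.arr (s.reg 13))

/-- From `s` to `s'`, the only changes to the data, apart from the stack and the pointers in array
`5`, are `r` recolourings, made in at most `T` steps. -/
structure Change (P : Par) (s s' : St) (r T : ℕ) : Prop where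
  reg : ∀ k < 20, k ≠ 13 → s'.reg k = s.reg k
  arr : ∀ k, k ≠ 0 → k ≠ 3 → k ≠ 5 → k ≠ 8 → s'.arr k = s.arr k
  nz : ∀ x y, s'.arr 0 x y = 0 ↔ s.arr 0 x y = 0
  out : s'.out.length = s.out.length + r
  pot : pot P.n P.t (s'.arr 3) + P.t * P.θ * r ≤ pot P.n P.t (s.arr 3)
  tm : s'.tm ≤ s.tm + T

theorem Change.trans {P : Par} {s s' s'' : St} {r r' T T' : ℕ} (h : Change P s s' r T)
    (h' : Change P s' s'' r' T') : Change P s s'' (r + r') (T + T') where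
  reg k hk hk' := by rw [h'.reg k hk hk', h.reg k hk hk']
  arr k h0 h3 h5 h8 := by rw [h'.arr k h0 h3 h5 h8, h.arr k h0 h3 h5 h8]
  nz x y := (h'.nz x y).trans (h.nz x y)
  out := by rw [h'.out, h.out]; ring
  pot := by have := h.pot; have := h'.pot; push_cast; linarith
  tm := by have := h.tm; have := h'.tm; omega

/-- From `s` to `s'`, the only changes to the data are `r` recolourings, made in at most `T`
steps. -/
structure Evolve (P : Par) (s s' : St) (r T : ℕ) : Prop extends Change P s s' r T where
  sp : s'.reg 13 = s.reg 13 + 2 * r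
  ptr : s'.arr 5 = s.arr 5

theorem Evolve.trans {P : Par} {s s' s'' : St} {r r' T T' : ℕ} (h : Evolve P s s' r T)
    (h' : Evolve P s' s'' r' T') : Evolve P s s'' (r + r') (T + T') where
  toChange := h.toChange.trans h'.toChange
  sp := by rw [h'.sp, h.sp]; ring
  ptr := by rw [h'.ptr, h.ptr]

/-- Steps that change only registers from `20` on. -/
theorem Evolve.of_eq {P : Par} {s s' : St} {T : ℕ} (hr : ∀ k < 20, s'.reg k = s.reg k)
    (hA : s'.arr = s.arr) (ho : s'.out = s.out) (hT : s'.tm ≤ s.tm + T) : Evolve P s s' 0 T where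
  reg k hk _ := hr k hk
  arr k _ _ _ _ := by rw [hA]
  nz x y := by rw [hA]
  out := by rw [ho]; rfl
  pot := by rw [hA]; simp
  tm := hT
  sp := by rw [hr 13 (by omega)]; rfl
  ptr := by rw [hA]

/-- Array entry `[x, i]` of the colour degrees up or down by one. -/
def bump (o : BinOp) (x i : ℕ) : Cmd := .get 41 3 x i ;; .op o 41 41 16 ;; .put 3 x i 41

/-- Push the content of register `x`. -/
def push (x : ℕ) : Cmd := .put 8 13 15 x ;; .op .add 13 13 16

/-- Give the edge between registers `20` and `32` the colour in register `37` instead of the one in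
register `33`. -/
def recolourCmd : Cmd :=
  .op .add 40 37 16 ;; .put 0 20 32 40 ;; .put 0 32 20 40 ;;
  bump .sub 20 33 ;; bump .sub 32 33 ;; bump .add 20 37 ;; bump .add 32 37 ;;
  .report 20 32 37 ;; push 20 ;; push 32

/-- Body of the loop that finds the colour (register `37`) with the smallest sum (register `36`) of
the colour degrees at the vertices in registers `20` and `32`. -/
def argminBody : Cmd :=
  .get 39 3 20 35 ;; .get 40 3 32 35 ;; .op .add 39 39 40 ;; .op .lt 40 39 36 ;;
  .ite 40 (.mov 36 39 ;; .mov 37 35) (.const 40 0) ;;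
  .op .add 35 35 16 ;; .op .lt 38 35 4

/-- Check the edge in the slot given by register `21` of the vertex in register `20`, and recolour
it if it gains more than the threshold. Nothing is done if the slot is empty. -/
def check : Cmd :=
  .get 30 4 20 15 ;; .op .lt 31 21 30 ;;
  .ite 31
    (.get 32 2 20 21 ;; .get 33 0 20 32 ;; .op .sub 33 33 16 ;;
     .get 34 3 20 33 ;; .get 35 3 32 33 ;; .op .add 34 34 35 ;;
     .mov 36 34 ;; .mov 37 33 ;; .const 35 0 ;; .op .lt 38 35 4 ;;
     .loop 38 argminBody ;;
     .op .add 40 36 11 ;; .op .lt 40 40 34 ;;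
     .ite 40 recolourCmd (.const 40 0))
    (.const 31 0)

section specs

variable {P : Par} {s : St} {Q : St → Prop}

theorem Core.dcol_le {n t : ℕ} {A : ℕ → ℕ → ℕ → ℕ} (h : Core n t A) {v i : ℕ} (hv : v < n)
    (hi : i < t) : A 3 v i ≤ n := by
  rw [(h.row v hv).dcol i hi]
  exact rowCount_le _ _ _

theorem Core.deg_le {n t : ℕ} {A : ℕ → ℕ → ℕ → ℕ} (h : Core n t A) {v : ℕ} (hv : v < n) :
    A 4 v 0 ≤ n := by
  have := (h.row v hv).deg
  omega

theorem argmin_spec (hP : P.Ok) (h : Inv P s) {v u b : ℕ} (hv : v < P.n) (hu : u < P.n)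
    (h20 : s.reg 20 = v) (h32 : s.reg 32 = u) (h35 : s.reg 35 = 0) (h37 : s.reg 37 = b)
    (hb : b < P.t) (h36 : s.reg 36 = s.arr 3 v b + s.arr 3 u b) (h38 : s.reg 38 = 1)
    (hQ : ∀ reg tm b', (∀ k < 35, reg k = s.reg k) → reg 37 = b' → b' < P.t →
      reg 36 = s.arr 3 v b' + s.arr 3 u b' →
      (b' = b ∨ s.arr 3 v b' + s.arr 3 u b' < s.arr 3 v b + s.arr 3 u b) →
      (∀ i < P.t, s.arr 3 v b' + s.arr 3 u b' ≤ s.arr 3 v i + s.arr 3 u i) →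
      tm ≤ s.tm + 40 * P.t + 1 → Q ⟨reg, s.arr, s.out, tm⟩) :
    Spec P.N P.B (.loop 38 argminBody) s Q := by
  have hN := hP.le_N
  have hB := hP.le_B
  refine spec_loop (m := P.t) (fun m s' => ∃ i b', m + i = P.t ∧ s'.arr = s.arr ∧ s'.out = s.out ∧
    (∀ k < 35, s'.reg k = s.reg k) ∧ s'.reg 35 = i ∧ s'.reg 37 = b' ∧ b' < P.t ∧
    s'.reg 36 = s.arr 3 v b' + s.arr 3 u b' ∧
    (b' = b ∨ s.arr 3 v b' + s.arr 3 u b' < s.arr 3 v b + s.arr 3 u b) ∧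
    (∀ k < i, s.arr 3 v b' + s.arr 3 u b' ≤ s.arr 3 v k + s.arr 3 u k) ∧
    s'.reg 38 = (if i < P.t then 1 else 0) ∧ s'.tm ≤ s.tm + 40 * i) ?_ ?_ ?_
  · refine ⟨0, b, by omega, rfl, rfl, fun _ _ => rfl, h35, h37, hb, h36, Or.inl rfl, by simp, ?_,
      by omega⟩
    rw [h38, if_pos hP.t_pos]
  · rintro m ⟨reg, arr, out, tm⟩ ⟨i, b', hm, rfl, rfl, hreg, e35, e37, hb', e36, hbb, hmin, e38, htm⟩
      hne
    dsimp only at *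
    have hi : i < P.t := by
      by_contra hcon
      rw [e38, if_neg hcon] at hne
      exact hne rfl
    have e20 : reg 20 = v := by rw [hreg 20 (by omega), h20]
    have e32 : reg 32 = u := by rw [hreg 32 (by omega), h32]
    have e4 : reg 4 = P.t := by rw [hreg 4 (by omega), h.r4]
    have e7 : reg 7 = P.N := by rw [hreg 7 (by omega), h.r7]
    have e16 : reg 16 = 1 := by rw [hreg 16 (by omega), h.r16]
    have d1 := h.core.dcol_le hv hi
    have d2 := h.core.dcol_le hu hi
    have d3 := h.core.dcol_le hv hb'
    have d4 := h.core.dcol_le hu hb'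
    simp only [argminBody, spec_seq, spec_get, spec_op, spec_ite, spec_mov, spec_const, opOk, opVal,
      Function.update_apply, e20, e32, e4, e7, e16, e35, e36]
    norm_num
    refine ⟨⟨by omega, by omega⟩, ⟨by omega, by omega⟩, by omega, fun hlt => ?_, fun hge => ?_⟩
    · refine ⟨by omega, by omega, by omega, m - 1, by omega, i + 1, by omega, ?_, rfl, hi, ?_, ?_,
        by omega⟩
      · intro k hk
        have : k ≠ 38 ∧ k ≠ 35 ∧ k ≠ 37 ∧ k ≠ 36 ∧ k ≠ 40 ∧ k ≠ 39 := by omega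
        simp [this, hreg k hk]
      · rcases hbb with rfl | hbb
        · exact Or.inr hlt
        · exact Or.inr (by omega)
      · intro k hk
        rcases Nat.lt_succ_iff_lt_or_eq.1 hk with hk | rfl
        · have := hmin k hk
          omega
        · exact le_rfl
    · refine ⟨by omega, by omega, m - 1, by omega, i + 1, by omega, ?_, rfl, ?_, ?_, ?_, ?_,
        by omega⟩
      · intro k hk
        have : k ≠ 38 ∧ k ≠ 35 ∧ k ≠ 37 ∧ k ≠ 36 ∧ k ≠ 40 ∧ k ≠ 39 := by omega
        simp [this, hreg k hk]
      · rwa [e37]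
      · rw [e37]
      · rwa [e37]
      · intro k hk
        rw [e37]
        rcases Nat.lt_succ_iff_lt_or_eq.1 hk with hk | rfl
        · exact hmin k hk
        · omega
  · rintro m ⟨reg, arr, out, tm⟩ ⟨i, b', hm, rfl, rfl, hreg, e35, e37, hb', e36, hbb, hmin, e38, htm⟩
      hz
    dsimp only at *
    have hi : ¬ i < P.t := by
      intro hcon
      rw [e38, if_pos hcon] at hz
      omega
    have : i ≤ P.t := by omega
    exact hQ reg _ b' hreg e37 hb' e36 hbb (fun k hk => hmin k (by omega)) (by
      have := Nat.mul_le_mul_left 40 this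
      omega)

theorem recolour_spec (hP : P.Ok) (h : Inv P s) {v u c j : ℕ} (h20 : s.reg 20 = v)
    (h32 : s.reg 32 = u) (h33 : s.reg 33 = c) (h37 : s.reg 37 = j) (hvu : s.arr 0 v u = c + 1)
    (hj : j < P.t) (hcj : c ≠ j)
    (hQ : ∀ reg tm, (∀ k < 40, k ≠ 13 → reg k = s.reg k) → reg 13 = s.reg 13 + 2 →
      tm ≤ s.tm + 110 →
      Q ⟨reg, recoloured s.arr v u c j (s.reg 13), s.out ++ [(v, u, j)], tm⟩) :
    Spec P.N P.B recolourCmd s Q := by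
  have hN := hP.le_N
  have hB := hP.le_B
  have hH := hP.H_le
  have hv : v < P.n := h.core.supp v u (by omega)
  have hu : u < P.n := h.core.supp u v (by rw [h.core.symm]; omega)
  have hc : c < P.t := by
    have := (h.core.row v hv).le u
    omega
  have huv : v ≠ u := by rintro rfl; have := h.core.irrefl v; omega
  have hsp : s.reg 13 ≤ P.H := by
    have := h.height
    have := pot_nonneg P.n P.t (s.arr 3)
    omega
  have d1 := h.core.dcol_le hv hc
  have d2 := h.core.dcol_le hu hc
  have d3 := h.core.dcol_le hv hj
  have d4 := h.core.dcol_le hu hj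
  have p1 := h.core.dcol_pos hvu
  have p2 := h.core.dcol_pos (show s.arr 0 u v = c + 1 by rw [h.core.symm, hvu])
  simp only [recolourCmd, bump, push, spec_seq, spec_get, spec_put, spec_op, spec_report, opOk,
    opVal, Function.update_apply, h20, h32, h33, h37, h.r15, h.r16, h.r7]
  norm_num
  have e1 : upd (upd s.arr 0 v u (j + 1)) 0 u v (j + 1) 3 = s.arr 3 := by
    rw [upd_ne _ (by omega), upd_ne _ (by omega)]
  have e2 : ∀ a, upd (upd (upd s.arr 0 v u (j + 1)) 0 u v (j + 1)) 3 v c a 3 u c = s.arr 3 u c := by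
    intro a
    rw [upd_row_ne _ huv.symm, e1]
  have e3 : ∀ a b, upd (upd (upd (upd s.arr 0 v u (j + 1)) 0 u v (j + 1)) 3 v c a) 3 u c b 3 v j
      = s.arr 3 v j := by
    intro a b
    rw [upd_row_ne _ huv, upd_row, Function.update_of_ne hcj.symm, e1]
  have e4 : ∀ a b d, upd (upd (upd (upd (upd s.arr 0 v u (j + 1)) 0 u v (j + 1)) 3 v c a) 3 u c b)
      3 v j d 3 u j = s.arr 3 u j := by
    intro a b d
    rw [upd_row_ne _ huv.symm, upd_row, Function.update_of_ne hcj.symm, upd_row_ne _ huv.symm, e1]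
  have e5 : ∀ a b, upd (upd (upd (upd s.arr 0 v u (j + 1)) 0 u v (j + 1)) 3 v c a) 3 u c b 3 u j
      = s.arr 3 u j := by
    intro a b
    rw [upd_row, Function.update_of_ne hcj.symm, upd_row_ne _ huv.symm, e1]
  simp only [e1, e2, e3, e4]
  refine ⟨by omega, ⟨by omega, by omega⟩, ⟨by omega, by omega⟩, ⟨by omega, by omega⟩,
    ⟨by omega, by omega⟩, ⟨by omega, by omega⟩, ⟨by omega, by omega⟩, ⟨by omega, by omega⟩,
    ⟨by omega, by omega⟩, ⟨by omega, by omega⟩, by omega, ⟨by omega, by omega⟩,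
    ⟨by omega, by omega⟩, by omega, ⟨by omega, by omega⟩, ⟨by omega, by omega⟩, by omega,
    ⟨by omega, by omega⟩, by omega, ?_⟩
  have harr : recoloured s.arr v u c j (s.reg 13) = upd (upd (upd (upd (upd (upd
      (upd (upd s.arr 0 v u (j + 1)) 0 u v (j + 1)) 3 v c (s.arr 3 v c - 1)) 3 u c
      (s.arr 3 u c - 1)) 3 v j (s.arr 3 v j + 1)) 3 u j (s.arr 3 u j + 1)) 8 (s.reg 13) 0 v) 8
      (s.reg 13 + 1) 0 u := by
    simp only [recoloured, e1, e3, e5]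
  rw [← harr]
  refine hQ _ _ (fun k hk hk' => ?_) (by simp) (by omega)
  have : k ≠ 40 ∧ k ≠ 41 := by omega
  simp [this, hk']

/-- The effect of `check` on the slot `a` of the vertex `v`: the edge in this slot no longer needs
an allowance, and the allowances of all other edges remain valid. -/
theorem check_spec (hP : P.Ok) (h : Inv P s) {v a : ℕ} (hv : v < P.n) (h20 : s.reg 20 = v)
    (h21 : s.reg 21 = a)
    (hQ : ∀ s' r, Inv P s' → Evolve P s s' r (300 * P.t) →
      (∀ k < 30, k ≠ 13 → s'.reg k = s.reg k) →
      (∀ W W', AgedSt P W s → (∀ x y, s.arr 0 x y ≠ 0 → ¬ (x = v ∧ s.arr 1 x y = a) →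
        ¬ (y = v ∧ s.arr 1 y x = a) → W x y ≤ W' x y) → AgedSt P W' s') → Q s') :
    Spec P.N P.B check s Q := by
  have hN := hP.le_N
  have hB := hP.le_B
  have ht := hP.t_pos
  have hdeg := h.core.deg_le hv
  have hrow := h.core.row v hv
  -- Nothing but registers from `30` on and the step count has changed.
  have hsame : ∀ reg tm, (∀ k < 30, reg k = s.reg k) → tm ≤ s.tm + 300 * P.t →
      (∀ W W', AgedSt P W s → (∀ x y, s.arr 0 x y ≠ 0 → ¬ (x = v ∧ s.arr 1 x y = a) →
        ¬ (y = v ∧ s.arr 1 y x = a) → W x y ≤ W' x y) → AgedSt P W' s) →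
      Q ⟨reg, s.arr, s.out, tm⟩ := by
    intro reg tm hreg htm hW
    have e13 := hreg 13 (by omega)
    refine hQ _ 0 ?_ ?_ (fun k hk _ => hreg k hk) ?_
    · exact h.congr (fun k _ hk _ _ _ _ => hreg k (by omega)) (fun _ _ => rfl) rfl
    · exact Evolve.of_eq (fun k hk => hreg k (by omega)) rfl rfl htm
    · intro W W' h1 h2
      have := hW W W' h1 h2
      simpa only [AgedSt, e13] using this
  simp only [check, spec_seq, spec_get, spec_op, spec_ite, spec_const, opOk, opVal,
    Function.update_apply, h20, h21, h.r15, h.r7]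
  norm_num
  refine ⟨⟨by omega, by omega⟩, fun ha => ?_, fun ha => ⟨by omega, ?_⟩⟩
  swap
  · -- The slot is empty.
    refine hsame _ _ (fun k hk => ?_) (by omega) ?_
    · have : k ≠ 30 ∧ k ≠ 31 := by omega
      simp [this]
    · intro W W' h1 h2
      have hC : ∀ x y, s.arr 0 x y ≤ P.t := by
        intro x y
        by_cases hxy : s.arr 0 x y = 0
        · omega
        · exact (h.core.row x (h.core.supp x y hxy)).le y
      refine h1.step hC (fun x i _ j _ => by omega) (fun x y hxy => Or.inl ⟨rfl, ?_⟩)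
      refine h2 x y hxy ?_ ?_
      · rintro ⟨rfl, h3⟩
        have := (hrow.pos y hxy).1
        omega
      · rintro ⟨rfl, h3⟩
        have := (hrow.pos x (by rwa [h.core.symm])).1
        omega
  · obtain ⟨hne, hpos⟩ := hrow.slot a ha
    set u := s.arr 2 v a with hu_def
    have hu : u < P.n := hrow.supp u hne
    obtain ⟨c, hc⟩ : ∃ c, s.arr 0 v u = c + 1 := ⟨s.arr 0 v u - 1, by omega⟩
    have hct : c < P.t := by have := hrow.le u; omega
    have d1 := h.core.dcol_le hv hct
    have d2 := h.core.dcol_le hu hct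
    simp only [hc, spec_mov, Function.update_apply, h.r4, h.r16, Nat.add_sub_cancel]
    norm_num
    refine ⟨⟨by omega, by omega⟩, ⟨by omega, by omega⟩, by omega, ⟨by omega, by omega⟩,
      ⟨by omega, by omega⟩, by omega, by omega, by omega, ?_⟩
    refine argmin_spec (v := v) (u := u) (b := c) hP ?_ hv hu (by simpa using h20) (by simp)
      (by simp) (by simp) hct (by simp) (by simp [ht]) ?_
    · refine h.congr (fun k _ hk _ _ _ _ => ?_) (fun _ _ => rfl) rfl
      have : k ≠ 38 ∧ k ≠ 35 ∧ k ≠ 37 ∧ k ≠ 36 ∧ k ≠ 34 ∧ k ≠ 33 ∧ k ≠ 32 ∧ k ≠ 31 ∧ k ≠ 30 := by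
        omega
      simp [this]
    intro reg tm j hreg e37 hj e36 hjc hmin htm
    have hreg' : ∀ k < 30, reg k = s.reg k := by
      intro k hk
      rw [hreg k (by omega)]
      have : k ≠ 38 ∧ k ≠ 35 ∧ k ≠ 37 ∧ k ≠ 36 ∧ k ≠ 34 ∧ k ≠ 33 ∧ k ≠ 32 ∧ k ≠ 31 ∧ k ≠ 30 := by
        omega
      simp [this]
    have e33 : reg 33 = c := by rw [hreg 33 (by omega)]; simp
    have e32 : reg 32 = u := by rw [hreg 32 (by omega)]; simp
    have e34 : reg 34 = s.arr 3 v c + s.arr 3 u c := by rw [hreg 34 (by omega)]; simp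
    have e11 : reg 11 = P.θ := by rw [hreg' 11 (by omega), h.r11]
    dsimp only at e36 hjc hmin htm ⊢
    simp only [e36, e34, e11]
    have hjle := hmin c hct
    refine ⟨by omega, fun hlt => ?_, fun hge => ⟨by omega, ?_⟩⟩
    · -- The edge is recoloured.
      have hcj : c ≠ j := by rintro rfl; omega
      refine recolour_spec (v := v) (u := u) (c := c) (j := j) hP (s := ⟨_, _, _, _⟩) ?_ ?_ ?_ ?_ ?_
        hc hj hcj ?_
      · refine h.congr (fun k _ hk _ _ _ _ => ?_) (fun _ _ => rfl) rfl
        have : k ≠ 40 := by omega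
        simp [this, hreg' k (by omega)]
      · simp [hreg' 20 (by omega), h20]
      · simp [e32]
      · simp [e33]
      · simp [e37]
      intro reg' tm' hr' e13 htm'
      dsimp only at hr' e13 htm' ⊢
      have hreg'' : ∀ k < 30, k ≠ 13 → reg' k = s.reg k := by
        intro k hk hk'
        have : k ≠ 40 := by omega
        rw [hr' k (by omega) hk', Function.update_of_ne this, hreg' k hk]
      have e13' : reg' 13 = s.reg 13 + 2 := by
        rw [e13, Function.update_of_ne (by omega), hreg' 13 (by omega)]
      have e13'' : ∀ x, Function.update reg 40 x 13 = s.reg 13 := by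
        intro x
        rw [Function.update_of_ne (by omega), hreg' 13 (by omega)]
      simp only [e13'']
      have huv : v ≠ u := by rintro h'; rw [← h'] at hc; have := h.core.irrefl v; omega
      have hpot := pot_recoloured (p := s.reg 13) h.core hc hj hcj hP.two_le hlt
      refine hQ _ 1 ?_ ?_ hreg'' ?_
      · refine ⟨(hreg'' 3 (by omega) (by omega)).trans h.r3,
          (hreg'' 4 (by omega) (by omega)).trans h.r4, (hreg'' 5 (by omega) (by omega)).trans h.r5,
          (hreg'' 7 (by omega) (by omega)).trans h.r7,
          (hreg'' 11 (by omega) (by omega)).trans h.r11,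
          (hreg'' 12 (by omega) (by omega)).trans h.r12,
          (hreg'' 15 (by omega) (by omega)).trans h.r15,
          (hreg'' 16 (by omega) (by omega)).trans h.r16, h.core.recolour hc hj hcj, ?_, ?_, ?_⟩
        · intro k hk
          dsimp only at hk ⊢
          rw [e13'] at hk
          by_cases hk' : k < s.reg 13
          · rw [recoloured_eight hk']
            exact h.stk k hk'
          · rcases (by omega : k = s.reg 13 ∨ k = s.reg 13 + 1) with rfl | rfl
            · simpa [recoloured, upd] using hv
            · simpa [recoloured, upd] using hu
        · dsimp only
          rw [e13']
          have h1 := h.height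
          have h2 : (2 : ℤ) ≤ P.t * P.θ := by
            have := Nat.mul_le_mul ht hP.two_le
            exact_mod_cast this
          push_cast
          linarith
        · intro x y hxy
          dsimp only at hxy ⊢
          rw [recoloured_zero] at hxy ⊢
          rw [tableAfter, List.foldl_append, ← tableAfter]
          show Function.update (tableAfter P.base s.out) s(v, u) (some j) s(x, y) = _
          by_cases h3 : (x = v ∧ y = u) ∨ (x = u ∧ y = v)
          · rw [if_pos h3]
            have : s(x, y) = s(v, u) := by
              rcases h3 with ⟨rfl, rfl⟩ | ⟨rfl, rfl⟩
              · rfl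
              · exact Sym2.eq_swap
            rw [this]
            simp
          · rw [if_neg h3] at hxy ⊢
            rw [Function.update_of_ne, h.table x y hxy]
            intro h4
            exact h3 (by simpa using h4)
      · refine ⟨⟨fun k hk hk' => hreg'' k (by omega) hk',
          fun k h0 h3 _ h8 => recoloured_ne h0 h3 h8, fun x y => ?_, by simp, by simpa using hpot, ?_⟩,
          by simp [e13'], ?_⟩
        · dsimp only
          rw [recoloured_zero]
          split_ifs with h3
          · rcases h3 with ⟨rfl, rfl⟩ | ⟨rfl, rfl⟩
            · simp [hc]
            · simp [h.core.symm u, hc]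
          · rfl
        · dsimp only
          omega
        · exact recoloured_ne (A := s.arr) (v := v) (u := u) (c := c) (j := j) (p := s.reg 13) (k := 5)
            (by omega) (by omega) (by omega)
      · intro W W' hW hWW'
        have := Aged.recolour h.core hc hj hcj hP.two_le hW hlt hmin (W' := W') (fun x y h1 h2 h3 =>
          hWW' x y h1 ?_ ?_)
        · simpa only [AgedSt, e13'] using this
        · rintro ⟨rfl, h4⟩
          exact h2 ⟨rfl, by rw [hu_def, ← h4, (hrow.pos y h1).2]⟩
        · rintro ⟨rfl, h4⟩
          exact h3 ⟨by rw [hu_def, ← h4, (hrow.pos x (by rwa [h.core.symm])).2], rfl⟩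
    · refine hsame _ _ (fun k hk => ?_) (by omega) ?_
      · have : k ≠ 40 := by omega
        simp [this, hreg' k hk]
      · intro W W' h1 h2
        have hC : ∀ x y, s.arr 0 x y ≤ P.t := by
          intro x y
          by_cases hxy : s.arr 0 x y = 0
          · omega
          · exact (h.core.row x (h.core.supp x y hxy)).le y
        refine h1.step hC (fun x i _ j _ => by omega) (fun x y hxy => ?_)
        by_cases h3 : (x = v ∧ y = u) ∨ (x = u ∧ y = v)
        · right
          refine ⟨0, by simp, fun i hi => ?_⟩
          have := hmin i hi
          rcases h3 with ⟨rfl, rfl⟩ | ⟨rfl, rfl⟩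
          · rw [hc, Nat.add_sub_cancel]; omega
          · rw [h.core.symm, hc, Nat.add_sub_cancel]; omega
        · left
          refine ⟨rfl, h2 x y hxy ?_ ?_⟩
          · rintro ⟨rfl, h4⟩
            exact h3 (Or.inl ⟨rfl, by rw [hu_def, ← h4, (hrow.pos y hxy).2]⟩)
          · rintro ⟨rfl, h4⟩
            exact h3 (Or.inr ⟨by rw [hu_def, ← h4, (hrow.pos x (by rwa [h.core.symm])).2], rfl⟩)

end specs

end Splitter

/-! ### Working off the stack -/

namespace Splitter

open Finset Imp WordRAM

/-- The number of steps since the pointer of `x` has left the slot of `y`. The pointer runs through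
`0, …, Δ - 1` cyclically, and `Δ` is added because the subtraction is truncated. -/
def age (Δ : ℕ) (A : ℕ → ℕ → ℕ → ℕ) (x y : ℕ) : ℕ := (A 5 x 0 + Δ - 1 - A 1 x y) % Δ

/-- The allowance of an edge while `r` checks at the vertex `v` are still due: each check at one of
its ends since its own last check there was paid for with a part `1 / K` of a stack entry, and such
an entry stands for a gain of at most two. -/
def allow (Δ : ℕ) (A : ℕ → ℕ → ℕ → ℕ) (v r x y : ℕ) : ℕ :=
  2 * (age Δ A x y + if x = v then r else 0) + 2 * (age Δ A y x + if y = v then r else 0)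

theorem age_lt {Δ : ℕ} (hΔ : 0 < Δ) (A : ℕ → ℕ → ℕ → ℕ) (x y : ℕ) : age Δ A x y < Δ :=
  Nat.mod_lt _ hΔ

theorem age_step {Δ p a : ℕ} (hp : p < Δ) (ha : a < Δ) (hne : a ≠ p) :
    ((p + 1) % Δ + Δ - 1 - a) % Δ = (p + Δ - 1 - a) % Δ + 1 := by
  by_cases h : p + 1 = Δ
  · rw [h, Nat.mod_self, show 0 + Δ - 1 - a = Δ - 1 - a by omega, Nat.mod_eq_of_lt (by omega),
      show p + Δ - 1 - a = (p - 1 - a) + Δ by omega, Nat.add_mod_right,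
      Nat.mod_eq_of_lt (by omega)]
    omega
  · rw [Nat.mod_eq_of_lt (show p + 1 < Δ by omega)]
    by_cases h' : a < p
    · rw [show p + 1 + Δ - 1 - a = (p - a) + Δ by omega,
        show p + Δ - 1 - a = (p - 1 - a) + Δ by omega, Nat.add_mod_right, Nat.add_mod_right,
        Nat.mod_eq_of_lt (by omega), Nat.mod_eq_of_lt (by omega)]
      omega
    · rw [Nat.mod_eq_of_lt (by omega), Nat.mod_eq_of_lt (by omega)]
      omega

/-- Slots and pointers are below the degree bound. -/
structure Ptr (P : Par) (A : ℕ → ℕ → ℕ → ℕ) : Prop where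
  deg : ∀ v < P.n, A 4 v 0 ≤ P.Δ
  ptr : ∀ v, A 5 v 0 < P.Δ

/-- Check the slot under the pointer (register `21`) of the vertex in register `20`, advance the
pointer, and count down register `22`. -/
def scanBody : Cmd :=
  .get 21 5 20 15 ;; check ;; .op .add 21 21 16 ;; .op .mod 21 21 5 ;; .put 5 20 15 21 ;;
  .op .sub 22 22 16

/-- Work off the stack: for every entry, a fixed number of checks is made. -/
def drain : Cmd :=
  .loop 13 (.op .sub 13 13 16 ;; .get 20 8 13 15 ;; .mov 22 12 ;; .loop 22 scanBody)

section specs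

variable {P : Par} {s : St} {Q : St → Prop}

theorem Core.slot_lt {n t : ℕ} {A : ℕ → ℕ → ℕ → ℕ} (h : Core n t A) {x y : ℕ}
    (hxy : A 0 x y ≠ 0) : A 1 x y < A 4 x 0 :=
  ((h.row x (h.supp x y hxy)).pos y hxy).1

theorem Inv.sp_le (h : Inv P s) : s.reg 13 ≤ P.H := by
  have := h.height
  have := pot_nonneg P.n P.t (s.arr 3)
  omega

theorem scanBody_spec (hP : P.Ok) (h : Inv P s) (hp : Ptr P s.arr) {v r : ℕ} (hv : v < P.n)
    (h20 : s.reg 20 = v) (h22 : s.reg 22 = r + 1) (hr : r + 1 < P.B)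
    (hA : AgedSt P (allow P.Δ s.arr v (r + 1)) s)
    (hQ : ∀ s' k, Inv P s' → Ptr P s'.arr → s'.reg 20 = v → s'.reg 22 = r →
      AgedSt P (allow P.Δ s'.arr v r) s' → Change P s s' k (320 * P.t) →
      s'.reg 13 = s.reg 13 + 2 * k → Q s') :
    Spec P.N P.B scanBody s Q := by
  have hN := hP.le_N
  have hB := hP.le_B
  have ht := hP.t_pos
  have hΔ := hP.Δ_pos
  have hpv := hp.ptr v
  simp only [scanBody, spec_seq, spec_get, h20, h.r15, h.r7]
  refine ⟨⟨trivial, by omega, by omega⟩, check_spec (v := v) (a := s.arr 5 v 0) (s := ⟨_, _, _, _⟩) hP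
    (h.congr (fun k _ hk _ _ _ _ => Function.update_of_ne (by omega) _ _) (fun _ _ => rfl) rfl) hv
    (by simpa using h20) (by simp) ?_⟩
  intro s' k hI hE hreg hW
  dsimp only at hreg hW
  have hreg' : ∀ i < 30, i ≠ 13 → i ≠ 21 → s'.reg i = s.reg i := fun i hi h13 h21 => by
    rw [hreg i hi h13, Function.update_of_ne h21]
  have e20 : s'.reg 20 = v := by rw [hreg' 20 (by omega) (by omega) (by omega), h20]
  have e21 : s'.reg 21 = s.arr 5 v 0 := by rw [hreg 21 (by omega) (by omega)]; simp
  have e22 : s'.reg 22 = r + 1 := by rw [hreg' 22 (by omega) (by omega) (by omega), h22]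
  have h5 : s'.arr 5 = s.arr 5 := hE.ptr
  have h1 : s'.arr 1 = s.arr 1 := hE.arr 1 (by omega) (by omega) (by omega) (by omega)
  have h4 : s'.arr 4 = s.arr 4 := hE.arr 4 (by omega) (by omega) (by omega) (by omega)
  simp only [spec_op, spec_put, opOk, opVal, Function.update_apply, e20, e21, e22, hI.r15,
    hI.r7, hI.r16, hI.r5]
  norm_num
  refine ⟨by omega, by omega, by omega, ?_⟩
  have hupd : ∀ i ≠ 5, ∀ z, upd s'.arr 5 v 0 z i = s'.arr i := fun i hi z => upd_ne _ hi
  refine hQ ⟨_, _, _, _⟩ k ?_ ?_ ?_ ?_ ?_ ?_ ?_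
  · refine hI.congr (fun i _ hi _ _ _ _ => ?_) (fun i hi => hupd i (by omega) _) rfl
    have : i ≠ 21 ∧ i ≠ 22 := by omega
    simp [this]
  · constructor
    · dsimp only
      rw [hupd 4 (by omega), h4]
      exact hp.deg
    · intro x
      simp only [upd]
      split_ifs
      · exact Nat.mod_lt _ hΔ
      · rw [h5]; exact hp.ptr x
  · simp [e20]
  · simp
  · have := hW _ (allow P.Δ (upd s'.arr 5 v 0 ((s.arr 5 v 0 + 1) % P.Δ)) v r) hA ?_
    · dsimp only [AgedSt] at this ⊢
      rw [hupd 0 (by omega), hupd 3 (by omega)]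
      convert this using 1
      funext x
      simp only [Function.update_apply]
      norm_num
      exact pend_congr (fun k _ => by rw [hupd 8 (by omega)]) x
    · intro x y hxy hnx hny
      have key : ∀ x y, s.arr 0 x y ≠ 0 → ¬ (x = v ∧ s.arr 1 x y = s.arr 5 v 0) →
          age P.Δ s.arr x y + (if x = v then r + 1 else 0) ≤
          age P.Δ (upd s'.arr 5 v 0 ((s.arr 5 v 0 + 1) % P.Δ)) x y + if x = v then r else 0 := by
        intro x y hxy hnx
        have hlt : s.arr 1 x y < P.Δ :=
          (h.core.slot_lt hxy).trans_le (hp.deg x (h.core.supp x y hxy))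
        unfold age
        rw [hupd 1 (by omega), h1]
        by_cases hx : x = v
        · subst hx
          have : upd s'.arr 5 x 0 ((s.arr 5 x 0 + 1) % P.Δ) 5 x 0 = (s.arr 5 x 0 + 1) % P.Δ := by
            simp [upd]
          rw [this, age_step hpv hlt (fun h' => hnx ⟨rfl, h'⟩), if_pos rfl, if_pos rfl]
          omega
        · have : upd s'.arr 5 v 0 ((s.arr 5 v 0 + 1) % P.Δ) 5 x 0 = s.arr 5 x 0 := by
            simp [upd, hx, h5]
          rw [this, if_neg hx, if_neg hx]
      have k1 := key x y hxy hnx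
      have k2 := key y x (by rwa [h.core.symm]) hny
      unfold allow
      omega
  · refine ⟨fun i hi h13 => ?_, fun i h0 h3 h5' h8 => ?_, fun x y => ?_, hE.out, ?_, ?_⟩
    · have : i ≠ 21 ∧ i ≠ 22 := by omega
      simp [this, hreg' i (by omega) h13]
    · dsimp only
      rw [hupd i h5']
      exact hE.arr i h0 h3 h5' h8
    · dsimp only
      rw [hupd 0 (by omega)]
      exact hE.nz x y
    · dsimp only
      rw [hupd 3 (by omega)]
      exact hE.pot
    · have := hE.tm
      dsimp only at this ⊢
      omega
  · have := hE.sp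
    simpa using this

theorem Inv.tick (h : Inv P s) (k : ℕ) : Inv P ⟨s.reg, s.arr, s.out, s.tm + k⟩ :=
  h.congr (fun _ _ _ _ _ _ _ => rfl) (fun _ _ => rfl) rfl

theorem Change.tick (P : Par) (s : St) (k : ℕ) :
    Change P s ⟨s.reg, s.arr, s.out, s.tm + k⟩ 0 k :=
  (Evolve.of_eq (s := s) (s' := ⟨s.reg, s.arr, s.out, s.tm + k⟩) (fun _ _ => rfl) rfl rfl
    le_rfl).toChange

theorem Change.mono {s s' : St} {r T T' : ℕ} (h : Change P s s' r T) (hT : T ≤ T') :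
    Change P s s' r T' :=
  { h with tm := h.tm.trans (by omega) }

theorem scan_spec (hP : P.Ok) (h : Inv P s) (hp : Ptr P s.arr) {v r : ℕ} (hv : v < P.n)
    (h20 : s.reg 20 = v) (h22 : s.reg 22 = r) (hr : r < P.B)
    (hA : AgedSt P (allow P.Δ s.arr v r) s)
    (hQ : ∀ s' k, Inv P s' → Ptr P s'.arr → AgedSt P (allow P.Δ s'.arr v 0) s' →
      Change P s s' k (r * (322 * P.t) + 1) → s'.reg 13 = s.reg 13 + 2 * k → Q s') :
    Spec P.N P.B (.loop 22 scanBody) s Q := by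
  have ht := hP.t_pos
  refine spec_loop (m := r) (fun m s' => ∃ i k, m + i = r ∧ Inv P s' ∧ Ptr P s'.arr ∧
    s'.reg 20 = v ∧ s'.reg 22 = m ∧ AgedSt P (allow P.Δ s'.arr v m) s' ∧
    Change P s s' k (i * (322 * P.t)) ∧ s'.reg 13 = s.reg 13 + 2 * k) ?_ ?_ ?_
  · exact ⟨0, 0, rfl, h, hp, h20, h22, hA, (Change.tick P s 0).mono (by simp), rfl⟩
  · rintro m s₁ ⟨i, k, hm, hI, hp₁, e20, e22, hA₁, hC, hsp⟩ hne
    obtain ⟨m', rfl⟩ : ∃ m', m = m' + 1 := ⟨m - 1, by omega⟩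
    refine scanBody_spec (s := ⟨_, _, _, _⟩) hP (hI.tick 2) hp₁ hv e20 e22 (by omega) hA₁ ?_
    intro s₂ k₂ hI₂ hp₂ f20 f22 hA₂ hC₂ hsp₂
    refine ⟨m', by omega, i + 1, k + (0 + k₂), by omega, hI₂, hp₂, f20, f22, hA₂,
      (hC.trans ((Change.tick P s₁ 2).trans hC₂)).mono (by nlinarith), ?_⟩
    dsimp only at hsp₂
    omega
  · rintro m s₁ ⟨i, k, hm, hI, hp₁, e20, e22, hA₁, hC, hsp⟩ hz
    obtain rfl : m = 0 := by omega
    obtain rfl : i = r := by omega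
    exact hQ _ k (hI.tick 1) hp₁ hA₁ (hC.trans (Change.tick P s₁ 1)) hsp

/-- Working off the stack: at the end, no edge needs an allowance for unfinished work, and the
number of steps is proportional to the number of stack entries worked off. -/
theorem drain_spec (hP : P.Ok) (h : Inv P s) (hp : Ptr P s.arr)
    (hA : AgedSt P (allow P.Δ s.arr 0 0) s)
    (hQ : ∀ s' k, Inv P s' → Ptr P s'.arr → s'.reg 13 = 0 →
      AgedSt P (allow P.Δ s'.arr 0 0) s' →
      Change P s s' k (350 * P.t * P.K * (s.reg 13 + 2 * k) + 1) → Q s') :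
    Spec P.N P.B drain s Q := by
  have hN := hP.le_N
  have hB := hP.le_B
  have hH := hP.H_le
  have ht := hP.t_pos
  have hK := hP.K_pos
  have htK : 1 ≤ P.t * P.K := Nat.mul_pos ht hK
  have h0 : ∀ A v, allow P.Δ A v 0 = allow P.Δ A 0 0 := by
    intro A v; funext x y; simp [allow]
  refine spec_loop (m := 2 * (pot P.n P.t (s.arr 3)).toNat + s.reg 13) (fun m s' =>
    m = 2 * (pot P.n P.t (s'.arr 3)).toNat + s'.reg 13 ∧ Inv P s' ∧ Ptr P s'.arr ∧ ∃ k T,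
    AgedSt P (allow P.Δ s'.arr 0 0) s' ∧ Change P s s' k T ∧
    T + 350 * P.t * P.K * s'.reg 13 ≤ 350 * P.t * P.K * (s.reg 13 + 2 * k)) ?_ ?_ ?_
  · exact ⟨rfl, h, hp, 0, 0, hA, Change.tick P s 0, by simp⟩
  · rintro m s₁ ⟨rfl, hI, hp₁, k, T, hA₁, hC, hT⟩ hne
    obtain ⟨p, hpe⟩ : ∃ p, s₁.reg 13 = p + 1 := ⟨s₁.reg 13 - 1, by omega⟩
    have hsp := hI.sp_le
    have hv : s₁.arr 8 p 0 < P.n := hI.stk p (by omega)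
    simp only [spec_seq, spec_op, spec_get, spec_mov, opOk, opVal, Function.update_apply, hI.r16,
      hI.r15, hI.r7, hI.r12, hpe]
    norm_num
    refine ⟨by omega, ⟨by omega, by omega⟩, by omega, ?_⟩
    have hI' : Inv P ⟨Function.update (Function.update (Function.update s₁.reg 13 p) 20
        (s₁.arr 8 p 0)) 22 P.K, s₁.arr, s₁.out, s₁.tm + 2 + 1 + 7 + 2⟩ := by
      refine ⟨by simp [hI.r3], by simp [hI.r4], by simp [hI.r5], by simp [hI.r7], by simp [hI.r11],
        by simp [hI.r12], by simp [hI.r15], by simp [hI.r16], hI.core, ?_, ?_, hI.table⟩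
      · intro j hj
        refine hI.stk j ?_
        simp at hj
        omega
      · have := hI.height
        rw [hpe] at this
        push_cast at this
        simp
        omega
    refine scan_spec (v := s₁.arr 8 p 0) (r := P.K) hP hI' hp₁ hv (by simp) (by simp) (by omega)
      ?_ ?_
    · intro x y hxy j hj
      have := hA₁ x y hxy j hj
      dsimp only at this hxy ⊢
      simp only [Function.update_apply]
      norm_num
      rw [hpe, pend_succ, pend_succ] at this
      simp only [allow, ite_self] at this ⊢
      have e : ∀ z, (2 * P.K) * (if z = s₁.arr 8 p 0 then 1 else 0)
          = 2 * if z = s₁.arr 8 p 0 then P.K else 0 := by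
        intro z; split_ifs <;> simp
      have e1 := e x
      have e2 := e y
      linarith
    · intro s₂ k₂ hI₂ hp₂ hA₂ hC₂ hsp₂
      rw [h0] at hA₂
      have hC₀ : Change P s₁ ⟨Function.update (Function.update (Function.update s₁.reg 13 p) 20
          (s₁.arr 8 p 0)) 22 P.K, s₁.arr, s₁.out, s₁.tm + 2 + 1 + 7 + 2⟩ 0 12 := by
        refine ⟨fun i hi h13 => ?_, fun _ _ _ _ _ => rfl, fun _ _ => Iff.rfl, rfl, by simp, by
          dsimp only; omega⟩
        have : i ≠ 20 ∧ i ≠ 22 := by omega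
        simp [this, h13]
      have hC' := hC₀.trans hC₂
      have hpot := hC'.pot
      have hpos₁ := pot_nonneg P.n P.t (s₁.arr 3)
      have hpos₂ := pot_nonneg P.n P.t (s₂.arr 3)
      have hsp₂' : s₂.reg 13 = p + 2 * k₂ := by simpa using hsp₂
      have h2 : (2 * k₂ : ℤ) ≤ P.t * P.θ * (0 + k₂ : ℕ) := by
        have h3 : 2 ≤ P.t * P.θ := le_trans hP.two_le (Nat.le_mul_of_pos_left _ ht)
        have := Nat.mul_le_mul_right k₂ h3
        rw [zero_add]
        exact_mod_cast this
      refine ⟨_, ?_, rfl, hI₂, hp₂, hA₂, k + (0 + k₂), _, hC.trans hC', ?_⟩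
      · omega
      · have e1 : 350 * P.t * P.K * s₁.reg 13 = 350 * (P.t * P.K) * p + 350 * (P.t * P.K) := by
          rw [hpe]; ring
        have e2 : 350 * P.t * P.K * s₂.reg 13
            = 350 * (P.t * P.K) * p + 700 * ((P.t * P.K) * k₂) := by
          rw [hsp₂']; ring
        have e3 : 350 * P.t * P.K * (s.reg 13 + 2 * (k + (0 + k₂)))
            = 350 * P.t * P.K * (s.reg 13 + 2 * k) + 700 * ((P.t * P.K) * k₂) := by ring
        have e4 : P.K * (322 * P.t) = 322 * (P.t * P.K) := by ring
        rw [e3, e2, e4]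
        rw [e1] at hT
        omega
  · rintro m s₁ ⟨rfl, hI, hp₁, k, T, hA₁, hC, hT⟩ hz
    rw [hz, mul_zero, add_zero] at hT
    exact hQ _ k (hI.tick 1) hp₁ hz hA₁ ((hC.trans (Change.tick P s₁ 1)).mono (by omega))

end specs

end Splitter

/-! ### Rescanning all edges -/

namespace Splitter

open Finset Imp WordRAM

/-- The list of touched vertices: array `7` holds `c` different vertices, array `6` marks them, and
all vertices with positive degree are among them. -/
structure Touch (n c : ℕ) (A : ℕ → ℕ → ℕ → ℕ) : Prop where
  lt : ∀ k < c, A 7 k 0 < n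
  inj : ∀ k < c, ∀ l < c, A 7 k 0 = A 7 l 0 → k = l
  flag : ∀ k < c, A 6 (A 7 k 0) 0 ≠ 0
  mem : ∀ v < n, A 6 v 0 ≠ 0 → ∃ k < c, A 7 k 0 = v
  deg : ∀ v < n, A 4 v 0 ≠ 0 → A 6 v 0 ≠ 0

theorem Touch.congr {n c : ℕ} {A A' : ℕ → ℕ → ℕ → ℕ} (h : Touch n c A) (h4 : A' 4 = A 4)
    (h6 : A' 6 = A 6) (h7 : A' 7 = A 7) : Touch n c A' := by
  obtain ⟨a, b, c, d, e⟩ := h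
  constructor <;> simpa only [h4, h6, h7]

theorem Touch.le {n c : ℕ} {A : ℕ → ℕ → ℕ → ℕ} (h : Touch n c A) : c ≤ n := by
  have := card_le_card_of_injOn (s := range c) (t := range n) (fun k => A 7 k 0)
    (fun k hk => by simpa using h.lt k (by simpa using hk))
    (fun k hk l hl hkl => h.inj k (by simpa using hk) l (by simpa using hl) hkl)
  simpa using this

/-- The sum of the degrees over the list of touched vertices is at most the total degree. -/
theorem Touch.sum_le {n c : ℕ} {A : ℕ → ℕ → ℕ → ℕ} (h : Touch n c A) :
    ∑ k ∈ range c, A 4 (A 7 k 0) 0 ≤ ∑ v ∈ range n, A 4 v 0 := by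
  rw [← sum_image (s := range c) (g := fun k => A 7 k 0) (f := fun v => A 4 v 0)
    (fun k hk l hl hkl => h.inj k (by simpa using hk) l (by simpa using hl) hkl)]
  refine sum_le_sum_of_subset fun v hv => ?_
  obtain ⟨k, hk, rfl⟩ := mem_image.1 hv
  simpa using h.lt k (by simpa using hk)

/-- Check all slots of the vertex in register `20`. -/
def rescanVertex : Cmd :=
  .loop 27 (check ;; .op .add 21 21 16 ;; .op .lt 27 21 26)

/-- Check all edges. -/
def rescan : Cmd :=
  .const 24 0 ;; .op .lt 25 24 14 ;;
  .loop 25 (.get 20 7 24 15 ;; .get 26 4 20 15 ;; .const 21 0 ;; .op .lt 27 21 26 ;;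
    rescanVertex ;; .op .add 24 24 16 ;; .op .lt 25 24 14)

section specs

variable {P : Par} {s : St} {Q : St → Prop}

theorem Evolve.tick (P : Par) (s : St) (k : ℕ) :
    Evolve P s ⟨s.reg, s.arr, s.out, s.tm + k⟩ 0 k :=
  Evolve.of_eq (s := s) (s' := ⟨s.reg, s.arr, s.out, s.tm + k⟩) (fun _ _ => rfl) rfl rfl le_rfl

theorem Evolve.mono {s s' : St} {r T T' : ℕ} (h : Evolve P s s' r T) (hT : T ≤ T') :
    Evolve P s s' r T' :=
  { h with tm := h.tm.trans (by omega) }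

theorem rescanVertex_spec (hP : P.Ok) (h : Inv P s) {v : ℕ} (hv : v < P.n) (h20 : s.reg 20 = v)
    (h21 : s.reg 21 = 0) (h26 : s.reg 26 = s.arr 4 v 0)
    (h27 : s.reg 27 = if 0 < s.arr 4 v 0 then 1 else 0) {W : ℕ → ℕ → ℕ} (hW : AgedSt P W s)
    (hQ : ∀ s' k, Inv P s' → Evolve P s s' k (310 * P.t * s.arr 4 v 0 + 1) →
      s'.reg 24 = s.reg 24 → AgedSt P (fun x y => if x = v ∨ y = v then 0 else W x y) s' → Q s') :
    Spec P.N P.B rescanVertex s Q := by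
  have hN := hP.le_N
  have hB := hP.le_B
  have ht := hP.t_pos
  have hg := h.core.deg_le hv
  have hrow := h.core.row v hv
  refine spec_loop (m := s.arr 4 v 0) (fun m s' => ∃ a k, m + a = s.arr 4 v 0 ∧ Inv P s' ∧
    s'.reg 20 = v ∧ s'.reg 21 = a ∧ s'.reg 24 = s.reg 24 ∧ s'.reg 26 = s.arr 4 v 0 ∧
    s'.reg 27 = (if a < s.arr 4 v 0 then 1 else 0) ∧ Evolve P s s' k (310 * P.t * a) ∧
    AgedSt P (fun x y => if (x = v ∧ s.arr 1 x y < a) ∨ (y = v ∧ s.arr 1 y x < a) then 0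
      else W x y) s') ?_ ?_ ?_
  · refine ⟨0, 0, rfl, h, h20, h21, rfl, h26, h27, Evolve.tick P s 0, ?_⟩
    simpa using hW
  · rintro m s₁ ⟨a, k, hm, hI, e20, e21, e24, e26, e27, hE, hA⟩ hne
    have ha : a < s.arr 4 v 0 := by
      by_contra hcon
      rw [e27, if_neg hcon] at hne
      exact hne rfl
    refine spec_seq.2 (check_spec (v := v) (a := a) (s := ⟨_, _, _, _⟩) hP (hI.tick 2) hv e20 e21 ?_)
    intro s₂ k₂ hI₂ hE₂ hreg₂ hW₂
    dsimp only at hreg₂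
    have f21 : s₂.reg 21 = a := by rw [hreg₂ 21 (by omega) (by omega), e21]
    have f20 : s₂.reg 20 = v := by rw [hreg₂ 20 (by omega) (by omega), e20]
    have f24 : s₂.reg 24 = s.reg 24 := by rw [hreg₂ 24 (by omega) (by omega), e24]
    have f26 : s₂.reg 26 = s.arr 4 v 0 := by rw [hreg₂ 26 (by omega) (by omega), e26]
    simp only [spec_seq, spec_op, opOk, opVal, Function.update_apply, f21, f26, hI₂.r16]
    norm_num
    refine ⟨by omega, m - 1, by omega, a + 1, by omega, ?_, f20, rfl, f24, rfl,
      ⟨k + (0 + (k₂ + 0)), ?_⟩, ?_⟩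
    · refine hI₂.congr (fun i _ hi _ _ _ _ => ?_) (fun _ _ => rfl) rfl
      have : i ≠ 21 ∧ i ≠ 27 := by omega
      simp [this]
    · refine Evolve.mono (hE.trans ((Evolve.tick P s₁ 2).trans (hE₂.trans (Evolve.of_eq (T := 2)
        (fun i hi => ?_) rfl rfl (by dsimp only; omega))))) (by nlinarith)
      have : i ≠ 21 ∧ i ≠ 27 := by omega
      simp [this]
    · have h1 : s₁.arr 1 = s.arr 1 := hE.arr 1 (by omega) (by omega) (by omega) (by omega)
      have := hW₂ _ (fun x y => if (x = v ∧ s.arr 1 x y < a + 1) ∨ (y = v ∧ s.arr 1 y x < a + 1)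
        then 0 else W x y) hA (fun x y hxy hx hy => ?_)
      · simpa [AgedSt] using this
      · dsimp only at hx hy ⊢
        rw [h1] at hx hy
        split_ifs with g1 g2 g2
        · exact le_rfl
        · exact Nat.zero_le _
        · exfalso
          omega
        · exact le_rfl
  · rintro m s₁ ⟨a, k, hm, hI, e20, e21, e24, e26, e27, hE, hA⟩ hz
    have ha : a = s.arr 4 v 0 := by
      by_contra hcon
      rw [e27, if_pos (by omega)] at hz
      omega
    subst ha
    refine hQ _ _ (hI.tick 1) (hE.trans (Evolve.tick P s₁ 1)) e24 ?_
    refine Aged.step hA (fun x y => ?_) (fun x i _ j _ => by dsimp only; omega)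
      (fun x y hxy => Or.inl ⟨rfl, ?_⟩)
    · by_cases hxy : s₁.arr 0 x y = 0
      · omega
      · exact (hI.core.row x (hI.core.supp x y hxy)).le y
    · dsimp only at hxy ⊢
      have hxy' : s.arr 0 x y ≠ 0 := fun h' => hxy ((hE.nz x y).2 h')
      split_ifs with g1 g2 g2
      · exact le_rfl
      · exact Nat.zero_le _
      · exfalso
        apply g1
        rcases g2 with rfl | rfl
        · exact Or.inl ⟨rfl, (hrow.pos y hxy').1⟩
        · exact Or.inr ⟨rfl, (hrow.pos x (by rwa [h.core.symm])).1⟩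
      · exact le_rfl

/-- After all edges have been checked, no edge needs an allowance other than that for the stack. -/
theorem rescan_spec (hP : P.Ok) (h : Inv P s) (hT : Touch P.n (s.reg 14) s.arr)
    (hQ : ∀ s' k, Inv P s' →
      Evolve P s s' k (310 * P.t * (s.reg 14 + ∑ v ∈ range P.n, s.arr 4 v 0 + 1)) →
      AgedSt P (fun _ _ => 0) s' → Q s') :
    Spec P.N P.B rescan s Q := by
  have hN := hP.le_N
  have hB := hP.le_B
  have ht := hP.t_pos
  have hc := hT.le
  simp only [rescan, spec_seq, spec_const, spec_op, opOk, opVal, Function.update_apply]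
  norm_num
  refine ⟨by omega, spec_loop (m := s.reg 14) (fun m s' => ∃ i k, m + i = s.reg 14 ∧ Inv P s' ∧
    s'.reg 24 = i ∧ s'.reg 25 = (if i < s.reg 14 then 1 else 0) ∧
    Evolve P s s' k (∑ l ∈ range i, (310 * P.t * s.arr 4 (s.arr 7 l 0) 0 + 30) + 2) ∧
    AgedSt P (fun x y => if ∃ l < i, s.arr 7 l 0 = x ∨ s.arr 7 l 0 = y then 0
      else P.K * (2 * P.n)) s') ?_ ?_ ?_⟩
  · refine ⟨0, 0, rfl, ?_, by simp, by simp, ?_, ?_⟩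
    · refine h.congr (fun i _ hi _ _ _ _ => ?_) (fun _ _ => rfl) rfl
      have : i ≠ 24 ∧ i ≠ 25 := by omega
      simp [this]
    · refine Evolve.of_eq (fun i hi => ?_) rfl rfl (by simp)
      have : i ≠ 24 ∧ i ≠ 25 := by omega
      simp [this]
    · intro x y hxy j hj
      dsimp only at hxy ⊢
      have hx := h.core.supp x y hxy
      have hy := h.core.supp y x (by rwa [h.core.symm])
      have hi : s.arr 0 x y - 1 < P.t := by
        have := (h.core.row x hx).le y
        omega
      have d1 := h.core.dcol_le hx hi
      have d2 := h.core.dcol_le hy hi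
      have := Nat.mul_le_mul_left P.K (show s.arr 3 x (s.arr 0 x y - 1) +
        s.arr 3 y (s.arr 0 x y - 1) ≤ 2 * P.n by omega)
      rw [if_neg (by simp)]
      omega
  · rintro m s₁ ⟨i, k, hm, hI, e24, e25, hE, hA⟩ hne
    have hi : i < s.reg 14 := by
      by_contra hcon
      rw [e25, if_neg hcon] at hne
      exact hne rfl
    have h7 : s₁.arr 7 = s.arr 7 := hE.arr 7 (by omega) (by omega) (by omega) (by omega)
    have h4 : s₁.arr 4 = s.arr 4 := hE.arr 4 (by omega) (by omega) (by omega) (by omega)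
    have hv := hT.lt i hi
    have e14 : s₁.reg 14 = s.reg 14 := hE.reg 14 (by omega) (by omega)
    simp only [spec_seq, spec_const, spec_op, spec_get, opOk, opVal, Function.update_apply, e24,
      hI.r15, hI.r7, h7, h4]
    norm_num
    refine ⟨⟨by omega, by omega⟩, ⟨by omega, by omega⟩, by omega, ?_⟩
    have hreg : ∀ k < 20, Function.update (Function.update (Function.update (Function.update
        s₁.reg 20 (s.arr 7 i 0)) 26 (s.arr 4 (s.arr 7 i 0) 0)) 21 0) 27
        (if 0 < s.arr 4 (s.arr 7 i 0) 0 then 1 else 0) k = s₁.reg k := by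
      intro k hk
      have : k ≠ 20 ∧ k ≠ 26 ∧ k ≠ 21 ∧ k ≠ 27 := by omega
      simp [this]
    refine rescanVertex_spec (v := s.arr 7 i 0) (W := fun x y => if ∃ l < i, s.arr 7 l 0 = x ∨
      s.arr 7 l 0 = y then 0 else P.K * (2 * P.n)) hP ?_ hv (by simp) (by simp)
      (by simp [h4]) (by simp [h4]) ?_ ?_
    · refine hI.congr (fun i _ hi _ _ _ _ => ?_) (fun _ _ => rfl) rfl
      have : i ≠ 20 ∧ i ≠ 26 ∧ i ≠ 21 ∧ i ≠ 27 := by omega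
      simp [this]
    · simpa [AgedSt] using hA
    intro s₂ k₂ hI₂ hE₂ f24 hA₂
    have f24' : s₂.reg 24 = i := by rw [f24]; simp [e24]
    have f14 : s₂.reg 14 = s.reg 14 := by
      rw [hE₂.reg 14 (by omega) (by omega)]; simp [e14]
    simp only [f24', f14, hI₂.r16]
    refine ⟨by omega, m - 1, by omega, i + 1, by omega, ?_, rfl, rfl,
      ⟨k + (0 + (k₂ + 0)), ?_⟩, ?_⟩
    · refine hI₂.congr (fun i _ hi _ _ _ _ => ?_) (fun _ _ => rfl) rfl
      have : i ≠ 24 ∧ i ≠ 25 := by omega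
      simp [this]
    · have hE₁ : Evolve P s₁ ⟨Function.update (Function.update (Function.update (Function.update
          s₁.reg 20 (s.arr 7 i 0)) 26 (s.arr 4 (s.arr 7 i 0) 0)) 21 0) 27
          (if 0 < s.arr 4 (s.arr 7 i 0) 0 then 1 else 0), s₁.arr, s₁.out,
          s₁.tm + 2 + 7 + 7 + 1 + 1⟩ 0 18 :=
        Evolve.of_eq hreg rfl rfl (by dsimp only; omega)
      have hE₃ : Evolve P s₂ ⟨Function.update (Function.update s₂.reg 24 (i + 1)) 25
          (if i + 1 < s.reg 14 then 1 else 0), s₂.arr, s₂.out, s₂.tm + 1 + 1⟩ 0 2 := by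
        refine Evolve.of_eq (fun i hi => ?_) rfl rfl (by dsimp only; omega)
        have : i ≠ 24 ∧ i ≠ 25 := by omega
        simp [this]
      refine Evolve.mono (hE.trans (hE₁.trans (hE₂.trans hE₃))) ?_
      dsimp only
      rw [sum_range_succ, h4]
      omega
    · simp only [AgedSt, Function.update_apply] at hA₂ ⊢
      norm_num
      convert hA₂ using 1
      funext x y
      by_cases g : ∃ l < i, s.arr 7 l 0 = x ∨ s.arr 7 l 0 = y
      · obtain ⟨l, hl, hl'⟩ := g
        rw [if_pos ⟨l, by omega, hl'⟩]
        simp only [if_pos (show ∃ l < i, s.arr 7 l 0 = x ∨ s.arr 7 l 0 = y from ⟨l, hl, hl'⟩),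
          ite_self]
      · by_cases g' : x = s.arr 7 i 0 ∨ y = s.arr 7 i 0
        · rw [if_pos g', if_pos ⟨i, by omega, by tauto⟩]
        · rw [if_neg g', if_neg g, if_neg]
          rintro ⟨l, hl, hl'⟩
          rcases Nat.lt_or_eq_of_le (by omega : l ≤ i) with hl | rfl
          · exact g ⟨l, hl, hl'⟩
          · exact g' (by tauto)
  · rintro m s₁ ⟨i, k, hm, hI, e24, e25, hE, hA⟩ hz
    have hi : i = s.reg 14 := by
      by_contra hcon
      rw [e25, if_pos (by omega)] at hz
      omega
    subst hi
    refine hQ _ _ (hI.tick 1) (Evolve.mono (hE.trans (Evolve.tick P s₁ 1)) ?_) ?_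
    · rw [sum_add_distrib, ← mul_sum, sum_const, card_range, smul_eq_mul]
      have := Nat.mul_le_mul_left (310 * P.t) hT.sum_le
      nlinarith
    · refine Aged.step hA (fun x y => ?_) (fun x i _ j _ => by dsimp only; omega)
        (fun x y hxy => Or.inl ⟨rfl, ?_⟩)
      · by_cases hxy : s₁.arr 0 x y = 0
        · omega
        · exact (hI.core.row x (hI.core.supp x y hxy)).le y
      · dsimp only at hxy ⊢
        have hxy' : s.arr 0 x y ≠ 0 := fun h' => hxy ((hE.nz x y).2 h')
        have hx := h.core.supp x y hxy'
        have hdeg : s.arr 4 x 0 ≠ 0 := by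
          have := h.core.slot_lt hxy'
          omega
        obtain ⟨l, hl, hl'⟩ := hT.mem x hx (hT.deg x hx hdeg)
        rw [if_pos ⟨l, hl, Or.inl hl'⟩]

end specs

end Splitter

/-! ### Inserting and deleting an edge in the arrays -/

namespace Splitter

open Finset Imp WordRAM

/-- The arrays after the neighbour `y` has been appended, with colour `0`, to the row of `x`, and
`x` has been put on the stack at height `p`. -/
def insertHalf (A : ℕ → ℕ → ℕ → ℕ) (x y p : ℕ) : ℕ → ℕ → ℕ → ℕ :=
  upd (upd (upd (upd (upd (upd A 0 x y 1) 1 x y (A 4 x 0)) 2 x (A 4 x 0) y) 4 x 0 (A 4 x 0 + 1))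
    3 x 0 (A 3 x 0 + 1)) 8 p 0 x

/-- The arrays after the neighbour `y`, joined to `x` by an edge of colour `c`, has been removed
from the row of `x`, and `x` has been put on the stack at height `p`. The neighbour in the last slot
moves to the slot that has become free. -/
def deleteHalf (A : ℕ → ℕ → ℕ → ℕ) (x y c p : ℕ) : ℕ → ℕ → ℕ → ℕ :=
  upd (upd (upd (upd (upd (upd A 0 x y 0) 4 x 0 (A 4 x 0 - 1)) 2 x (A 1 x y) (A 2 x (A 4 x 0 - 1)))
    1 x (A 2 x (A 4 x 0 - 1)) (A 1 x y)) 3 x c (A 3 x c - 1)) 8 p 0 x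

/-- The arrays after the insertion of the edge `uv` with colour `0`. -/
def inserted (A : ℕ → ℕ → ℕ → ℕ) (u v p : ℕ) : ℕ → ℕ → ℕ → ℕ :=
  insertHalf (insertHalf A u v p) v u (p + 1)

/-- The arrays after the deletion of the edge `uv` of colour `c`. -/
def deleted (A : ℕ → ℕ → ℕ → ℕ) (u v c p : ℕ) : ℕ → ℕ → ℕ → ℕ :=
  deleteHalf (deleteHalf A u v c p) v u c (p + 1)

section arrays

variable {n t : ℕ} {A : ℕ → ℕ → ℕ → ℕ} {x y z u v c p k k' : ℕ}

theorem upd_apply_row_ne (a : ℕ) (hz : z ≠ x) : upd A k' x y a k z = A k z := by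
  funext b; simp [upd, hz]

theorem insertHalf_row_ne (hz : z ≠ x) (hk : k ≠ 8) : insertHalf A x y p k z = A k z := by
  simp only [insertHalf, upd_ne _ hk, upd_apply_row_ne _ hz]

theorem deleteHalf_row_ne (hz : z ≠ x) (hk : k ≠ 8) : deleteHalf A x y c p k z = A k z := by
  simp only [deleteHalf, upd_ne _ hk, upd_apply_row_ne _ hz]

theorem Row.insertHalf (h : Row n t (A 0 x) (A 1 x) (A 2 x) (A 3 x) (A 4 x 0)) (hxy : A 0 x y = 0)
    (hy : y < n) (ht : 0 < t) :
    Row n t (insertHalf A x y p 0 x) (insertHalf A x y p 1 x) (insertHalf A x y p 2 x)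
      (insertHalf A x y p 3 x) (insertHalf A x y p 4 x 0) := by
  refine (h.insert hxy hy ht).congr ?_ ?_ ?_ ?_ ?_
  all_goals first | funext b | skip
  all_goals simp [Splitter.insertHalf, upd, Function.update_apply]

theorem Row.deleteHalf (h : Row n t (A 0 x) (A 1 x) (A 2 x) (A 3 x) (A 4 x 0))
    (hxy : A 0 x y = c + 1) :
    Row n t (deleteHalf A x y c p 0 x) (deleteHalf A x y c p 1 x) (deleteHalf A x y c p 2 x)
      (deleteHalf A x y c p 3 x) (deleteHalf A x y c p 4 x 0) := by
  refine (h.delete hxy).congr ?_ ?_ ?_ ?_ ?_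
  all_goals first | funext b | skip
  all_goals simp [Splitter.deleteHalf, upd, Function.update_apply]

theorem Row.of_eq {A' : ℕ → ℕ → ℕ → ℕ} (h : Row n t (A 0 x) (A 1 x) (A 2 x) (A 3 x) (A 4 x 0))
    (hA : ∀ k ≤ 4, A' k x = A k x) : Row n t (A' 0 x) (A' 1 x) (A' 2 x) (A' 3 x) (A' 4 x 0) :=
  h.congr (hA 0 (by omega)) (hA 1 (by omega)) (hA 2 (by omega)) (hA 3 (by omega))
    (congrFun (hA 4 (by omega)) 0)

theorem inserted_ne (h : 4 < k) (h8 : k ≠ 8) : inserted A u v p k = A k := by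
  have : k ≠ 0 ∧ k ≠ 1 ∧ k ≠ 2 ∧ k ≠ 3 ∧ k ≠ 4 := by omega
  simp [inserted, insertHalf, upd_ne, this, h8]

theorem deleted_ne (h : 4 < k) (h8 : k ≠ 8) : deleted A u v c p k = A k := by
  have : k ≠ 0 ∧ k ≠ 1 ∧ k ≠ 2 ∧ k ≠ 3 ∧ k ≠ 4 := by omega
  simp [deleted, deleteHalf, upd_ne, this, h8]

theorem inserted_zero (x y : ℕ) : inserted A u v p 0 x y =
    if (x = u ∧ y = v) ∨ (x = v ∧ y = u) then 1 else A 0 x y := by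
  simp only [inserted, insertHalf, upd]
  grind

theorem deleted_zero (x y : ℕ) : deleted A u v c p 0 x y =
    if (x = u ∧ y = v) ∨ (x = v ∧ y = u) then 0 else A 0 x y := by
  simp only [deleted, deleteHalf, upd]
  grind

theorem inserted_one (huv : u ≠ v) (x y : ℕ) : inserted A u v p 1 x y =
    if (x = u ∧ y = v) ∨ (x = v ∧ y = u) then A 4 x 0 else A 1 x y := by
  simp only [inserted, insertHalf, upd]
  grind

theorem deleted_one (huv : u ≠ v) (x y : ℕ) : deleted A u v c p 1 x y =
    if x = u ∧ y = A 2 u (A 4 u 0 - 1) then A 1 u v else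
      if x = v ∧ y = A 2 v (A 4 v 0 - 1) then A 1 v u else A 1 x y := by
  simp only [deleted, deleteHalf, upd]
  grind

theorem inserted_three (huv : u ≠ v) (x i : ℕ) : inserted A u v p 3 x i =
    A 3 x i + if (x = u ∨ x = v) ∧ i = 0 then 1 else 0 := by
  simp only [inserted, insertHalf, upd]
  grind

theorem deleted_three (huv : u ≠ v) (x i : ℕ) : deleted A u v c p 3 x i =
    A 3 x i - if (x = u ∨ x = v) ∧ i = c then 1 else 0 := by
  simp only [deleted, deleteHalf, upd]
  grind

theorem inserted_four (huv : u ≠ v) (x : ℕ) : inserted A u v p 4 x 0 =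
    A 4 x 0 + if x = u ∨ x = v then 1 else 0 := by
  simp only [inserted, insertHalf, upd]
  grind

theorem deleted_four (huv : u ≠ v) (x : ℕ) : deleted A u v c p 4 x 0 =
    A 4 x 0 - if x = u ∨ x = v then 1 else 0 := by
  simp only [deleted, deleteHalf, upd]
  grind

theorem pend_inserted (huv : u ≠ v) (x : ℕ) :
    pend (inserted A u v p) (p + 2) x = pend A p x + if x = u ∨ x = v then 1 else 0 := by
  rw [pend_succ, pend_succ, pend_congr (A := A) (fun k hk => ?_)]
  all_goals
    simp only [inserted, insertHalf, upd]
    grind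

theorem pend_deleted (huv : u ≠ v) (x : ℕ) :
    pend (deleted A u v c p) (p + 2) x = pend A p x + if x = u ∨ x = v then 1 else 0 := by
  rw [pend_succ, pend_succ, pend_congr (A := A) (fun k hk => ?_)]
  all_goals
    simp only [deleted, deleteHalf, upd]
    grind

theorem Core.insert (h : Core n t A) (hu : u < n) (hv : v < n) (huv : u ≠ v) (h0 : A 0 u v = 0)
    (ht : 0 < t) : Core n t (inserted A u v p) := by
  refine ⟨fun x y => ?_, fun x => ?_, fun x y hxy => ?_, fun x hx => ?_⟩
  · rw [inserted_zero, inserted_zero, h.symm x y]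
    congr 1
    grind
  · rw [inserted_zero, if_neg (by grind)]
    exact h.irrefl x
  · rw [inserted_zero] at hxy
    have := h.supp x y
    grind
  · by_cases hxv : x = v
    · subst hxv
      refine Row.insertHalf ((h.row x hx).of_eq fun k hk => insertHalf_row_ne huv.symm (by omega))
        ?_ hu ht
      rw [insertHalf_row_ne huv.symm (by omega), h.symm, h0]
    · by_cases hxu : x = u
      · subst hxu
        exact (Row.insertHalf (h.row x hx) h0 hv ht).of_eq fun k hk =>
          insertHalf_row_ne huv (by omega)
      · refine (h.row x hx).of_eq fun k hk => ?_
        rw [inserted, insertHalf_row_ne hxv (by omega), insertHalf_row_ne hxu (by omega)]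

theorem Core.delete (h : Core n t A) (huv : u ≠ v) (h0 : A 0 u v = c + 1) :
    Core n t (deleted A u v c p) := by
  refine ⟨fun x y => ?_, fun x => ?_, fun x y hxy => ?_, fun x hx => ?_⟩
  · rw [deleted_zero, deleted_zero, h.symm x y]
    congr 1
    grind
  · rw [deleted_zero, if_neg (by grind)]
    exact h.irrefl x
  · rw [deleted_zero] at hxy
    have := h.supp x y
    grind
  · by_cases hxv : x = v
    · subst hxv
      refine Row.deleteHalf ((h.row x hx).of_eq fun k hk => deleteHalf_row_ne huv.symm (by omega)) ?_
      rw [deleteHalf_row_ne huv.symm (by omega), h.symm, h0]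
    · by_cases hxu : x = u
      · subst hxu
        exact (Row.deleteHalf (h.row x hx) h0).of_eq fun k hk =>
          deleteHalf_row_ne huv (by omega)
      · refine (h.row x hx).of_eq fun k hk => ?_
        rw [deleted, deleteHalf_row_ne hxv (by omega), deleteHalf_row_ne hxu (by omega)]

/-- If all colour degrees at a vertex are within `X` of each other, the insertion or deletion of an
edge changes the potential by little. -/
theorem pot_update_le {X i : ℕ} {d d' : ℕ → ℕ → ℕ} (hu : u < n) (hv : v < n) (huv : u ≠ v)
    (hi : i < t) (h : ∀ x k, ¬ ((x = u ∨ x = v) ∧ k = i) → d' x k = d x k)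
    (hd : ∀ x, x = u ∨ x = v → d' x i = d x i + 1 ∨ d' x i + 1 = d x i)
    (hX : ∀ x < n, ∀ k < t, ∀ l < t, d x k ≤ d x l + X) :
    pot n t d' ≤ pot n t d + 2 * (2 * t * X + t) := by
  have key : ∀ x < n, x = u ∨ x = v → dev t (d' x) ≤ dev t (d x) + (2 * t * X + t) :=
    fun x hx hxuv => dev_update_le hi (fun k _ hk => h x k (by simp [hk])) (hd x hxuv) (hX x hx)
  rw [pot_update hu hv huv (fun x _ h1 h2 => funext fun k => h x k (by simp [h1, h2]))]
  have := key u hu (Or.inl rfl)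
  have := key v hv (Or.inr rfl)
  linarith

theorem pot_inserted {X : ℕ} (hu : u < n) (hv : v < n) (huv : u ≠ v) (ht : 0 < t)
    (hX : ∀ x < n, ∀ k < t, ∀ l < t, A 3 x k ≤ A 3 x l + X) :
    pot n t (inserted A u v p 3) ≤ pot n t (A 3) + 2 * (2 * t * X + t) := by
  refine pot_update_le hu hv huv ht (fun x k hk => ?_) (fun x hx => Or.inl ?_) hX
  · rw [inserted_three huv, if_neg hk]; rfl
  · rw [inserted_three huv, if_pos ⟨hx, rfl⟩]

theorem pot_deleted {X : ℕ} (h : Core n t A) (h0 : A 0 u v = c + 1) (huv : u ≠ v)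
    (hX : ∀ x < n, ∀ k < t, ∀ l < t, A 3 x k ≤ A 3 x l + X) :
    pot n t (deleted A u v c p 3) ≤ pot n t (A 3) + 2 * (2 * t * X + t) := by
  have h1 := h.dcol_pos h0
  have h0' : A 0 v u = c + 1 := by rw [h.symm, h0]
  have h2 := h.dcol_pos h0'
  have hu := h.supp u v (by omega)
  refine pot_update_le hu (h.supp v u (by omega)) huv (i := c) ?_ (fun x k hk => ?_)
    (fun x hx => Or.inr ?_) hX
  · have := (h.row u hu).le v
    omega
  · rw [deleted_three huv, if_neg hk]; rfl
  · rw [deleted_three huv, if_pos ⟨hx, rfl⟩]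
    rcases hx with rfl | rfl <;> omega

/-- After an insertion, only the new edge needs an additional allowance. -/
theorem Aged.insert {θ K : ℕ} {W : ℕ → ℕ → ℕ} (h : Core n t A) (huv : u ≠ v)
    (hA : Aged t θ K W (A 0) (A 3) (pend A p)) (hC : Core n t (inserted A u v p)) (ht : 0 < t) :
    Aged t θ K (fun x y => if (x = u ∧ y = v) ∨ (x = v ∧ y = u) then K * (2 * n) else W x y)
      (inserted A u v p 0) (inserted A u v p 3) (pend (inserted A u v p) (p + 2)) := by
  refine hA.step (fun x y => ?_) (fun x i _ k _ => ?_) (fun x y hxy => ?_)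
  · by_cases hx : A 0 x y = 0
    · omega
    · exact (h.row x (h.supp x y hx)).le y
  · rw [pend_inserted huv, inserted_three huv, inserted_three huv]
    grind
  · by_cases h' : (x = u ∧ y = v) ∨ (x = v ∧ y = u)
    · right
      refine ⟨2 * n, by simp [h'], fun i hi => ?_⟩
      have hi' : inserted A u v p 0 x y - 1 < t := by
        rw [inserted_zero, if_pos h']; omega
      have := hC.dcol_le (hC.supp x y hxy) hi'
      have := hC.dcol_le (hC.supp y x (by rwa [hC.symm])) hi'
      omega
    · left
      rw [if_neg h', inserted_zero, if_neg h']
      exact ⟨rfl, le_rfl⟩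

/-- A deletion does not make additional allowances necessary. -/
theorem Aged.delete {θ K : ℕ} {W : ℕ → ℕ → ℕ} (h : Core n t A) (huv : u ≠ v)
    (h0 : A 0 u v = c + 1) (hA : Aged t θ K W (A 0) (A 3) (pend A p)) :
    Aged t θ K W (deleted A u v c p 0) (deleted A u v c p 3) (pend (deleted A u v c p) (p + 2)) := by
  have h1 := h.dcol_pos h0
  have h2 := h.dcol_pos (show A 0 v u = c + 1 by rw [h.symm, h0])
  refine hA.step (fun x y => ?_) (fun x i _ k _ => ?_) (fun x y hxy => Or.inl ?_)
  · by_cases hx : A 0 x y = 0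
    · omega
    · exact (h.row x (h.supp x y hx)).le y
  · rw [pend_deleted huv, deleted_three huv, deleted_three huv]
    grind
  · rw [deleted_zero] at hxy ⊢
    split_ifs at hxy ⊢
    · exact absurd rfl hxy
    · exact ⟨rfl, le_rfl⟩

end arrays

end Splitter

/-! ### Inserting and deleting an edge by commands -/

namespace Splitter

open Finset Imp WordRAM

/-- Enter the vertex in register `x` in the list of touched vertices. -/
def touch (x : ℕ) : Cmd :=
  .get 26 6 x 15 ;;
  .ite 26 (.const 26 0) (.put 6 x 15 16 ;; .put 7 14 15 x ;; .op .add 14 14 16)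

/-- The command for `insertHalf`. -/
def insertHalfCmd (x y : ℕ) : Cmd :=
  .get 22 4 x 15 ;; .put 0 x y 16 ;; .put 1 x y 22 ;; .put 2 x 22 y ;; .op .add 22 22 16 ;;
  .put 4 x 15 22 ;; .get 22 3 x 15 ;; .op .add 22 22 16 ;; .put 3 x 15 22 ;; push x

/-- The command for `deleteHalf`, with the colour in register `28`. The slot that has become free
is put into register `z`. -/
def deleteHalfCmd (x y z : ℕ) : Cmd :=
  .get 22 4 x 15 ;; .op .sub 22 22 16 ;; .get z 1 x y ;; .get 23 2 x 22 ;; .put 0 x y 15 ;;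
  .put 4 x 15 22 ;; .put 2 x z 23 ;; .put 1 x 23 z ;; .get 22 3 x 28 ;; .op .sub 22 22 16 ;;
  .put 3 x 28 22 ;; push x

/-- Insert the edge between the vertices in registers `1` and `2` with colour `0`. -/
def insertData : Cmd :=
  touch 1 ;; touch 2 ;; insertHalfCmd 1 2 ;; insertHalfCmd 2 1 ;; .op .add 10 10 16 ;;
  .report 1 2 15

/-- Delete the edge between the vertices in registers `1` and `2`. -/
def deleteData : Cmd :=
  .get 28 0 1 2 ;; .op .sub 28 28 16 ;; deleteHalfCmd 1 2 24 ;; deleteHalfCmd 2 1 25 ;;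
  .op .sub 10 10 16

/-- The bounds for the values and for the stack are large enough for all graphs. -/
structure Par.Large (P : Par) : Prop extends P.Ok where
  sq_le : 4 * P.n * P.n + 8 ≤ P.B
  pot_le : P.n * (P.t * (P.t * P.n ^ 2)) + 2 ≤ P.H

/-- The data structure for a graph with `m` edges. -/
structure Ready (P : Par) (m : ℕ) (s : St) : Prop where
  inv : Inv P s
  ptr : Ptr P s.arr
  touch : Touch P.n (s.reg 14) s.arr
  sum : ∑ v ∈ range P.n, s.arr 4 v 0 = 2 * m
  r10 : s.reg 10 = m

theorem pot_le_of_core {n t : ℕ} {A : ℕ → ℕ → ℕ → ℕ} (h : Core n t A) :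
    pot n t (A 3) ≤ (n * (t * (t * n ^ 2)) : ℕ) := by
  have key : ∀ v ∈ range n, dev t (A 3 v) ≤ (t * (t * n ^ 2) : ℕ) := by
    intro v hv
    have h1 : ∑ i ∈ range t, (A 3 v i : ℤ) ^ 2 ≤ ∑ i ∈ range t, (n : ℤ) ^ 2 :=
      sum_le_sum fun i hi => by
        have := h.dcol_le (mem_range.1 hv) (mem_range.1 hi)
        gcongr
    rw [sum_const, card_range, nsmul_eq_mul] at h1
    have h2 := mul_le_mul_of_nonneg_left h1 (Int.natCast_nonneg t)
    have h3 := sq_nonneg (∑ i ∈ range t, (A 3 v i : ℤ))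
    unfold dev
    push_cast
    linarith
  refine (sum_le_sum key).trans ?_
  rw [sum_const, card_range]
  simp

section specs

variable {P : Par} {s : St} {Q : St → Prop}

theorem touch_spec {n N B v x : ℕ} (hT : Touch n (s.reg 14) s.arr) (hx : s.reg x = v) (hv : v < n)
    (hx26 : x ≠ 26) (h15 : s.reg 15 = 0) (h16 : s.reg 16 = 1) (h7 : s.reg 7 = N)
    (hN : n ≤ N) (hB : n + 2 ≤ B)
    (hQ : ∀ reg arr tm, (∀ k, k ≠ 14 → k ≠ 26 → reg k = s.reg k) → reg 14 ≤ s.reg 14 + 1 →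
      Touch n (reg 14) arr → arr 6 v 0 ≠ 0 → (∀ y, s.arr 6 y 0 ≠ 0 → arr 6 y 0 ≠ 0) →
      (∀ k, k ≠ 6 → k ≠ 7 → arr k = s.arr k) → tm ≤ s.tm + 30 → Q ⟨reg, arr, s.out, tm⟩) :
    Spec N B (touch x) s Q := by
  have hc := hT.le
  simp only [touch, spec_seq, spec_get, spec_put, spec_op, spec_ite, spec_const, opOk, opVal,
    Function.update_apply, hx26, hx, h15, h16, h7]
  norm_num
  refine ⟨⟨by omega, by omega⟩, fun h6 => ⟨by omega, ?_⟩, fun h6 => ⟨⟨by omega, by omega⟩,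
    ⟨by omega, by omega⟩, by omega, ?_⟩⟩
  · refine hQ _ _ _ (fun k h1 h2 => by simp [h2]) (by simp) (by simpa using hT) h6
      (fun _ h => h) (fun _ _ _ => rfl) (by omega)
  · refine hQ _ _ _ (fun k h1 h2 => by simp [h1, h2]) (by simp) ?_ (by simp [upd]) ?_ ?_ (by omega)
    · simp only [Function.update_self]
      have hne : ∀ k < s.reg 14, s.arr 7 k 0 ≠ v := fun k hk h => hT.flag k hk (by rw [h, h6])
      refine ⟨fun k hk => ?_, fun k hk l hl hkl => ?_, fun k hk => ?_, fun y hy h => ?_,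
        fun y hy h => ?_⟩
      · have := hT.lt k
        simp only [upd]
        grind
      · have h1 := hT.inj k
        have h2 := hne k
        have h3 := hne l
        simp only [upd] at hkl
        grind
      · have h1 := hT.flag k
        simp only [upd]
        grind
      · by_cases hyv : y = v
        · exact ⟨s.reg 14, by omega, by simp [upd, hyv]⟩
        · obtain ⟨k, hk, hk'⟩ := hT.mem y hy (by simpa [upd, hyv] using h)
          have : k ≠ s.reg 14 := by omega
          exact ⟨k, by omega, by simpa [upd, this] using hk'⟩
      · have h1 := hT.deg y hy (by simpa [upd] using h)
        simp only [upd]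
        grind
    · intro y hy
      simp only [upd]
      grind
    · intro k h1 h2
      rw [upd_ne _ h2, upd_ne _ h1]

theorem insertHalf_spec {n N B x y u v p : ℕ} (hx : s.reg x = u) (hy : s.reg y = v) (hu : u < n)
    (hv : v < n) (hx22 : x ≠ 22) (hy22 : y ≠ 22) (h13 : s.reg 13 = p)
    (h15 : s.reg 15 = 0) (h16 : s.reg 16 = 1) (h7 : s.reg 7 = N) (hN : n < N) (hB : n + 2 ≤ B)
    (hp : p + 1 < B) (h4 : s.arr 4 u 0 ≤ n) (h3 : s.arr 3 u 0 ≤ n)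
    (hQ : ∀ reg tm, (∀ k, k ≠ 13 → k ≠ 22 → reg k = s.reg k) → reg 13 = p + 1 →
      tm ≤ s.tm + 60 → Q ⟨reg, insertHalf s.arr u v p, s.out, tm⟩) :
    Spec N B (insertHalfCmd x y) s Q := by
  simp only [insertHalfCmd, push, spec_seq, spec_get, spec_put, spec_op, opOk, opVal,
    Function.update_apply, hx22, hy22, hx, hy, h15, h16, h7, h13]
  norm_num
  have e : ∀ a b c d, upd (upd (upd (upd s.arr 0 u v 1) 1 u v a) 2 u b c) 4 u 0 d 3 u 0
      = s.arr 3 u 0 := by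
    intro a b c d
    simp [upd]
  simp only [e]
  refine ⟨by omega, by omega, by omega, by omega, by omega, by omega, by omega, by omega, by omega,
    ?_⟩
  exact hQ _ _ (fun k h1 h2 => by simp [h1, h2]) (by simp) (by omega)

theorem deleteHalf_spec {n t N B x y z u v c p : ℕ}
    (h : Row n t (s.arr 0 u) (s.arr 1 u) (s.arr 2 u) (s.arr 3 u) (s.arr 4 u 0)) (hx : s.reg x = u)
    (hy : s.reg y = v) (h28 : s.reg 28 = c) (hc : s.arr 0 u v = c + 1) (hu : u < n)
    (hx' : x ≠ 22 ∧ x ≠ 23 ∧ x ≠ z) (hy' : y ≠ 22 ∧ y ≠ 23 ∧ y ≠ z)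
    (hz : z ≠ 13 ∧ z ≠ 15 ∧ z ≠ 16 ∧ z ≠ 7 ∧ z ≠ 22 ∧ z ≠ 23 ∧ z ≠ 28) (h13 : s.reg 13 = p)
    (h15 : s.reg 15 = 0) (h16 : s.reg 16 = 1) (h7 : s.reg 7 = N) (hN : n + t ≤ N) (hB : n + 2 ≤ B)
    (hp : p + 1 < B)
    (hQ : ∀ reg tm, (∀ k, k ≠ 13 → k ≠ 22 → k ≠ 23 → k ≠ z → reg k = s.reg k) → reg 13 = p + 1 →
      reg z = s.arr 1 u v → tm ≤ s.tm + 80 → Q ⟨reg, deleteHalf s.arr u v c p, s.out, tm⟩) :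
    Spec N B (deleteHalfCmd x y z) s Q := by
  obtain ⟨hx1, hx2, hx3⟩ := hx'
  obtain ⟨hy1, hy2, hy3⟩ := hy'
  obtain ⟨hz1, hz2, hz3, hz4, hz5, hz6, hz7⟩ := hz
  have hv : v < n := h.supp v (by omega)
  have hct : c < t := by
    have := h.le v
    omega
  have hpos := h.pos v (by omega)
  have hdeg := h.deg
  have hd : 0 < s.arr 3 u c := by
    rw [h.dcol c hct]
    exact card_pos.2 ⟨v, by simp [hv, hc]⟩
  have hd' : s.arr 3 u c ≤ n := (h.dcol c hct).trans_le (rowCount_le _ _ _)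
  obtain ⟨hl, -⟩ := h.slot (s.arr 4 u 0 - 1) (by omega)
  have hln := h.supp _ hl
  simp only [deleteHalfCmd, push, spec_seq, spec_get, spec_put, spec_op, opOk, opVal,
    Function.update_apply, hx1, hx2, hx3, hy1, hy2, hy3, hz1.symm, hz2.symm, hz3.symm,
    hz4.symm, hz5, hz5.symm, hz6, hz7.symm, hx, hy, h15, h16, h7, h13, h28]
  norm_num
  have e : ∀ a b d, upd (upd (upd (upd s.arr 0 u v 0) 4 u 0 a) 2 u (s.arr 1 u v) b) 1 u b d 3 u c
      = s.arr 3 u c := by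
    intro a b d
    simp [upd]
  simp only [e]
  refine ⟨by omega, by omega, by omega, by omega, by omega, by omega, by omega, by omega, by omega,
    by omega, by omega, by omega, by omega, ?_⟩
  exact hQ _ _ (fun k h1 h2 h3 h4 => by simp [h1, h2, h3, h4]) (by simp) (by simp [hz1, hz5, hz6])
    (by omega)

/-- The colour of the edge `uv` is erased from the table. -/
abbrev Par.erase (P : Par) (u v : ℕ) : Par :=
  { P with base := Function.update P.base s(u, v) none }

theorem sum_inserted {n u v p : ℕ} {A : ℕ → ℕ → ℕ → ℕ} (hu : u < n) (hv : v < n) (huv : u ≠ v) :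
    ∑ x ∈ range n, inserted A u v p 4 x 0 = ∑ x ∈ range n, A 4 x 0 + 2 := by
  have : ∀ x, (if x = u ∨ x = v then 1 else 0) =
      (if x = u then 1 else 0) + if x = v then 1 else 0 := by
    grind
  simp only [inserted_four huv, sum_add_distrib, this, sum_ite_eq', mem_range, hu, hv, if_true]

theorem sum_deleted {n u v c p : ℕ} {A : ℕ → ℕ → ℕ → ℕ} (hu : u < n) (hv : v < n) (huv : u ≠ v)
    (h4u : 0 < A 4 u 0) (h4v : 0 < A 4 v 0) :
    ∑ x ∈ range n, deleted A u v c p 4 x 0 + 2 = ∑ x ∈ range n, A 4 x 0 := by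
  have : ∀ x, A 4 x 0 =
      deleted A u v c p 4 x 0 + ((if x = u then 1 else 0) + if x = v then 1 else 0) := by
    intro x
    rw [deleted_four huv]
    grind
  rw [sum_congr rfl fun x _ => this x]
  simp only [sum_add_distrib, sum_ite_eq', mem_range, hu, hv, if_true]

theorem insertData_spec (hP : P.Large) {m u v : ℕ} (h : Ready P m s) (h13 : s.reg 13 = 0)
    (ho : s.out = []) (h1 : s.reg 1 = u) (h2 : s.reg 2 = v) (hu : u < P.n) (hv : v < P.n)
    (huv : u ≠ v) (h0 : s.arr 0 u v = 0) (hdu : s.arr 4 u 0 < P.Δ) (hdv : s.arr 4 v 0 < P.Δ)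
    (hQ : ∀ s', Ready (P.erase u v) (m + 1) s' →
      (∀ k < 20, k ≠ 10 → k ≠ 13 → k ≠ 14 → s'.reg k = s.reg k) → s'.reg 14 ≤ s.reg 14 + 2 →
      s'.reg 13 = 2 → s'.out = [(u, v, 0)] →
      (∀ k, k ≠ 6 → k ≠ 7 → s'.arr k = inserted s.arr u v 0 k) → s'.tm ≤ s.tm + 200 → Q s') :
    Spec P.N P.B insertData s Q := by
  have hN := hP.le_N
  have hB := hP.le_B
  have hn := hP.sq_le
  have ht := hP.t_pos
  have hI := h.inv
  simp only [insertData, spec_seq]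
  refine touch_spec (n := P.n) (v := u) h.touch h1 hu (by omega) hI.r15 hI.r16 hI.r7 (by omega)
    (by omega) ?_
  intro r₁ a₁ t₁ hr₁ h14₁ hT₁ hu₁ hm₁ ha₁ ht₁
  refine touch_spec (n := P.n) (v := v) (s := ⟨r₁, a₁, s.out, t₁⟩) hT₁ (by simp [hr₁, h2]) hv
    (by omega) (by simp [hr₁, hI.r15]) (by simp [hr₁, hI.r16]) (by simp [hr₁, hI.r7]) (by omega)
    (by omega) ?_
  intro r₂ a₂ t₂ hr₂ h14₂ hT₂ hv₂ hm₂ ha₂ ht₂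
  dsimp only at hr₂ h14₂ hT₂ hv₂ hm₂ ha₂ ht₂ ⊢
  have hr : ∀ k, k ≠ 14 → k ≠ 26 → r₂ k = s.reg k := fun k h h' => by rw [hr₂ k h h', hr₁ k h h']
  have ha : ∀ k, k ≠ 6 → k ≠ 7 → a₂ k = s.arr k := fun k h h' => by rw [ha₂ k h h', ha₁ k h h']
  have e3 : a₂ 3 = s.arr 3 := ha 3 (by omega) (by omega)
  have e4 : a₂ 4 = s.arr 4 := ha 4 (by omega) (by omega)
  have du := hI.core.deg_le hu
  have dv := hI.core.deg_le hv
  have cu := hI.core.dcol_le hu ht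
  have cv := hI.core.dcol_le hv ht
  refine insertHalf_spec (n := P.n) (u := u) (v := v) (p := 0) (s := ⟨r₂, a₂, s.out, t₂⟩)
    (by simp [hr, h1]) (by simp [hr, h2]) hu hv (by omega) (by omega) (by simp [hr, h13])
    (by simp [hr, hI.r15]) (by simp [hr, hI.r16]) (by simp [hr, hI.r7]) (by omega) (by omega)
    (by omega) (by simpa [e4] using du) (by simpa [e3] using cu) ?_
  intro r₃ t₃ hr₃ h13₃ ht₃
  dsimp only at hr₃ h13₃ ht₃ ⊢
  have hr' : ∀ k, k ≠ 13 → k ≠ 14 → k ≠ 22 → k ≠ 26 → r₃ k = s.reg k :=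
    fun k h h' h'' h''' => by rw [hr₃ k h h'', hr k h' h''']
  refine insertHalf_spec (n := P.n) (u := v) (v := u) (p := 1)
    (s := ⟨r₃, insertHalf a₂ u v 0, s.out, t₃⟩)
    (by simp [hr', h2]) (by simp [hr', h1]) hv hu (by omega) (by omega) (by simp [h13₃])
    (by simp [hr', hI.r15]) (by simp [hr', hI.r16]) (by simp [hr', hI.r7]) (by omega) (by omega)
    (by omega) (by simpa [insertHalf_row_ne huv.symm, e4] using dv)
    (by simpa [insertHalf_row_ne huv.symm, e3] using cv) ?_
  intro r₄ t₄ hr₄ h13₄ ht₄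
  dsimp only at hr₄ h13₄ ht₄ ⊢
  have hr₄' : ∀ k, k ≠ 13 → k ≠ 14 → k ≠ 22 → k ≠ 26 → r₄ k = s.reg k :=
    fun k h h' h'' h''' => by rw [hr₄ k h h'', hr' k h h' h'' h''']
  have e14 : r₄ 14 = r₂ 14 := by rw [hr₄ 14 (by omega) (by omega), hr₃ 14 (by omega) (by omega)]
  have e10 : r₄ 10 = m := by rw [hr₄' 10 (by omega) (by omega) (by omega) (by omega), h.r10]
  have e16 : r₄ 16 = 1 := by rw [hr₄' 16 (by omega) (by omega) (by omega) (by omega), hI.r16]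
  have e15 : r₄ 15 = 0 := by rw [hr₄' 15 (by omega) (by omega) (by omega) (by omega), hI.r15]
  have e1 : r₄ 1 = u := by rw [hr₄' 1 (by omega) (by omega) (by omega) (by omega), h1]
  have e2 : r₄ 2 = v := by rw [hr₄' 2 (by omega) (by omega) (by omega) (by omega), h2]
  have hm : m ≤ P.n * P.n := by
    have := h.sum
    have : ∑ v ∈ range P.n, s.arr 4 v 0 ≤ ∑ v ∈ range P.n, P.n :=
      sum_le_sum fun v hv => hI.core.deg_le (mem_range.1 hv)
    rw [sum_const, card_range, smul_eq_mul] at this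
    omega
  have hnn : 4 * P.n * P.n = 4 * (P.n * P.n) := by ring
  simp only [spec_op, spec_report, opOk, opVal, e10, e16, Function.update_apply, e15, e1, e2]
  norm_num
  refine ⟨by omega, ?_⟩
  have harr : ∀ k, k ≠ 6 → k ≠ 7 →
      insertHalf (insertHalf a₂ u v 0) v u 1 k = inserted s.arr u v 0 k := by
    intro k h6 h7
    have e4' : ∀ x y, a₂ 4 x y = s.arr 4 x y := fun x y => by rw [e4]
    have e3' : ∀ x y, a₂ 3 x y = s.arr 3 x y := fun x y => by rw [e3]
    have ek := ha k h6 h7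
    funext x y
    simp only [inserted, insertHalf, upd, e3', e4', ek]
  have h67 : ∀ k, k = 6 ∨ k = 7 → insertHalf (insertHalf a₂ u v 0) v u 1 k = a₂ k := by
    intro k hk
    exact inserted_ne (A := a₂) (p := 0) (by omega) (by omega)
  have hc' := hI.core.insert (p := 0) hu hv huv h0 ht
  have hI' : Inv (P.erase u v) ⟨Function.update r₄ 10 (m + 1),
      insertHalf (insertHalf a₂ u v 0) v u 1, s.out ++ [(u, v, 0)], t₄ + 1 + 1⟩ := by
    refine ⟨by simp [hr₄', hI.r3], by simp [hr₄', hI.r4], by simp [hr₄', hI.r5],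
      by simp [hr₄', hI.r7], by simp [hr₄', hI.r11], by simp [hr₄', hI.r12], by simp [e15],
      by simp [e16], hc'.congr fun k hk => harr k (by omega) (by omega), ?_, ?_, ?_⟩
    · intro k hk
      dsimp only at hk ⊢
      rw [Function.update_of_ne (by omega), h13₄] at hk
      simp only [insertHalf, upd]
      grind
    · have h3 := pot_le_of_core hc'
      have h4 := hP.pot_le
      dsimp only
      rw [harr 3 (by omega) (by omega), Function.update_of_ne (by omega), h13₄]
      omega
    · intro x y hxy
      simp only [harr 0 (by omega) (by omega), inserted_zero, ho, tableAfter] at hxy ⊢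
      simp only [List.nil_append, List.foldl_cons, List.foldl_nil, Function.update_idem]
      have := h.inv.table x y
      simp only [ho, tableAfter, List.foldl_nil] at this
      split_ifs at hxy ⊢ with h'
      · have : s(x, y) = s(u, v) := by
          rcases h' with ⟨rfl, rfl⟩ | ⟨rfl, rfl⟩
          · rfl
          · exact Sym2.eq_swap
        rw [this]
        simp
      · rw [Function.update_of_ne, this hxy]
        intro h''
        exact h' (by simpa using h'')
  refine hQ _ ⟨hI', ⟨?_, ?_⟩, ?_, ?_, ?_⟩ ?_ ?_ ?_ ?_ harr ?_
  · intro x hx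
    have := h.ptr.deg x hx
    simp only [harr 4 (by omega) (by omega), inserted_four huv]
    split_ifs with h'
    · rcases h' with rfl | rfl <;> omega
    · exact this
  · intro x
    simp only [harr 5 (by omega) (by omega), inserted_ne (show 4 < 5 by omega) (show 5 ≠ 8 by omega)]
    exact h.ptr.ptr x
  · have e6 := h67 6 (by omega)
    have e7 := h67 7 (by omega)
    have hT := hT₂
    rw [← e14] at hT
    refine ⟨?_, ?_, ?_, ?_, ?_⟩
    · simpa [e7] using hT.lt
    · simpa [e7] using hT.inj
    · simpa [e6, e7] using hT.flag
    · simpa [e6, e7] using hT.mem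
    · intro x hx
      simp only [harr 4 (by omega) (by omega), inserted_four huv, e6]
      intro hne
      by_cases hxu : x = u
      · rw [hxu]; exact hm₂ u hu₁
      · by_cases hxv : x = v
        · rw [hxv]; exact hv₂
        · refine hT.deg x hx ?_
          simpa [hxu, hxv, e4] using hne
  · simp only [harr 4 (by omega) (by omega)]
    have := h.sum
    have := sum_inserted (A := s.arr) (p := 0) hu hv huv
    omega
  · simp
  · intro k hk h10 h13 h14
    simp [h10, hr₄' k h13 h14 (by omega) (by omega)]
  · dsimp only
    rw [Function.update_of_ne (by omega), e14]
    omega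
  · simp [h13₄]
  · simp [ho]
  · dsimp only
    omega

theorem deleteData_spec (hP : P.Large) {m u v c : ℕ} (h : Ready P m s) (h13 : s.reg 13 = 0)
    (ho : s.out = []) (h1 : s.reg 1 = u) (h2 : s.reg 2 = v) (huv : u ≠ v)
    (h0 : s.arr 0 u v = c + 1)
    (hQ : ∀ s', Ready (P.erase u v) (m - 1) s' →
      (∀ k < 20, k ≠ 10 → k ≠ 13 → s'.reg k = s.reg k) → s'.reg 24 = s.arr 1 u v →
      s'.reg 25 = s.arr 1 v u → s'.reg 13 = 2 → s'.out = [] →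
      s'.arr = deleted s.arr u v c 0 → s'.tm ≤ s.tm + 200 → Q s') :
    Spec P.N P.B deleteData s Q := by
  have hN := hP.le_N
  have hB := hP.le_B
  have hn := hP.sq_le
  have ht := hP.t_pos
  have hI := h.inv
  have h0' : s.arr 0 v u = c + 1 := by rw [hI.core.symm, h0]
  have hu : u < P.n := hI.core.supp u v (by omega)
  have hv : v < P.n := hI.core.supp v u (by omega)
  have hct : c < P.t := by
    have := (hI.core.row u hu).le v
    omega
  have du := hI.core.slot_lt (show s.arr 0 u v ≠ 0 by omega)
  have dv := hI.core.slot_lt (show s.arr 0 v u ≠ 0 by omega)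
  have hc' := hI.core.delete (p := 0) huv h0
  have hm : m ≤ P.n * P.n := by
    have := h.sum
    have : ∑ v ∈ range P.n, s.arr 4 v 0 ≤ ∑ v ∈ range P.n, P.n :=
      sum_le_sum fun v hv => hI.core.deg_le (mem_range.1 hv)
    rw [sum_const, card_range, smul_eq_mul] at this
    omega
  have hnn : 4 * P.n * P.n = 4 * (P.n * P.n) := by ring
  have hsum := sum_deleted (A := s.arr) (c := c) (p := 0) hu hv huv (by omega) (by omega)
  have hm1 := h.sum
  simp only [deleteData, spec_seq, spec_get, spec_op, opOk, opVal, Function.update_apply, h1, h2,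
    hI.r7, h0, hI.r16]
  norm_num
  refine ⟨by omega, by omega, ?_⟩
  refine deleteHalf_spec (n := P.n) (t := P.t) (u := u) (v := v) (c := c) (p := 0)
    (s := ⟨Function.update s.reg 28 c, s.arr, s.out, s.tm + 7 + 1⟩) (hI.core.row u hu)
    (by simp [h1]) (by simp [h2]) (by simp) h0 hu (by omega) (by omega) (by omega) (by simp [h13])
    (by simp [hI.r15]) (by simp [hI.r16]) (by simp [hI.r7]) (by omega) (by omega) (by omega) ?_
  intro r₁ t₁ hr₁ h13₁ h24 ht₁
  dsimp only at hr₁ h13₁ h24 ht₁ ⊢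
  have hr₁' : ∀ k < 20, k ≠ 13 → r₁ k = s.reg k := by
    intro k hk h13
    rw [hr₁ k h13 (by omega) (by omega) (by omega), Function.update_of_ne (by omega)]
  refine deleteHalf_spec (n := P.n) (t := P.t) (u := v) (v := u) (c := c) (p := 1)
    (s := ⟨r₁, deleteHalf s.arr u v c 0, s.out, t₁⟩) ((hI.core.row v hv).of_eq fun k hk =>
      deleteHalf_row_ne huv.symm (by omega))
    (by simp [hr₁', h2]) (by simp [hr₁', h1]) (by simp [hr₁])
    (by simp [deleteHalf_row_ne huv.symm, h0']) hv (by omega) (by omega) (by omega) (by simp [h13₁])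
    (by simp [hr₁', hI.r15]) (by simp [hr₁', hI.r16]) (by simp [hr₁', hI.r7]) (by omega) (by omega)
    (by omega) ?_
  intro r₂ t₂ hr₂ h13₂ h25 ht₂
  dsimp only at hr₂ h13₂ h25 ht₂ ⊢
  have hr : ∀ k < 20, k ≠ 13 → r₂ k = s.reg k := by
    intro k hk h13
    rw [hr₂ k h13 (by omega) (by omega) (by omega), hr₁' k hk h13]
  rw [deleteHalf_row_ne huv.symm (by omega)] at h25
  simp only [hr 10 (by omega) (by omega), hr 16 (by omega) (by omega), h.r10, hI.r16]
  refine ⟨by omega, ?_⟩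
  have harr : deleteHalf (deleteHalf s.arr u v c 0) v u c 1 = deleted s.arr u v c 0 := rfl
  rw [harr]
  refine hQ _ ⟨?_, ⟨?_, ?_⟩, ?_, ?_, ?_⟩ ?_ ?_ ?_ ?_ ho rfl ?_
  · refine ⟨by simp [hr, hI.r3], by simp [hr, hI.r4], by simp [hr, hI.r5],
      by simp [hr, hI.r7], by simp [hr, hI.r11], by simp [hr, hI.r12], by simp [hr, hI.r15],
      by simp [hr, hI.r16], hc', ?_, ?_, ?_⟩
    · intro k hk
      dsimp only at hk ⊢
      rw [Function.update_of_ne (by omega), h13₂] at hk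
      simp only [deleted, deleteHalf, upd]
      grind
    · have h3 := pot_le_of_core hc'
      have h4 := hP.pot_le
      dsimp only
      rw [Function.update_of_ne (by omega), h13₂]
      omega
    · intro x y hxy
      simp only [deleted_zero, ho, tableAfter] at hxy ⊢
      have := h.inv.table x y
      simp only [ho, tableAfter, List.foldl_nil] at this ⊢
      split_ifs at hxy ⊢ with h'
      · exact absurd rfl hxy
      · rw [Function.update_of_ne, this hxy]
        intro h''
        exact h' (by simpa using h'')
  · intro x hx
    have := h.ptr.deg x hx
    simp only [deleted_four huv]
    omega
  · intro x
    simp only [deleted_ne (show 4 < 5 by omega) (show 5 ≠ 8 by omega)]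
    exact h.ptr.ptr x
  · have e6 : deleted s.arr u v c 0 6 = s.arr 6 := deleted_ne (by omega) (by omega)
    have e7 : deleted s.arr u v c 0 7 = s.arr 7 := deleted_ne (by omega) (by omega)
    have hT := h.touch
    rw [← hr 14 (by omega) (by omega)] at hT
    refine ⟨?_, ?_, ?_, ?_, ?_⟩
    · simpa [e7] using hT.lt
    · simpa [e7] using hT.inj
    · simpa [e6, e7] using hT.flag
    · simpa [e6, e7] using hT.mem
    · intro x hx
      simp only [deleted_four huv, e6]
      intro hne
      exact hT.deg x hx (by omega)
  · dsimp only
    omega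
  · simp
  · intro k hk h10 h13
    simp [h10, hr k hk h13]
  · simp [h24, hr₂]
  · simp [h25]
  · simp [h13₂]
  · dsimp only
    omega

end specs

end Splitter

/-! ### The program and a single update -/

namespace Splitter

open Finset Imp WordRAM

/-- The parameters while register `8` contains `l`, so that the graph has had less than
`2 ^ (l + 1)` edges at all times. The bound for the height of the stack comes from the potential,
which is at most `n * (t * (t * n ^ 2))`; an update adds two entries. The threshold
is about `4 * Δ / K`, the largest allowance between updates divided by `K`. -/
def par (n t Δ q B l : ℕ) (base : DynGraph.Table) : Par :=
  ⟨n, t, Δ, Δ / ((l + 1) * 128 * t * q * q / 4), (l + 1) * 128 * t * q * q, n + t, B,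
    n * (t * (t * n ^ 2)) + 2, base⟩

/-- Compute the threshold and the number of checks per stack entry from registers `4`, `5`, `6`
and `8`. -/
def setParams : Cmd :=
  .op .add 22 8 16 ;; .const 23 128 ;; .op .mul 22 22 23 ;; .op .mul 22 22 4 ;; .op .mul 22 22 6 ;;
  .op .mul 12 22 6 ;; .const 23 4 ;; .op .div 22 12 23 ;; .op .div 11 5 22

/-- Increase register `8` by one, adapt the parameters, and check all edges. -/
def grow : Cmd :=
  .op .add 8 8 16 ;; .op .add 9 9 9 ;; .op .add 9 9 16 ;; .op .add 9 9 16 ;; setParams ;; rescan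

/-- Insert an edge with colour `0`. If the new number of edges is below the next power of two, the
new edge is checked, otherwise all edges are. -/
def insertCmd : Cmd :=
  insertData ;; .const 22 2 ;; .op .add 22 22 9 ;; .op .lt 22 10 22 ;;
  .ite 22 (.mov 20 1 ;; .get 21 4 1 15 ;; .op .sub 21 21 16 ;; check) grow

/-- Delete an edge. The two edges that `deleteData` has moved to another slot are checked, since
their position relative to the pointer has changed. -/
def deleteCmd : Cmd :=
  deleteData ;; .mov 20 1 ;; .mov 21 24 ;; check ;; .mov 20 2 ;; .mov 21 25 ;; check

/-- The whole program. Register `9` contains `2 ^ (l + 1) - 2` if register `8` contains `l`, so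
that zero is the correct initial value of both. -/
def main : Cmd :=
  .const 15 0 ;; .const 16 1 ;; .op .add 7 3 4 ;; setParams ;; .ite 0 insertCmd deleteCmd ;; drain

/-- The state between updates: the graph has `m` edges, has had less than `2 ^ (l + 1)` edges at all
times, and the colour table is `base`. -/
structure Rest (n t Δ q B l m : ℕ) (base : DynGraph.Table) (s : St) : Prop where
  r3 : s.reg 3 = n
  r4 : s.reg 4 = t
  r5 : s.reg 5 = Δ
  r6 : s.reg 6 = q
  r8 : s.reg 8 = l
  r9 : s.reg 9 + 2 = 2 ^ (l + 1)
  r10 : s.reg 10 = m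
  r13 : s.reg 13 = 0
  core : Core n t s.arr
  ptr : Ptr (par n t Δ q B l base) s.arr
  touch : Touch n (s.reg 14) s.arr
  sum : ∑ v ∈ range n, s.arr 4 v 0 = 2 * m
  lt : m < 2 ^ (l + 1)
  le : 2 ^ l ≤ n ^ 2
  table : ∀ u v, s.arr 0 u v ≠ 0 → base s(u, v) = some (s.arr 0 u v - 1)
  aged : Aged t (par n t Δ q B l base).θ (par n t Δ q B l base).K (allow Δ s.arr 0 0) (s.arr 0)
    (s.arr 3) (fun _ => 0)

/-- The degree bound is large and the words are long enough for all values of register `8` that can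
occur. -/
structure Fits (n t Δ q B : ℕ) : Prop where
  t_pos : 0 < t
  q_pos : 0 < q
  n_pos : 0 < n
  large : ∀ l, 2 ^ l ≤ n ^ 2 → ∀ base, (par n t Δ q B l base).Large
  lt_B : 1000 < B

section specs

variable {n t Δ q B l m : ℕ} {base : DynGraph.Table} {s : St} {Q : St → Prop} {P : Par}

theorem Ready.change {s' : St} {r T : ℕ} (h : Ready P m s) (hI : Inv P s') (hp : Ptr P s'.arr)
    (hC : Change P s s' r T) : Ready P m s' := by
  have e : ∀ k, k = 4 ∨ k = 6 ∨ k = 7 → s'.arr k = s.arr k := fun k hk =>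
    hC.arr k (by omega) (by omega) (by omega) (by omega)
  refine ⟨hI, hp, ?_, ?_, ?_⟩
  · rw [hC.reg 14 (by omega) (by omega)]
    exact h.touch.congr (e 4 (by omega)) (e 6 (by omega)) (e 7 (by omega))
  · rw [e 4 (by omega)]
    exact h.sum
  · rw [hC.reg 10 (by omega) (by omega)]
    exact h.r10

theorem Ready.evolve {s' : St} {r T : ℕ} (h : Ready P m s) (hI : Inv P s')
    (hE : Evolve P s s' r T) : Ready P m s' := by
  have e4 : s'.arr 4 = s.arr 4 := hE.arr 4 (by omega) (by omega) (by omega) (by omega)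
  exact h.change hI ⟨by rw [e4]; exact h.ptr.deg, by rw [hE.ptr]; exact h.ptr.ptr⟩ hE.toChange

theorem pend_of_eq {A A' : ℕ → ℕ → ℕ → ℕ} {p : ℕ} (h : A' 8 = A 8) : pend A' p = pend A p :=
  funext fun x => pend_congr (fun k _ => by rw [h]) x

theorem pend_zero (A : ℕ → ℕ → ℕ → ℕ) : pend A 0 = fun _ => 0 := by
  funext x; simp [pend]

theorem setParams_spec (hF : Fits n t Δ q B) (hl : 2 ^ l ≤ n ^ 2) (h4 : s.reg 4 = t)
    (h5 : s.reg 5 = Δ) (h6 : s.reg 6 = q) (h8 : s.reg 8 = l) (h16 : s.reg 16 = 1)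
    (hQ : ∀ reg, (∀ k, k ≠ 11 → k ≠ 12 → k ≠ 22 → k ≠ 23 → reg k = s.reg k) →
      reg 11 = (par n t Δ q B l base).θ → reg 12 = (par n t Δ q B l base).K →
      Q ⟨reg, s.arr, s.out, s.tm + 9⟩) :
    Spec N B setParams s Q := by
  have hB : (l + 1) * 128 * t * q * q + Δ < B := by
    have := (hF.large l hl base).le_B
    simp only [par] at this
    generalize Δ / _ = d at this
    omega
  have hlt := hF.lt_B
  have ht := hF.t_pos
  have hq := hF.q_pos
  have a1 : (l + 1) * 128 * t * q ≤ (l + 1) * 128 * t * q * q := Nat.le_mul_of_pos_right _ hq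
  have a2 : (l + 1) * 128 * t ≤ (l + 1) * 128 * t * q := Nat.le_mul_of_pos_right _ hq
  have a3 : (l + 1) * 128 ≤ (l + 1) * 128 * t := Nat.le_mul_of_pos_right _ ht
  simp only [setParams, spec_seq, spec_const, spec_op, opOk, opVal, Function.update_apply, h4, h5,
    h6, h8, h16]
  norm_num
  refine ⟨by omega, by omega, by omega, by omega, by omega, by omega, by omega, by omega, by omega,
    ?_⟩
  exact hQ _ (fun k h1 h2 h3 h4 => by simp [h1, h2, h3, h4]) (by simp [par]) (by simp [par])

/-- Working off the stack leads back to the state between updates. -/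
theorem drain_rest {m : ℕ} (hF : Fits n t Δ q B) (hl : 2 ^ l ≤ n ^ 2)
    (h : Ready (par n t Δ q B l base) m s) (h6 : s.reg 6 = q) (h8 : s.reg 8 = l)
    (h9 : s.reg 9 + 2 = 2 ^ (l + 1)) (hm : m < 2 ^ (l + 1))
    (hA : AgedSt (par n t Δ q B l base) (allow Δ s.arr 0 0) s)
    (hQ : ∀ s' k, Rest n t Δ q B l m (tableAfter base s'.out) s' →
      Change (par n t Δ q B l base) s s' k
        (350 * t * (par n t Δ q B l base).K * (s.reg 13 + 2 * k) + 1) → Q s') :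
    Spec (n + t) B drain s Q := by
  have hP := hF.large l hl base
  refine drain_spec hP.toOk h.inv h.ptr hA fun s' k hI hp h13 hA' hC => hQ s' k ?_ hC
  have hR := h.change hI hp hC
  have e : ∀ k < 20, k ≠ 13 → s'.reg k = s.reg k := hC.reg
  refine ⟨hI.r3, hI.r4, hI.r5, (e 6 (by omega) (by omega)).trans h6,
    (e 8 (by omega) (by omega)).trans h8, ?_, hR.r10, h13, hI.core, ⟨hp.deg, hp.ptr⟩,
    hR.touch, hR.sum, hm, hl, hI.table, ?_⟩
  · rw [e 9 (by omega) (by omega)]; exact h9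
  · have := hA'
    simp only [AgedSt, h13, pend_zero] at this
    exact this

theorem Ready.of_reg (h : Ready P m s) {reg : ℕ → ℕ} {tm : ℕ} (hr : ∀ k < 20, reg k = s.reg k) :
    Ready P m ⟨reg, s.arr, s.out, tm⟩ := by
  refine ⟨h.inv.congr (fun k _ hk _ _ _ _ => hr k hk) (fun _ _ => rfl) rfl, h.ptr, ?_, h.sum, ?_⟩
  · have := h.touch
    simpa only [hr 14 (by omega)] using this
  · have := h.r10
    simpa only [hr 10 (by omega)] using this

theorem AgedSt.of_reg {W : ℕ → ℕ → ℕ} (h : AgedSt P W s) {reg : ℕ → ℕ} {tm : ℕ}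
    (hr : reg 13 = s.reg 13) : AgedSt P W ⟨reg, s.arr, s.out, tm⟩ := by
  simpa only [AgedSt, hr] using h

/-- Between updates, the data structure is ready for the next one as soon as the working registers
are set. -/
theorem Rest.ready (hF : Fits n t Δ q B) (h : Rest n t Δ q B l m base s) (ho : s.out = [])
    {reg : ℕ → ℕ} {tm : ℕ} (hr : ∀ k < 20, k ≠ 7 → k ≠ 11 → k ≠ 12 → k ≠ 15 → k ≠ 16 →
      reg k = s.reg k) (h7 : reg 7 = n + t)
    (h11 : reg 11 = (par n t Δ q B l base).θ) (h12 : reg 12 = (par n t Δ q B l base).K)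
    (h15 : reg 15 = 0) (h16 : reg 16 = 1) :
    Ready (par n t Δ q B l base) m ⟨reg, s.arr, s.out, tm⟩ := by
  have e13 : reg 13 = 0 := by simp [hr, h.r13]
  refine ⟨⟨?_, ?_, ?_, h7, h11, h12, h15, h16, h.core, ?_, ?_, ?_⟩, h.ptr, ?_, h.sum, ?_⟩
  · simp [hr, h.r3, par]
  · simp [hr, h.r4, par]
  · simp [hr, h.r5, par]
  · simp [e13]
  · have h1 := pot_le_of_core h.core
    have h2 := (hF.large l h.le base).pot_le
    dsimp only [par] at h2 ⊢
    rw [e13]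
    omega
  · simp only [ho, tableAfter, List.foldl_nil]
    exact h.table
  · have := h.touch
    simpa [hr, par] using this
  · simp [hr, h.r10]

/-- The program sets the working registers, then carries out the insertion or the deletion, and then
works off the stack. -/
theorem main_start (hF : Fits n t Δ q B) (h : Rest n t Δ q B l m base s) (ho : s.out = [])
    (hQ : ∀ s', Ready (par n t Δ q B l base) m s' → (∀ k, k = 0 ∨ k = 1 ∨ k = 2 ∨ k = 6 ∨ k = 8 ∨
      k = 9 ∨ k = 13 ∨ k = 14 → s'.reg k = s.reg k) → s'.arr = s.arr → s'.out = [] →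
      s'.tm = s.tm + 12 →
      Spec (n + t) B (.ite 0 insertCmd deleteCmd) s' fun s'' => Spec (n + t) B drain s'' Q) :
    Spec (n + t) B main s Q := by
  have hlt := hF.lt_B
  have hB : n + t < B := by
    have := (hF.large l h.le base).le_B
    simp only [par] at this
    generalize Δ / _ = d at this
    omega
  simp only [main, spec_seq (c := .const 15 0), spec_seq (c := .const 16 1),
    spec_seq (c := .op .add 7 3 4), spec_seq (c := setParams), spec_seq (c := .ite 0 _ _),
    spec_const, spec_op, opOk, opVal, Function.update_apply, h.r3, h.r4]
  norm_num
  refine ⟨by omega, by omega, by omega, ?_⟩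
  refine setParams_spec (base := base) hF h.le (by simp [h.r4]) (by simp [h.r5]) (by simp [h.r6])
    (by simp [h.r8]) (by simp) fun reg hr h11 h12 => ?_
  dsimp only at hr ⊢
  have hr' : ∀ k < 20, k ≠ 7 → k ≠ 11 → k ≠ 12 → k ≠ 15 → k ≠ 16 → reg k = s.reg k := by
    intro k hk h7 h11 h12 h15 h16
    rw [hr k h11 h12 (by omega) (by omega)]
    simp [h7, h15, h16]
  exact hQ _ (h.ready hF ho hr' (by simp [hr]) h11 h12 (by simp [hr]) (by simp [hr]))
    (fun k hk => hr' k (by omega) (by omega) (by omega) (by omega) (by omega) (by omega)) rfl ho rfl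

/-- The outcome of an update after which the graph has `m'` edges: `k` edges have been recoloured,
and the power of two has possibly changed. -/
def Updated (n t Δ q B l m' : ℕ) (base : DynGraph.Table) (X : ℕ) (s s' : St) : Prop :=
  ∃ l' k, Rest n t Δ q B l' m' (tableAfter base s'.out) s' ∧ (l' = l ∨ l' = l + 1 ∧ m' = 2 ^ l') ∧
    s'.out.length ≤ k + 1 ∧
    pot n t (s'.arr 3) + t * (par n t Δ q B l' base).θ * k ≤
      pot n t (s.arr 3) + 2 * (2 * t * X + t) ∧
    s'.tm ≤ s.tm + (1000 * t + 350 * t * (par n t Δ q B l' base).K * (2 + 2 * k) +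
      310 * t * (s.reg 14 + 2 * m' + 3) * (l' - l)) ∧
    s'.reg 14 ≤ s.reg 14 + 2

/-- The final part of an update in which `r` edges have already been recoloured. -/
theorem drain_updated {s₀ : St} {l₀ X r : ℕ} (hF : Fits n t Δ q B) (hl : 2 ^ l ≤ n ^ 2)
    (h : Ready (par n t Δ q B l base) m s) (h6 : s.reg 6 = q) (h8 : s.reg 8 = l)
    (h9 : s.reg 9 + 2 = 2 ^ (l + 1)) (hm : m < 2 ^ (l + 1))
    (hA : AgedSt (par n t Δ q B l base) (allow Δ s.arr 0 0) s)
    (hll : l = l₀ ∨ l = l₀ + 1 ∧ m = 2 ^ l) (h13 : s.reg 13 = 2 + 2 * r)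
    (ho : s.out.length ≤ r + 1)
    (hpot : pot n t (s.arr 3) + t * (par n t Δ q B l base).θ * r ≤
      pot n t (s₀.arr 3) + 2 * (2 * t * X + t))
    (hT : s.tm + 1 ≤ s₀.tm + (1000 * t + 310 * t * (s₀.reg 14 + 2 * m + 3) * (l - l₀)))
    (h14 : s.reg 14 ≤ s₀.reg 14 + 2)
    (hQ : ∀ s', Updated n t Δ q B l₀ m base X s₀ s' →
      (∀ x y, s'.arr 0 x y = 0 ↔ s.arr 0 x y = 0) → Q s') :
    Spec (n + t) B drain s Q := by
  refine drain_rest hF hl h h6 h8 h9 hm hA fun s' k hR hC => hQ s' ⟨l, r + k, hR, hll, ?_, ?_, ?_, ?_⟩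
    hC.nz
  · have := hC.out
    omega
  · have := hC.pot
    have e : (par n t Δ q B l base).n = n ∧ (par n t Δ q B l base).t = t := ⟨rfl, rfl⟩
    rw [e.1, e.2] at this
    push_cast
    nlinarith
  · have := hC.tm
    rw [h13] at this
    have e : 2 + 2 * (r + k) = 2 + 2 * r + 2 * k := by ring
    rw [e]
    omega
  · rw [hC.reg 14 (by omega) (by omega)]
    exact h14

theorem main_insert {u v X : ℕ} (hF : Fits n t Δ q B) (h : Rest n t Δ q B l m base s)
    (ho : s.out = []) (h0 : s.reg 0 = 1) (h1 : s.reg 1 = u) (h2 : s.reg 2 = v) (hu : u < n)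
    (hv : v < n) (huv : u ≠ v) (he : s.arr 0 u v = 0) (hdu : s.arr 4 u 0 < Δ)
    (hdv : s.arr 4 v 0 < Δ) (hX : ∀ x < n, ∀ k < t, ∀ l < t, s.arr 3 x k ≤ s.arr 3 x l + X)
    (hQ : ∀ s', Updated n t Δ q B l (m + 1) (Function.update base s(u, v) none) X s s' →
      (∀ x y, s'.arr 0 x y = 0 ↔ ¬ ((x = u ∧ y = v) ∨ (x = v ∧ y = u)) ∧ s.arr 0 x y = 0) →
      Q s') :
    Spec (n + t) B main s Q := by
  have ht := hF.t_pos
  have hlt := hF.lt_B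
  have hP := hF.large l h.le base
  have hle := hP.le_B
  have hsq := hP.sq_le
  refine main_start hF h ho fun s₀ hR₀ hr₀ ha₀ ho₀ ht₀ => ?_
  have hB : 2 * n + t < B := by
    simp only [par] at hle
    generalize Δ / _ = d at hle
    omega
  rw [spec_ite]
  refine ⟨fun _ => ?_, fun h' => absurd h' (by rw [hr₀ 0 (by omega), h0]; omega)⟩
  rw [insertCmd, spec_seq]
  have hR₀' : Ready (par n t Δ q B l base) m ⟨s₀.reg, s₀.arr, s₀.out, s₀.tm + 2⟩ :=
    ⟨hR₀.inv.tick 2, hR₀.ptr, hR₀.touch, hR₀.sum, hR₀.r10⟩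
  refine insertData_spec (u := u) (v := v) hP hR₀' (by simp [hr₀, h.r13]) ho₀ (by simp [hr₀, h1])
    (by simp [hr₀, h2]) hu hv huv (by simp [ha₀, he]) (by simpa [ha₀, par] using hdu)
    (by simpa [ha₀, par] using hdv) ?_
  intro s₁ hR₁ hr₁ h14₁ h13₁ ho₁ ha₁ ht₁
  set base' := Function.update base s(u, v) none with hbase
  replace hR₁ : Ready (par n t Δ q B l base') (m + 1) s₁ := hR₁
  have hP' := hF.large l h.le base'
  dsimp only at hr₁ ha₁ ht₁ h14₁
  rw [ha₀] at ha₁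
  have hr : ∀ k, k = 1 ∨ k = 6 ∨ k = 8 ∨ k = 9 → s₁.reg k = s.reg k := fun k hk => by
    rw [hr₁ k (by omega) (by omega) (by omega) (by omega), hr₀ k (by omega)]
  have hm : m + 1 ≤ n * n := by
    have h1 := hR₁.sum
    have : ∑ v ∈ range n, s₁.arr 4 v 0 ≤ ∑ v ∈ range n, n :=
      sum_le_sum fun v hv => hR₁.inv.core.deg_le (mem_range.1 hv)
    rw [sum_const, card_range, smul_eq_mul] at this
    dsimp only [par] at h1
    omega
  have h9 := h.r9
  have hpow : 2 ^ (l + 1) = 2 * 2 ^ l := by ring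
  have hl := h.le
  have hnn : n ^ 2 = n * n := by ring
  have hsq' : 4 * (n * n) + 8 ≤ B := by
    have := hsq
    simp only [par] at this
    nlinarith
  have hpot₁ : pot n t (s₁.arr 3) ≤ pot n t (s.arr 3) + 2 * (2 * t * X + t) := by
    rw [ha₁ 3 (by omega) (by omega)]
    exact pot_inserted hu hv huv ht hX
  have hz : ∀ x y, s₁.arr 0 x y = 0 ↔ ¬ ((x = u ∧ y = v) ∨ (x = v ∧ y = u)) ∧ s.arr 0 x y = 0 := by
    intro x y
    rw [ha₁ 0 (by omega) (by omega), inserted_zero]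
    split_ifs with h' <;> simp [h']
  have e4 : s₁.arr 4 u 0 = s.arr 4 u 0 + 1 := by
    rw [ha₁ 4 (by omega) (by omega), inserted_four huv, if_pos (Or.inl rfl)]
  have h14 : s₁.reg 14 ≤ s.reg 14 + 2 := by
    rw [hr₀ 14 (by omega)] at h14₁
    exact h14₁
  have hdn := hR₁.inv.core.deg_le hu
  simp only [spec_seq (c := .const 22 2), spec_seq (c := .op _ _ _ _), spec_const, spec_op, opOk,
    opVal, Function.update_apply, hR₁.r10, hr 9 (by omega)]
  norm_num
  refine ⟨by omega, by omega, ?_⟩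
  simp only [spec_ite]
  norm_num
  refine ⟨fun hmlt => ?_, fun hmge => ?_⟩
  · simp only [spec_seq, spec_mov, spec_get, spec_op, opOk, opVal, Function.update_apply,
      hr 1 (by omega), h1, hR₁.inv.r15, hR₁.inv.r7, hR₁.inv.r16]
    norm_num
    dsimp only [par] at hdn ⊢
    refine ⟨by omega, ⟨by omega, by omega⟩, by omega, ?_⟩
    have hsame : ∀ b k, k < 20 → Function.update (Function.update (Function.update s₁.reg 22 b) 20 u)
        21 (s₁.arr 4 u 0 - 1) k = s₁.reg k := by
      intro b k hk
      have : k ≠ 20 ∧ k ≠ 21 ∧ k ≠ 22 := by omega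
      simp [this]
    have hA₁ : AgedSt (par n t Δ q B l base') (fun x y => if (x = u ∧ y = v) ∨ (x = v ∧ y = u) then
        (par n t Δ q B l base').K * (2 * n) else allow Δ s.arr 0 0 x y) s₁ := by
      have := h.aged
      rw [← pend_zero s.arr] at this
      have := this.insert h.core huv (h.core.insert hu hv huv he ht) ht
      simp only [AgedSt, h13₁]
      rw [pend_of_eq (ha₁ 8 (by omega) (by omega)), ha₁ 0 (by omega) (by omega),
        ha₁ 3 (by omega) (by omega)]
      exact this
    refine check_spec (P := par n t Δ q B l base') (v := u) (a := s₁.arr 4 u 0 - 1) hP'.toOk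
      (hR₁.of_reg (hsame _)).inv hu (by simp) (by simp) ?_
    intro s₂ r hI₂ hE₂ hr₂ hA₂
    have hR₂ := (hR₁.of_reg (hsame _)).evolve hI₂ hE₂
    dsimp only at hr₂ hA₂
    have e : ∀ k, k = 6 ∨ k = 8 ∨ k = 9 → s₂.reg k = s.reg k := fun k hk => by
      rw [hr₂ k (by omega) (by omega), hsame _ k (by omega), hr k (by omega)]
    have e14 : s₂.reg 14 = s₁.reg 14 := by
      rw [hr₂ 14 (by omega) (by omega), hsame _ 14 (by omega)]
    refine drain_updated (l₀ := l) (r := r) (s₀ := s) (X := X) hF hl hR₂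
      ((e 6 (by omega)).trans h.r6) ((e 8 (by omega)).trans h.r8) (by rw [e 9 (by omega), h9])
      (by omega) ?_ (Or.inl rfl) ?_ ?_ ?_ ?_ (by rw [e14]; exact h14) fun s' hU hz' => ?_
    · refine hA₂ _ _ (hA₁.of_reg (by simp)) fun x y hxy hn1 hn2 => ?_
      have e1 : ∀ x y, s₁.arr 1 x y =
          if (x = u ∧ y = v) ∨ (x = v ∧ y = u) then s.arr 4 x 0 else s.arr 1 x y := fun x y => by
        rw [ha₁ 1 (by omega) (by omega), inserted_one huv]
      have e5 : s₂.arr 5 = s.arr 5 := by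
        rw [hE₂.ptr, ha₁ 5 (by omega) (by omega), inserted_ne (by omega) (by omega)]
      have e1' : s₂.arr 1 = s₁.arr 1 := hE₂.arr 1 (by omega) (by omega) (by omega) (by omega)
      by_cases h' : (x = u ∧ y = v) ∨ (x = v ∧ y = u)
      · exfalso
        rcases h' with ⟨rfl, rfl⟩ | ⟨rfl, rfl⟩
        · exact hn1 ⟨rfl, by rw [e1, e4]; simp⟩
        · exact hn2 ⟨rfl, by rw [e1, e4]; simp⟩
      · have h'' : ¬ ((y = u ∧ x = v) ∨ (y = v ∧ x = u)) := by tauto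
        rw [if_neg h']
        simp only [allow, age, e5, e1', e1, if_neg h', if_neg h'']
        exact le_rfl
    · rw [hE₂.sp]
      simp [h13₁]
    · rw [hE₂.out]
      simp [ho₁]
      omega
    · have := hE₂.pot
      dsimp only [par] at this ⊢
      linarith
    · have := hE₂.tm
      dsimp only [par] at this ⊢
      omega
    · exact hQ s' hU fun x y => (hz' x y).trans ((hE₂.nz x y).trans (hz x y))
  · have hm2 : m + 1 = 2 ^ (l + 1) := by
      have := h.lt
      omega
    have hl' : 2 ^ (l + 1) ≤ n ^ 2 := by omega
    rw [grow]
    simp only [spec_seq (c := .op _ _ _ _), spec_seq (c := setParams), spec_op, opOk, opVal,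
      Function.update_apply, hr 8 (by omega), hr 9 (by omega), h.r8, hR₁.inv.r16]
    norm_num
    have hl2 : l < 2 ^ l := Nat.lt_two_pow_self
    refine ⟨by omega, by omega, by omega, by omega, ?_⟩
    have hP₂ := hF.large (l + 1) hl' base'
    refine setParams_spec (base := base') (l := l + 1) hF hl' (by simpa [par] using hR₁.inv.r4)
      (by simpa [par] using hR₁.inv.r5) (by simpa [hr] using h.r6) (by simp)
      (by simpa using hR₁.inv.r16) fun reg hreg h11 h12 => ?_
    dsimp only at hreg ⊢
    have hreg' : ∀ k < 20, k ≠ 8 → k ≠ 9 → k ≠ 11 → k ≠ 12 → reg k = s₁.reg k := by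
      intro k hk h8 h9 h11 h12
      rw [hreg k h11 h12 (by omega) (by omega)]
      have : k ≠ 22 := by omega
      simp [h8, h9, this]
    have hI := hR₁.inv
    have hR₂ : Ready (par n t Δ q B (l + 1) base') (m + 1)
        ⟨reg, s₁.arr, s₁.out, s₁.tm + 1 + 1 + 1 + 1 + 1 + 1 + 1 + 1 + 9⟩ := by
      refine ⟨⟨by simpa [hreg', par] using hI.r3, by simpa [hreg', par] using hI.r4,
        by simpa [hreg', par] using hI.r5, by simpa [hreg', par] using hI.r7, h11, h12,
        by simpa [hreg', par] using hI.r15, by simpa [hreg', par] using hI.r16, hI.core,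
        by simpa [hreg', par] using hI.stk, by simpa [hreg', par] using hI.height, hI.table⟩,
        ⟨hR₁.ptr.deg, hR₁.ptr.ptr⟩, by simpa [hreg', par] using hR₁.touch, hR₁.sum,
        by simpa [hreg', par] using hR₁.r10⟩
    refine rescan_spec (P := par n t Δ q B (l + 1) base') hP₂.toOk hR₂.inv hR₂.touch ?_
    intro s₂ r hI₂ hE₂ hA₂
    have hR₃ := hR₂.evolve hI₂ hE₂
    have e : ∀ k < 20, k ≠ 13 → s₂.reg k = reg k := hE₂.reg
    refine drain_updated (l₀ := l) (r := r) (s₀ := s) (X := X) hF hl' hR₃ ?_ ?_ ?_ ?_ ?_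
      (Or.inr ⟨rfl, hm2⟩) ?_ ?_ ?_ ?_ ?_ fun s' hU hz' => ?_
    · rw [e 6 (by omega) (by omega), hreg' 6 (by omega) (by omega) (by omega) (by omega) (by omega),
        hr 6 (by omega), h.r6]
    · rw [e 8 (by omega) (by omega), hreg 8 (by omega) (by omega) (by omega) (by omega)]
      simp
    · rw [e 9 (by omega) (by omega), hreg 9 (by omega) (by omega) (by omega) (by omega)]
      simp
      omega
    · rw [hm2]
      exact Nat.pow_lt_pow_right (by omega) (by omega)
    · refine Aged.step hA₂ (fun x y => ?_) (fun x i _ j _ => by omega)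
        (fun x y hxy => Or.inl ⟨rfl, Nat.zero_le _⟩)
      by_cases hx : s₂.arr 0 x y = 0
      · omega
      · exact (hI₂.core.row x (hI₂.core.supp x y hx)).le y
    · rw [hE₂.sp]
      simp [hreg', h13₁]
    · rw [hE₂.out]
      simp [ho₁]
      omega
    · have := hE₂.pot
      dsimp only [par] at this ⊢
      linarith
    · have h3 := hE₂.tm
      have h4 := hR₁.sum
      dsimp only [par] at h3 h4 ⊢
      rw [h4, hreg' 14 (by omega) (by omega) (by omega) (by omega) (by omega)] at h3
      have h5 := Nat.mul_le_mul_left (310 * t)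
        (show s₁.reg 14 + 2 * (m + 1) + 1 ≤ s.reg 14 + 2 * (m + 1) + 3 by omega)
      rw [Nat.add_sub_cancel_left, Nat.mul_one]
      omega
    · rw [e 14 (by omega) (by omega), hreg' 14 (by omega) (by omega) (by omega) (by omega) (by omega)]
      exact h14
    · exact hQ s' hU fun x y => (hz' x y).trans ((hE₂.nz x y).trans (hz x y))

theorem main_delete {u v X : ℕ} (hF : Fits n t Δ q B) (h : Rest n t Δ q B l m base s)
    (ho : s.out = []) (h0 : s.reg 0 = 0) (h1 : s.reg 1 = u) (h2 : s.reg 2 = v) (huv : u ≠ v)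
    (he : s.arr 0 u v ≠ 0) (hX : ∀ x < n, ∀ k < t, ∀ l < t, s.arr 3 x k ≤ s.arr 3 x l + X)
    (hQ : ∀ s', Updated n t Δ q B l (m - 1) (Function.update base s(u, v) none) X s s' →
      (∀ x y, s'.arr 0 x y = 0 ↔ ((x = u ∧ y = v) ∨ (x = v ∧ y = u)) ∨ s.arr 0 x y = 0) →
      Q s') :
    Spec (n + t) B main s Q := by
  obtain ⟨c, he⟩ : ∃ c, s.arr 0 u v = c + 1 := ⟨s.arr 0 u v - 1, by omega⟩
  have ht := hF.t_pos
  have hP := hF.large l h.le base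
  have hle := hP.le_B
  have hu : u < n := h.core.supp u v (by omega)
  have he' : s.arr 0 v u = c + 1 := by rw [h.core.symm, he]
  have hv : v < n := h.core.supp v u (by omega)
  refine main_start hF h ho fun s₀ hR₀ hr₀ ha₀ ho₀ ht₀ => ?_
  have hB : 2 * n + t < B := by
    simp only [par] at hle
    generalize Δ / _ = d at hle
    omega
  rw [spec_ite]
  refine ⟨fun h' => absurd (hr₀ 0 (by omega)) (by rw [h0]; exact h'), fun _ => ?_⟩
  rw [deleteCmd, spec_seq]
  have hR₀' : Ready (par n t Δ q B l base) m ⟨s₀.reg, s₀.arr, s₀.out, s₀.tm + 1⟩ :=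
    ⟨hR₀.inv.tick 1, hR₀.ptr, hR₀.touch, hR₀.sum, hR₀.r10⟩
  refine deleteData_spec (u := u) (v := v) (c := c) hP hR₀' (by simp [hr₀, h.r13]) ho₀
    (by simp [hr₀, h1]) (by simp [hr₀, h2]) huv (by simp [ha₀, he]) ?_
  intro s₁ hR₁ hr₁ h24₁ h25₁ h13₁ ho₁ ha₁ ht₁
  set base' := Function.update base s(u, v) none with hbase
  replace hR₁ : Ready (par n t Δ q B l base') (m - 1) s₁ := hR₁
  have hP' := hF.large l h.le base'
  dsimp only at hr₁ ha₁ ht₁ h24₁ h25₁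
  rw [ha₀] at ha₁ h24₁ h25₁
  have hr : ∀ k, k = 1 ∨ k = 2 ∨ k = 6 ∨ k = 8 ∨ k = 9 ∨ k = 14 → s₁.reg k = s.reg k :=
    fun k hk => by rw [hr₁ k (by omega) (by omega) (by omega), hr₀ k (by omega)]
  have hpot₁ : pot n t (s₁.arr 3) ≤ pot n t (s.arr 3) + 2 * (2 * t * X + t) := by
    rw [ha₁]
    exact pot_deleted h.core he huv hX
  have hz : ∀ x y, s₁.arr 0 x y = 0 ↔ ((x = u ∧ y = v) ∨ (x = v ∧ y = u)) ∨ s.arr 0 x y = 0 := by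
    intro x y
    rw [ha₁, deleted_zero]
    split_ifs with h' <;> simp [h']
  have hau := (h.core.row u hu).pos v (by omega)
  have hav := (h.core.row v hv).pos u (by omega)
  have hdu := h.core.deg_le hu
  have hdv := h.core.deg_le hv
  have hA₁ : AgedSt (par n t Δ q B l base') (allow Δ s.arr 0 0) s₁ := by
    have := h.aged
    rw [← pend_zero s.arr] at this
    have := this.delete h.core huv he
    simp only [AgedSt, h13₁, ha₁]
    exact this
  simp only [spec_seq (c := .mov _ _), spec_seq (c := check), spec_mov, Function.update_apply,
    hr 1 (by omega), h1, h24₁]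
  norm_num
  refine ⟨by omega, by omega, ?_⟩
  have hsame : ∀ k < 30, k ≠ 20 → k ≠ 21 → Function.update (Function.update s₁.reg 20 u) 21
      (s.arr 1 u v) k = s₁.reg k := by
    intro k hk h20 h21
    simp [h20, h21]
  refine check_spec (P := par n t Δ q B l base') (v := u) (a := s.arr 1 u v) hP'.toOk
    (hR₁.of_reg fun k hk => hsame k (by omega) (by omega) (by omega)).inv hu (by simp) (by simp) ?_
  intro s₂ r₂ hI₂ hE₂ hr₂ hA₂
  have hR₂ := (hR₁.of_reg fun k hk => hsame k (by omega) (by omega) (by omega)).evolve hI₂ hE₂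
  dsimp only at hr₂ hA₂
  have e₂ : ∀ k < 30, k ≠ 13 → k ≠ 20 → k ≠ 21 → s₂.reg k = s₁.reg k := fun k hk h13 h20 h21 => by
    rw [hr₂ k hk h13, hsame k hk h20 h21]
  simp only [e₂ 2 (by omega) (by omega) (by omega) (by omega), hr 2 (by omega), h2,
    e₂ 25 (by omega) (by omega) (by omega) (by omega), h25₁]
  refine ⟨by omega, by omega, ?_⟩
  have hsame₂ : ∀ k < 30, k ≠ 20 → k ≠ 21 → Function.update (Function.update s₂.reg 20 v) 21
      (s.arr 1 v u) k = s₂.reg k := by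
    intro k hk h20 h21
    simp [h20, h21]
  refine check_spec (P := par n t Δ q B l base') (v := v) (a := s.arr 1 v u) hP'.toOk
    (hR₂.of_reg fun k hk => hsame₂ k (by omega) (by omega) (by omega)).inv hv (by simp) (by simp) ?_
  intro s₃ r₃ hI₃ hE₃ hr₃ hA₃
  have hR₃ := (hR₂.of_reg fun k hk => hsame₂ k (by omega) (by omega) (by omega)).evolve hI₃ hE₃
  dsimp only at hr₃ hA₃
  have e : ∀ k, k = 6 ∨ k = 8 ∨ k = 9 ∨ k = 14 → s₃.reg k = s.reg k := fun k hk => by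
    rw [hr₃ k (by omega) (by omega), hsame₂ k (by omega) (by omega) (by omega),
      e₂ k (by omega) (by omega) (by omega) (by omega), hr k (by omega)]
  refine drain_updated (l₀ := l) (r := r₂ + r₃) (s₀ := s) (X := X) hF h.le hR₃
    ((e 6 (by omega)).trans h.r6) ((e 8 (by omega)).trans h.r8) (by rw [e 9 (by omega), h.r9])
    (by have := h.lt; omega) ?_ (Or.inl rfl) ?_ ?_ ?_ ?_ (by rw [e 14 (by omega)]; omega)
    fun s' hU hz' => ?_
  · have e1₂ : s₂.arr 1 = s₁.arr 1 := hE₂.arr 1 (by omega) (by omega) (by omega) (by omega)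
    have e1₃ : s₃.arr 1 = s₁.arr 1 :=
      (hE₃.arr 1 (by omega) (by omega) (by omega) (by omega)).trans e1₂
    have e5 : s₃.arr 5 = s.arr 5 := by
      have : s₁.arr 5 = s.arr 5 := by rw [ha₁, deleted_ne (by omega) (by omega)]
      exact (hE₃.ptr.trans hE₂.ptr).trans this
    have e1 : ∀ x y, s₁.arr 1 x y = if x = u ∧ y = s.arr 2 u (s.arr 4 u 0 - 1) then s.arr 1 u v else
        if x = v ∧ y = s.arr 2 v (s.arr 4 v 0 - 1) then s.arr 1 v u else s.arr 1 x y := fun x y => by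
      rw [ha₁, deleted_one huv]
    -- The edges in the slots that have been filled again are free, the others have not moved.
    have hB₂ := hA₂ _ (fun x y => if x = u ∧ s₁.arr 1 x y = s.arr 1 u v ∨
      y = u ∧ s₁.arr 1 y x = s.arr 1 u v then 0 else allow Δ s.arr 0 0 x y)
      (hA₁.of_reg (by simp)) fun x y _ hn1 hn2 => by rw [if_neg (by tauto)]
    refine hA₃ _ _ (hB₂.of_reg (by simp)) fun x y hxy hn1 hn2 => ?_
    rw [e1₂] at hn1 hn2
    split_ifs with h'
    · exact Nat.zero_le _
    · have key : ∀ x y, ¬ (x = u ∧ s₁.arr 1 x y = s.arr 1 u v) →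
          ¬ (x = v ∧ s₁.arr 1 x y = s.arr 1 v u) → s₁.arr 1 x y = s.arr 1 x y := by
        intro x y h3 h4
        rw [e1] at h3 h4 ⊢
        grind
      have k1 := key x y (by tauto) (by tauto)
      have k2 := key y x (by tauto) (by tauto)
      simp only [allow, age, e5, e1₃, k1, k2]
      exact le_rfl
  · rw [hE₃.sp]
    simp [hE₂.sp, h13₁]
    omega
  · rw [hE₃.out]
    simp [hE₂.out, ho₁]
  · have h3 := hE₂.pot
    have h4 := hE₃.pot
    dsimp only [par] at h3 h4 ⊢
    rw [Nat.cast_add, mul_add]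
    linarith
  · have h3 := hE₂.tm
    have h4 := hE₃.tm
    dsimp only [par] at h3 h4 ⊢
    omega
  · exact hQ s' hU fun x y =>
      (hz' x y).trans ((hE₃.nz x y).trans ((hE₂.nz x y).trans (hz x y)))

end specs

end Splitter

/-! ### Graphs and colour tables -/

namespace Splitter

open Finset Imp WordRAM DynGraph

/-- The colour matrix `C` has entries for exactly the edges of the graph. -/
def Linked {n : ℕ} (G : SimpleGraph (Fin n)) (C : ℕ → ℕ → ℕ) : Prop :=
  ∀ u v : Fin n, G.Adj u v ↔ C u v ≠ 0

/-- All allowances between updates are so small that the colours are locally balanced. -/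
theorem Rest.local_balance {n t Δ q B l m : ℕ} {base : Table} {s : St} (hF : Fits n t Δ q B)
    (h : Rest n t Δ q B l m base s) {x y : ℕ} (hxy : s.arr 0 x y ≠ 0) {j : ℕ} (hj : j < t) :
    s.arr 3 x (s.arr 0 x y - 1) + s.arr 3 y (s.arr 0 x y - 1) ≤
      s.arr 3 x j + s.arr 3 y j + 2 * (par n t Δ q B l base).θ := by
  have hΔ : 0 < Δ := (hF.large l h.le base).Δ_pos
  have h1 := h.aged x y hxy j hj
  have ha : allow Δ s.arr 0 0 x y + 4 ≤ 4 * Δ := by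
    have := age_lt hΔ s.arr x y
    have := age_lt hΔ s.arr y x
    simp only [allow, ite_self]
    omega
  obtain ⟨p, hp⟩ : ∃ p, (par n t Δ q B l base).K = 4 * p :=
    ⟨(l + 1) * 32 * t * q * q, by simp only [par]; ring⟩
  have hθ : (par n t Δ q B l base).θ = Δ / p := by
    have : (l + 1) * 128 * t * q * q = 4 * p := hp
    simp only [par, this]
    congr 1
    omega
  have hp0 : 0 < p := by
    have : 0 < (par n t Δ q B l base).K := (hF.large l h.le base).K_pos
    omega
  have hlt := Nat.lt_mul_div_succ Δ hp0
  rw [← hθ] at hlt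
  rw [hp] at h1
  set θ := (par n t Δ q B l base).θ
  by_contra hcon
  push Not at hcon
  have h2 := Nat.mul_le_mul_left (4 * p) hcon.nat_succ_le
  simp only [Nat.succ_eq_add_one] at h2
  nlinarith

theorem Rest.deg_eq {n t Δ q B l m : ℕ} {base : Table} {s : St} (h : Rest n t Δ q B l m base s)
    {v : ℕ} (hv : v < n) : ∑ i ∈ range t, s.arr 3 v i = s.arr 4 v 0 := by
  have hr := h.core.row v hv
  have h1 := sum_rowCount (n := n) hr.le
  have h2 := hr.deg
  rw [sum_congr rfl fun i hi => hr.dcol i (mem_range.1 hi)]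
  omega

/-- Between updates, the colour degrees at any vertex differ by at most `Δ / (t * q)`. -/
theorem Rest.balanced {n t Δ q B l m : ℕ} {base : Table} {s : St} (hF : Fits n t Δ q B)
    (hq : 2 ≤ q) (h : Rest n t Δ q B l m base s) {v i j : ℕ} (hv : v < n) (hi : i < t)
    (hj : j < t) : t * q * s.arr 3 v i ≤ t * q * s.arr 3 v j + Δ := by
  have hd : ∀ v < n, ∀ i < t, s.arr 3 v i = cdeg n (s.arr 0) v i := fun v hv i hi =>
    (h.core.row v hv).dcol i hi
  have hs : ∀ v ∈ range n, ∑ i ∈ range t, cdeg n (s.arr 0) v i = s.arr 4 v 0 := fun v hv => by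
    rw [← h.deg_eq (mem_range.1 hv)]
    exact sum_congr rfl fun i hi => (hd v (mem_range.1 hv) i (mem_range.1 hi)).symm
  rw [hd v hv i hi, hd v hv j hj]
  refine balanced_of_local (L := l + 1) (θ := (par n t Δ q B l base).θ) hF.t_pos hq (by omega)
    h.core.symm (fun v hv => ?_) ?_ ?_ (fun x hx y hy i hi hxy j hj => ?_) hv hi hj
  · rw [hs v (mem_range.2 hv)]
    exact h.ptr.deg v hv
  · rw [sum_congr rfl hs, h.sum]
    have := h.lt
    rw [pow_succ]
    omega
  · have e : 32 * t * q ^ 2 * (l + 1) = (l + 1) * 128 * t * q * q / 4 := by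
      rw [show (l + 1) * 128 * t * q * q = 4 * (32 * t * q ^ 2 * (l + 1)) by ring]
      omega
    rw [e]
    exact Nat.mul_div_le _ _
  · have := h.local_balance hF (x := x) (y := y) (by omega) hj
    rw [hxy, Nat.add_sub_cancel] at this
    rwa [← hd x hx i hi, ← hd y hy i hi, ← hd x hx j hj, ← hd y hy j hj]

section graph

variable {n t : ℕ} {A : ℕ → ℕ → ℕ → ℕ} {G : SimpleGraph (Fin n)}

/-- Counting over `Fin n` and over an initial segment of the natural numbers. -/
theorem card_fin_filter (n : ℕ) (p : ℕ → Prop) [DecidablePred p] :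
    #{u : Fin n | p u} = #{u ∈ range n | p u} := by
  rw [← card_map Fin.valEmbedding]
  congr 1
  ext u
  simp only [mem_map, mem_filter, mem_univ, true_and, mem_range, Fin.valEmbedding_apply]
  constructor
  · rintro ⟨u, hu, rfl⟩
    exact ⟨u.2, hu⟩
  · rintro ⟨hu, hp⟩
    exact ⟨⟨u, hu⟩, hp, rfl⟩

open scoped Classical in
theorem maxDeg_le {k : ℕ} (h : ∀ v, G.degree v ≤ k) : maxDeg G ≤ k :=
  G.maxDegree_le_of_forall_degree_le k h

open scoped Classical in
theorem Linked.degree (hL : Linked G (A 0)) (h : Core n t A) (v : Fin n) :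
    G.degree v = A 4 v 0 := by
  have h1 : G.degree v = #{u ∈ range n | A 0 v u ≠ 0} := by
    rw [← card_fin_filter, ← G.card_neighborFinset_eq_degree, SimpleGraph.neighborFinset_eq_filter]
    congr 1
    ext u
    simp [hL v u]
  have h2 := (h.row v v.2).deg
  have h3 : #{u ∈ range n | A 0 v u = 0} + #{u ∈ range n | A 0 v u ≠ 0} = n := by
    convert card_filter_add_card_filter_not (s := range n) (fun u => A 0 v u = 0)
    rw [card_range]
  unfold rowCount at h2
  omega

/-- The number of edges of the graph. -/
theorem Linked.ncard {m : ℕ} (hL : Linked G (A 0)) (h : Core n t A)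
    (hs : ∑ v ∈ range n, A 4 v 0 = 2 * m) : G.edgeSet.ncard = m := by
  classical
  have h1 := G.sum_degrees_eq_twice_card_edges
  rw [sum_congr rfl fun v _ => hL.degree h v, Fin.sum_univ_eq_sum_range (fun v => A 4 v 0) n, hs] at h1
  rw [← SimpleGraph.coe_edgeFinset, Set.ncard_coe_finset]
  omega

/-- Before the insertion of an edge that is allowed by the degree bound, the degree at its ends is
smaller. -/
theorem Linked.deg_lt (hL : Linked G (A 0)) (h : Core n t A) {u v : Fin n} {Δ : ℕ}
    (hn : ¬ G.Adj u v) {G' : SimpleGraph (Fin n)} (hG : G ≤ G') (h' : G'.Adj u v)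
    (hd : maxDeg G' ≤ Δ) : A 4 u 0 < Δ := by
  classical
  rw [← hL.degree h u]
  have h1 : G'.degree u ≤ Δ := by
    refine le_trans ?_ hd
    unfold maxDeg
    convert G'.degree_le_maxDegree u
  refine lt_of_lt_of_le ?_ h1
  rw [← G.card_neighborFinset_eq_degree, ← G'.card_neighborFinset_eq_degree]
  refine card_lt_card ⟨fun w hw => ?_, fun hsub => ?_⟩
  · rw [SimpleGraph.mem_neighborFinset] at hw ⊢
    exact hG hw
  · have := hsub ((G'.mem_neighborFinset u v).2 h')
    rw [SimpleGraph.mem_neighborFinset] at this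
    exact hn this

end graph

/-- The colouring between updates is a splitter. -/
theorem Rest.isSplitter {n t Δ q B l m : ℕ} {base : Table} {s : St} (hF : Fits n t Δ q B)
    (hq : 2 ≤ q) {ε : ℝ} (hε : 0 < ε) (hqε : 1 / ε ≤ q) (h : Rest n t Δ q B l m base s)
    {G : SimpleGraph (Fin n)} (hL : Linked G (s.arr 0)) :
    IsSplitter G t ((1 + ε) * ((Δ : ℝ) / t)) base := by
  classical
  have hC : ∀ u v : Fin n, G.Adj u v → ∃ i : Fin t, base s((u : ℕ), (v : ℕ)) = some (i : ℕ) ∧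
      s.arr 0 u v = i + 1 := by
    intro u v huv
    have h0 := (hL u v).1 huv
    have h1 := (h.core.row u u.2).le v
    exact ⟨⟨s.arr 0 u v - 1, by omega⟩, h.table u v h0, by dsimp only; omega⟩
  have hC' : ∀ e : G.edgeSet, ∃ i : Fin t, base ((e : Sym2 (Fin n)).map Fin.val) = some (i : ℕ) := by
    rintro ⟨e, he⟩
    induction e with
    | _ u v =>
      obtain ⟨i, hi, -⟩ := hC u v he
      exact ⟨i, hi⟩
  obtain ⟨χ, hχ⟩ : ∃ χ : G.EdgeLabeling (Fin t), ∀ e : G.edgeSet,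
      base ((e : Sym2 (Fin n)).map Fin.val) = some (χ e : ℕ) := Classical.axiom_of_choice hC'
  refine ⟨χ, hχ, fun i => ?_⟩
  have hbound : ∀ v : Fin n, (s.arr 3 v i : ℝ) ≤ (1 + ε) * ((Δ : ℝ) / t) := by
    intro v
    have h1 : t * (t * q * s.arr 3 v i) ≤ t * q * s.arr 4 v 0 + t * Δ := by
      rw [← h.deg_eq v.2, mul_sum]
      have := sum_le_sum fun j (hj : j ∈ range t) =>
        h.balanced hF hq v.2 i.2 (mem_range.1 hj)
      rw [sum_const, card_range, smul_eq_mul, sum_add_distrib, sum_const, card_range,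
        smul_eq_mul] at this
      exact this
    have h2 : s.arr 4 v 0 ≤ Δ := h.ptr.deg v v.2
    have h3 : t * q * s.arr 4 v 0 ≤ t * q * Δ := Nat.mul_le_mul_left _ h2
    have h4 : (t : ℝ) * (t * q * s.arr 3 v i) ≤ t * q * Δ + t * Δ := by
      exact_mod_cast h1.trans (Nat.add_le_add_right h3 _)
    have ht : (0 : ℝ) < t := by exact_mod_cast hF.t_pos
    have hq0 : (0 : ℝ) < q := by exact_mod_cast hF.q_pos
    have h5 : 1 ≤ ε * q := by
      rw [div_le_iff₀ hε] at hqε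
      linarith
    have h6 : (t : ℝ) * q * s.arr 3 v i ≤ q * Δ + Δ := by
      have : (t : ℝ) * (t * q * s.arr 3 v i) ≤ t * (q * Δ + Δ) := by linarith
      exact le_of_mul_le_mul_left this ht
    have h7 : (q : ℝ) * Δ + Δ ≤ q * ((1 + ε) * Δ) := by
      have : (0 : ℝ) ≤ Δ := by positivity
      nlinarith
    rw [← mul_div_assoc, le_div_iff₀ ht]
    have : (q : ℝ) * (s.arr 3 v i * t) ≤ q * ((1 + ε) * Δ) := by linarith
    exact le_of_mul_le_mul_left this hq0
  have hdeg : ∀ v : Fin n, (χ.labelGraph i).degree v ≤ s.arr 3 v i := by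
    intro v
    rw [(h.core.row v v.2).dcol i i.2, rowCount, ← card_fin_filter,
      ← SimpleGraph.card_neighborFinset_eq_degree]
    refine card_le_card fun u hu => ?_
    rw [SimpleGraph.mem_neighborFinset, SimpleGraph.EdgeLabeling.labelGraph_adj] at hu
    obtain ⟨hadj, hu⟩ := hu
    obtain ⟨j, hj, hj'⟩ := hC v u hadj
    have h1 := hχ ⟨s(v, u), hadj⟩
    rw [Sym2.map_mk] at h1
    have h2 : j = χ ⟨s(v, u), hadj⟩ := by
      rw [hj] at h1
      exact Fin.ext (Option.some.inj h1)
    have h3 : χ ⟨s(v, u), hadj⟩ = i := hu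
    simp [hj', h2, h3]
  have hnn : (0 : ℝ) ≤ (1 + ε) * ((Δ : ℝ) / t) := by positivity
  rw [← Nat.le_floor_iff hnn]
  refine maxDeg_le fun v => ?_
  refine Nat.le_floor ((Nat.cast_le.2 ?_).trans (hbound v))
  convert hdeg v

end Splitter

/-! ### A sequence of updates -/

namespace Splitter

open Finset Imp WordRAM DynGraph

section lists

variable {n : ℕ}

theorem graphAfter_append (us : List (Update n)) (u : Update n) :
    graphAfter (us ++ [u]) = u.apply (graphAfter us) := by
  simp [graphAfter]

theorem valid_append {Δ : ℕ} (G : SimpleGraph (Fin n)) (us : List (Update n)) (u : Update n) :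
    Valid Δ G (us ++ [u]) ↔ Valid Δ G us ∧ u.Legal (us.foldl (fun G u => u.apply G) G) ∧
      maxDeg (u.apply (us.foldl (fun G u => u.apply G) G)) ≤ Δ := by
  induction us generalizing G with
  | nil => simp [Valid]
  | cons v us ih => simp [Valid, ih, and_assoc]

theorem peakEdges_append (G : SimpleGraph (Fin n)) (us : List (Update n)) (u : Update n) :
    peakEdges G (us ++ [u]) =
      max (peakEdges G us) (u.apply (us.foldl (fun G u => u.apply G) G)).edgeSet.ncard := by
  induction us generalizing G with
  | nil => simp [peakEdges]
  | cons v us ih => simp [peakEdges, ih, max_assoc]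

end lists

/-- The situation after the updates `us`, with `m` edges in the graph, `l` in register `8`, and `k`
recolourings so far. The three summands of the bound on the time are due to the updates themselves,
to the stack, to which every update and every recolouring has added two entries, and to the `l`
rescans. Both `θ` and `K` are those for the final `l`; this suffices since `θ` is antitone and `K`
monotone in `l`. -/
structure History (n t Δ q B w : ℕ) (us : List (Update n)) (M : Mem) (c : Table) (T R l m k : ℕ)
    (s : St) : Prop where
  maintains : Maintains (compile 0 main) w (initMem n t Δ q) us M c T R
  rest : Rest n t Δ q B l m c s
  rep : Rep (n + t) M s
  linked : Linked (graphAfter us) (s.arr 0)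
  pow_le : 2 ^ l ≤ max 1 (peakEdges ⊥ us)
  touched : s.reg 14 ≤ 2 * us.length
  edges : m ≤ us.length
  potential : pot n t (s.arr 3) + t * (par n t Δ q B l c).θ * k ≤
    us.length * (2 * (2 * t * (Δ / (t * q) : ℕ) + t) : ℤ)
  reports : R ≤ k + us.length
  time : T ≤ 1000 * t * us.length + 350 * t * (par n t Δ q B l c).K * (2 * us.length + 2 * k) +
    310 * t * (4 * us.length + 1) * l

section

variable {n t Δ q B w : ℕ}

theorem par_K_mono {l l' : ℕ} (h : l ≤ l') (c c' : Table) :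
    (par n t Δ q B l c).K ≤ (par n t Δ q B l' c').K := by
  simp only [par]
  gcongr

theorem par_θ_anti {l l' : ℕ} (hF : Fits n t Δ q B) (h : l ≤ l') (c c' : Table) :
    (par n t Δ q B l' c').θ ≤ (par n t Δ q B l c).θ := by
  have ht := hF.t_pos
  have hq := hF.q_pos
  have h1 : 4 ≤ (l + 1) * 128 * t * q * q := by
    have : 0 < (l + 1) * t * q * q := by positivity
    nlinarith
  simp only [par]
  apply Nat.div_le_div_left
  · gcongr
  · omega

theorem Rest.congr {l m : ℕ} {c : Table} {s s' : St} (h : Rest n t Δ q B l m c s)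
    (hr : ∀ k, 3 ≤ k → s'.reg k = s.reg k) (ha : s'.arr = s.arr) : Rest n t Δ q B l m c s' := by
  obtain ⟨h1, h2, h3, h4, h5, h6, h7, h8, h9, h10, h11, h12, h13, h14, h15, h16⟩ := h
  constructor
  all_goals first | rw [hr _ (by omega)] | skip
  all_goals first | rw [ha] | skip
  all_goals assumption

theorem History.init (hF : Fits n t Δ q B) :
    History n t Δ q B w [] (initMem n t Δ q) (fun _ => none) 0 0 0 0 0
      ⟨initMem n t Δ q, fun _ _ _ => 0, [], 0⟩ := by
  have hΔ : 0 < Δ := (hF.large 0 (Nat.one_le_pow _ _ hF.n_pos) (fun _ => none)).Δ_pos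
  have hpot : pot n t (fun _ _ => 0) = 0 := by simp [pot, dev]
  refine ⟨.init, ⟨rfl, rfl, rfl, rfl, rfl, rfl, rfl, rfl, ⟨?_, ?_, ?_, ?_⟩, ⟨?_, ?_⟩,
    ⟨?_, ?_, ?_, ?_, ?_⟩, ?_, by simp, Nat.one_le_pow _ _ hF.n_pos, ?_, ?_⟩, ⟨fun _ _ => rfl, ?_⟩,
    ?_, by simp, by simp [initMem], by simp, ?_, by simp, by simp⟩
  · simp
  · simp
  · simp
  · refine fun v _ => ⟨by simp, by simp, by simp [rowCount], by simp [rowCount], by simp, by simp⟩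
  · simp
  · simpa [par] using hΔ
  · simp [initMem]
  · simp [initMem]
  · simp [initMem]
  · simp
  · simp
  · simp
  · simp
  · intro x y hxy
    simp at hxy
  · intro k hk x y hy
    simp only [initMem]
    rw [if_neg (by omega), if_neg (by omega), if_neg (by omega), if_neg (by omega)]
  · intro u v
    simp [graphAfter]
  · dsimp only
    rw [hpot]
    simp

theorem History.step (hF : Fits n t Δ q B) (hw : 64 + 16 * (B * (n + t) + (n + t)) + 16 ≤ 2 ^ w)
    (hwB : B ≤ 2 ^ w) {us : List (Update n)} {M : Mem} {c : Table} {T R l m k m' : ℕ} {s s₁ : St}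
    (h : History n t Δ q B w us M c T R l m k s) (u : Update n) (ho : s₁.out = [])
    (htm : s₁.tm = 0) (ha : s₁.arr = s.arr) (h14 : s₁.reg 14 = s.reg 14)
    (hM : Rep (n + t) (u.feed M) s₁) (hm : m' ≤ m + 1)
    (hS : Spec (n + t) B main s₁ fun s' =>
      Updated n t Δ q B l m' (Function.update c (u.edge.map Fin.val) none) (Δ / (t * q)) s₁ s' ∧
      Linked (graphAfter (us ++ [u])) (s'.arr 0)) :
    ∃ M c T R l m k s, History n t Δ q B w (us ++ [u]) M c T R l m k s := by
  obtain ⟨s', hev, ⟨l', k', hR, hll, hout, hpot, htime, htc⟩, hL⟩ := hS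
  obtain ⟨M', T', pc, hM', hT', hrun⟩ := run_compile hw hwB (by decide) hev ho hM
  have hlen : (us ++ [u]).length = us.length + 1 := by simp
  have hle : l ≤ l' := by omega
  have hK := par_K_mono (n := n) (t := t) (Δ := Δ) (q := q) (B := B) hle c
    (tableAfter (Function.update c (u.edge.map Fin.val) none) s'.out)
  have hθ := par_θ_anti hF hle c (tableAfter (Function.update c (u.edge.map Fin.val) none) s'.out)
  refine ⟨M', c.refresh u s'.out, T + T', R + s'.out.length, l', m', k + k', s',
    h.maintains.update u hrun, hR, hM', hL, ?_, ?_, ?_, ?_, ?_, ?_⟩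
  · rw [peakEdges_append]
    rcases hll with rfl | ⟨rfl, hm'⟩
    · have := h.pow_le
      omega
    · have := hL.ncard hR.core hR.sum
      rw [graphAfter_append] at this
      unfold graphAfter at this
      omega
  · have := h.touched
    omega
  · have := h.edges
    omega
  · have h1 := h.potential
    rw [ha] at hpot
    rw [hlen]
    have h2 : (t : ℤ) * (par n t Δ q B l' (tableAfter (Function.update c (u.edge.map Fin.val) none)
        s'.out)).θ * k ≤ t * (par n t Δ q B l c).θ * k := by
      gcongr
    change _ + (t : ℤ) * (par n t Δ q B l' (tableAfter (Function.update c (u.edge.map Fin.val) none)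
        s'.out)).θ * _ ≤ _
    have h3 : (par n t Δ q B l' (tableAfter (Function.update c (u.edge.map Fin.val) none)
        s'.out)).θ = (par n t Δ q B l' (Function.update c (u.edge.map Fin.val) none)).θ := rfl
    rw [h3] at h2 ⊢
    rw [Nat.cast_add, mul_add, Nat.cast_add, add_mul, Nat.cast_one, one_mul]
    linarith
  · have := h.reports
    omega
  · have h1 := h.time
    rw [hlen]
    change _ ≤
      _ + 350 * t * (par n t Δ q B l' (Function.update c (u.edge.map Fin.val) none)).K * _ + _
    change _ ≤ (par n t Δ q B l' (Function.update c (u.edge.map Fin.val) none)).K at hK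
    set K := (par n t Δ q B l c).K
    set K' := (par n t Δ q B l' (Function.update c (u.edge.map Fin.val) none)).K
    set σ := us.length
    have h2 : 350 * t * K * (2 * σ + 2 * k) ≤ 350 * t * K' * (2 * σ + 2 * k) := by gcongr
    have h3 : s₁.reg 14 + 2 * m' + 3 ≤ 4 * (σ + 1) + 1 := by
      have := h.touched
      have := h.edges
      omega
    have h4 : 310 * t * (s₁.reg 14 + 2 * m' + 3) * (l' - l) ≤
        310 * t * (4 * (σ + 1) + 1) * (l' - l) := by gcongr
    have h5 : 310 * t * (4 * σ + 1) * l ≤ 310 * t * (4 * (σ + 1) + 1) * l := by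
      gcongr
      omega
    have h6 : 310 * t * (4 * (σ + 1) + 1) * l' =
        310 * t * (4 * (σ + 1) + 1) * l + 310 * t * (4 * (σ + 1) + 1) * (l' - l) := by
      rw [← mul_add]
      congr 1
      omega
    have h7 : 350 * t * K' * (2 * (σ + 1) + 2 * (k + k')) =
      350 * t * K' * (2 * σ + 2 * k) + 350 * t * K' * (2 + 2 * k') := by ring
    have h8 : 1000 * t * (σ + 1) = 1000 * t * σ + 1000 * t := by ring
    omega

theorem exists_history (hF : Fits n t Δ q B) (hq : 2 ≤ q)
    (hw : 64 + 16 * (B * (n + t) + (n + t)) + 16 ≤ 2 ^ w) (hwB : B ≤ 2 ^ w)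
    (us : List (Update n)) (hV : Valid Δ ⊥ us) :
    ∃ M c T R l m k s, History n t Δ q B w us M c T R l m k s := by
  induction us using List.reverseRecOn with
  | nil => exact ⟨_, _, _, _, _, _, _, _, History.init hF⟩
  | append_singleton us u ih =>
    obtain ⟨hV, hleg, hdeg⟩ := (valid_append ⊥ us u).1 hV
    obtain ⟨M, c, T, R, l, m, k, s, h⟩ := ih hV
    change u.Legal (graphAfter us) at hleg
    change maxDeg (u.apply (graphAfter us)) ≤ Δ at hdeg
    have hX : ∀ x < n, ∀ i < t, ∀ j < t, s.arr 3 x i ≤ s.arr 3 x j + Δ / (t * q) := by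
      intro x hx i hi j hj
      have h1 := h.rest.balanced hF hq hx hi hj
      have htq : 0 < t * q := Nat.mul_pos hF.t_pos hF.q_pos
      rw [← Nat.sub_le_iff_le_add', Nat.le_div_iff_mul_le htq, Nat.sub_mul]
      nlinarith [Nat.sub_le_iff_le_add'.2 (show s.arr 3 x i * (t * q) ≤ s.arr 3 x j * (t * q) + Δ by
        linarith)]
    have hrep : ∀ f a b : ℕ, Rep (n + t)
        (Function.update (Function.update (Function.update M 0 f) 1 a) 2 b)
        ⟨Function.update (Function.update (Function.update s.reg 0 f) 1 a) 2 b, s.arr, [], 0⟩ := by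
      intro f a b
      refine ⟨fun r hr => ?_, fun k hk x y hy => ?_⟩
      · simp only [Function.update_apply, h.rep.reg r hr]
      · rw [Function.update_of_ne (by omega), Function.update_of_ne (by omega),
          Function.update_of_ne (by omega)]
        exact h.rep.arr k hk x y hy
    have hrest : ∀ f a b : ℕ, Rest n t Δ q B l m c
        ⟨Function.update (Function.update (Function.update s.reg 0 f) 1 a) 2 b, s.arr, [], 0⟩ := by
      intro f a b
      refine h.rest.congr (fun k hk => ?_) rfl
      have : k ≠ 0 ∧ k ≠ 1 ∧ k ≠ 2 := by omega
      simp [this]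
    cases u with
    | insert u v =>
      obtain ⟨huv, hadj⟩ := hleg
      have hle : graphAfter us ≤ graphAfter us ⊔ SimpleGraph.edge u v := le_sup_left
      have hnew : (graphAfter us ⊔ SimpleGraph.edge u v).Adj u v := by
        simp [SimpleGraph.sup_adj, SimpleGraph.edge_adj, huv]
      have hval : (u : ℕ) ≠ v := fun h' => huv (Fin.ext h')
      refine h.step hF hw hwB (.insert u v) (m' := m + 1)
        (s₁ := ⟨Function.update (Function.update (Function.update s.reg 0 1) 1 u) 2 v, s.arr, [], 0⟩)
        rfl rfl rfl (by simp) (hrep 1 u v) le_rfl ?_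
      refine main_insert (u := u) (v := v) hF (hrest 1 u v) rfl (by simp) (by simp) (by simp) u.2 v.2
        hval ?_ (h.linked.deg_lt h.rest.core hadj hle hnew hdeg)
        (h.linked.deg_lt h.rest.core (fun h' => hadj h'.symm) hle hnew.symm hdeg) hX
        fun s' hU hz => ⟨hU, fun x y => ?_⟩
      · by_contra h'
        exact hadj ((h.linked u v).2 h')
      · rw [graphAfter_append]
        have := h.linked x y
        have hxy : s.arr 0 x x = 0 := h.rest.core.irrefl x
        simp only [Update.apply, SimpleGraph.sup_adj, SimpleGraph.edge_adj, this, ne_eq, hz]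
        simp only [Fin.ext_iff]
        grind
    | delete u v =>
      have hadj : (graphAfter us).Adj u v := hleg
      have hval : (u : ℕ) ≠ v := fun h' => hadj.ne (Fin.ext h')
      refine h.step hF hw hwB (.delete u v) (m' := m - 1)
        (s₁ := ⟨Function.update (Function.update (Function.update s.reg 0 0) 1 u) 2 v, s.arr, [], 0⟩)
        rfl rfl rfl (by simp) (hrep 0 u v) (by omega) ?_
      refine main_delete (u := u) (v := v) hF (hrest 0 u v) rfl (by simp) (by simp) (by simp) hval
        ((h.linked u v).1 hadj) hX fun s' hU hz => ⟨hU, fun x y => ?_⟩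
      rw [graphAfter_append]
      have := h.linked x y
      simp only [Update.apply, SimpleGraph.deleteEdges_adj, this, ne_eq, hz, Set.mem_singleton_iff,
        Sym2.eq_iff]
      simp only [Fin.ext_iff]
      grind

end

end Splitter

/-! ### Recourse and update time -/

namespace Splitter

open Finset Imp WordRAM DynGraph

section

variable {n t Δ q B w : ℕ}

/-- The parameters fit if the degree bound is so large that all thresholds are at least two. -/
theorem fits_of_le (hn : 2 ≤ n) (ht : 0 < t) (hq : 2 ≤ q)
    (hΔ : ∀ l, 2 ^ l ≤ n ^ 2 → 64 * (l + 1) * t * q ^ 2 ≤ Δ) :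
    Fits n t Δ q ((n + t + Δ + q + 2) ^ 10) := by
  have h0 := hΔ 0 (Nat.one_le_pow _ _ (by omega))
  have hΔ0 : 0 < Δ := lt_of_lt_of_le (by positivity) h0
  set S := n + t + Δ + q + 2 with hS
  have hS8 : 8 ≤ S := by omega
  have hn' : n ≤ S := by omega
  have ht' : t ≤ S := by omega
  have hq' : q ≤ S := by omega
  have hpow : ∀ i j, i ≤ j → S ^ i ≤ S ^ j := fun i j h => Nat.pow_le_pow_right (by omega) h
  have h8 : ∀ i, 8 * S ^ i ≤ S ^ (i + 1) := fun i => by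
    rw [pow_succ, mul_comm]
    exact Nat.mul_le_mul_left _ hS8
  have e1 := h8 1
  have e2 := h8 2
  have e5 := h8 5
  have e6 := h8 6
  have e7 := h8 7
  have e8 := h8 8
  have e9 := h8 9
  have h25 := hpow 2 5 (by omega)
  have h38 := hpow 3 8 (by omega)
  have h58 := hpow 5 8 (by omega)
  norm_num at e1 e2 e5 e6 e7 e8 e9
  refine ⟨ht, by omega, by omega, fun l hl base => ⟨⟨ht, ?_, ?_, hΔ0, le_rfl, ?_, ?_⟩, ?_, le_rfl⟩,
    ?_⟩
  · simp only [par]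
    rw [Nat.le_div_iff_mul_le,
      show (l + 1) * 128 * t * q * q = 4 * (32 * (l + 1) * t * q ^ 2) by ring]
    · have := hΔ l hl
      have e : 64 * (l + 1) * t * q ^ 2 = 2 * (32 * (l + 1) * t * q ^ 2) := by ring
      omega
    · rw [show (l + 1) * 128 * t * q * q = 4 * (32 * (l + 1) * t * q ^ 2) by ring]
      have : 0 < 32 * (l + 1) * t * q ^ 2 := by positivity
      omega
  · simp only [par]
    positivity
  · have hK : (l + 1) * 128 * t * q * q ≤ S ^ 8 := by
      have hl1 : l + 1 ≤ S ^ 2 :=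
        (Nat.lt_two_pow_self (n := l)).nat_succ_le.trans (hl.trans (Nat.pow_le_pow_left hn' 2))
      calc (l + 1) * 128 * t * q * q ≤ S ^ 2 * 128 * S * S * S := by gcongr
        _ = 128 * S ^ 5 := by ring
        _ ≤ S ^ 8 := by omega
    have hθ := Nat.div_le_self Δ ((l + 1) * 128 * t * q * q / 4)
    simp only [par]
    generalize Δ / ((l + 1) * 128 * t * q * q / 4) = d at hθ
    omega
  · have hH : n * (t * (t * n ^ 2)) ≤ S ^ 5 := by
      calc n * (t * (t * n ^ 2)) ≤ S * (S * (S * S ^ 2)) := by gcongr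
        _ = S ^ 5 := by ring
    simp only [par]
    omega
  · have : 4 * n * n ≤ 4 * S ^ 2 := by
      calc 4 * n * n ≤ 4 * S * S := by gcongr
        _ = 4 * S ^ 2 := by ring
    simp only [par]
    omega
  · omega

/-- The words are long enough for the addresses that occur. -/
theorem word_size {S N W : ℕ} (hS : 8 ≤ S) (hN : N ≤ S) (hW : S ^ 13 ≤ W) :
    64 + 16 * (S ^ 10 * N + N) + 16 ≤ W ∧ S ^ 10 ≤ W := by
  have h1 : S ^ 10 * N ≤ S ^ 11 := by
    rw [pow_succ]
    exact Nat.mul_le_mul_left _ hN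
  have h8 : ∀ i, 8 * S ^ i ≤ S ^ (i + 1) := fun i => by
    rw [pow_succ, mul_comm]
    exact Nat.mul_le_mul_left _ hS
  have e10 := h8 10
  have e11 := h8 11
  have e12 := h8 12
  have h2 : S ^ 2 ≤ S ^ 11 := Nat.pow_le_pow_right (by omega) (by omega)
  have h3 := h8 1
  norm_num at *
  constructor <;> omega

variable {us : List (Update n)} {M : Mem} {c : Table} {T R l m k : ℕ} {s : St}

/-- The number of recolourings is bounded by the rise of the potential. -/
theorem History.recolourings_le (hF : Fits n t Δ q B)
    (h : History n t Δ q B w us M c T R l m k s) : k ≤ us.length * (192 * q * (l + 1) + 1) := by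
  have ht := hF.t_pos
  have hq := hF.q_pos
  have h2 : 2 ≤ (par n t Δ q B l c).θ := (hF.large l h.rest.le c).two_le
  have hp : (par n t Δ q B l c).θ = Δ / (32 * t * q ^ 2 * (l + 1)) := by
    simp only [par]
    rw [show (l + 1) * 128 * t * q * q = 4 * (32 * t * q ^ 2 * (l + 1)) by ring,
      Nat.mul_div_cancel_left _ (by omega)]
  have hlt := Nat.lt_mul_div_succ Δ (show 0 < 32 * t * q ^ 2 * (l + 1) by positivity)
  rw [← hp] at hlt
  have hpot := h.potential
  have hnn := pot_nonneg n t (s.arr 3)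
  set θ := (par n t Δ q B l c).θ
  have hΔ : Δ ≤ 48 * q * (l + 1) * θ * (t * q) := by
    calc Δ ≤ 32 * t * q ^ 2 * (l + 1) * (θ + 1) := hlt.le
      _ = 16 * t * q ^ 2 * (l + 1) * (2 * (θ + 1)) := by ring
      _ ≤ 16 * t * q ^ 2 * (l + 1) * (3 * θ) := Nat.mul_le_mul_left _ (by omega)
      _ = 48 * q * (l + 1) * θ * (t * q) := by ring
  have hX : Δ / (t * q) ≤ 48 * q * (l + 1) * θ := by
    refine (Nat.div_le_div_right hΔ).trans ?_
    rw [Nat.mul_div_cancel _ (by positivity)]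
  set X := Δ / (t * q)
  have h3 : t * θ * k ≤ us.length * (2 * (2 * t * X + t)) := by
    zify
    linarith
  have h4 : t * θ * k ≤ t * θ * (us.length * (192 * q * (l + 1) + 1)) := by
    calc t * θ * k ≤ us.length * (2 * (2 * t * X + t)) := h3
      _ ≤ us.length * (2 * (2 * t * (48 * q * (l + 1) * θ) + t)) := by gcongr
      _ = us.length * (t * (192 * q * (l + 1) * θ + 2)) := by ring
      _ ≤ us.length * (t * (192 * q * (l + 1) * θ + θ)) := by gcongr
      _ = t * θ * (us.length * (192 * q * (l + 1) + 1)) := by ring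
  exact Nat.le_of_mul_le_mul_left h4 (by positivity)

theorem History.reports_le (hF : Fits n t Δ q B) (h : History n t Δ q B w us M c T R l m k s) :
    R ≤ us.length * (194 * (q * (l + 1))) := by
  have h1 := h.recolourings_le hF
  have h2 := h.reports
  have h3 : 1 ≤ q * (l + 1) := Nat.mul_pos hF.q_pos (by omega)
  have h4 := Nat.mul_le_mul_left us.length
    (show 192 * q * (l + 1) + 2 ≤ 194 * (q * (l + 1)) by nlinarith)
  nlinarith

theorem History.time_le (hF : Fits n t Δ q B) (h : History n t Δ q B w us M c T R l m k s) :
    T ≤ us.length * (17384950 * (t ^ 2 * q ^ 3 * (l + 1) ^ 2)) := by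
  have ht := hF.t_pos
  have hq := hF.q_pos
  have h1 := h.recolourings_le hF
  have hl : (4 * us.length + 1) * l ≤ 5 * us.length * (l + 1) := by
    rcases Nat.eq_zero_or_pos us.length with h0 | h0
    · have h2 := h.pow_le
      obtain rfl := List.length_eq_zero_iff.1 h0
      have : l = 0 := by
        by_contra hl
        have := Nat.pow_le_pow_right (show 0 < 2 by omega) (show 1 ≤ l by omega)
        simp [peakEdges] at h2
        omega
      simp [this]
    · have := Nat.mul_le_mul (show 4 * us.length + 1 ≤ 5 * us.length by omega)
        (show l ≤ l + 1 by omega)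
      exact this
  have hT := h.time
  have hK : (par n t Δ q B l c).K = 128 * t * q ^ 2 * (l + 1) := by simp only [par]; ring
  rw [hK] at hT
  set L := l + 1 with hL
  set σ := us.length
  have hqL : 1 ≤ q * L := Nat.mul_pos hq (by omega)
  have hk : 2 * σ + 2 * k ≤ σ * (388 * (q * L)) := by
    calc 2 * σ + 2 * k ≤ 2 * σ + 2 * (σ * (192 * q * L + 1)) := by omega
      _ = σ * (384 * (q * L) + 4) := by ring
      _ ≤ σ * (388 * (q * L)) := Nat.mul_le_mul_left _ (by omega)
  have a1 : t ≤ t ^ 2 * q ^ 3 * L ^ 2 := by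
    calc t = t * 1 * 1 * 1 := by ring
      _ ≤ t * t * q ^ 3 * L ^ 2 := by
        gcongr
        · exact ht
        · exact Nat.one_le_pow _ _ hq
        · exact Nat.one_le_pow _ _ (by omega)
      _ = t ^ 2 * q ^ 3 * L ^ 2 := by ring
  have a2 : t * L ≤ t ^ 2 * q ^ 3 * L ^ 2 := by
    calc t * L = t * L * (1 * 1 * 1) := by ring
      _ ≤ t * L * (t * q ^ 3 * L) := by
        gcongr
        · exact ht
        · exact Nat.one_le_pow _ _ hq
        · omega
      _ = t ^ 2 * q ^ 3 * L ^ 2 := by ring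
  calc T ≤ 1000 * t * σ + 350 * t * (128 * t * q ^ 2 * L) * (2 * σ + 2 * k) +
        310 * t * (4 * σ + 1) * l := hT
    _ = 1000 * σ * t + 350 * t * (128 * t * q ^ 2 * L) * (2 * σ + 2 * k) +
        310 * t * ((4 * σ + 1) * l) := by ring
    _ ≤ 1000 * σ * t + 350 * t * (128 * t * q ^ 2 * L) * (σ * (388 * (q * L))) +
        310 * t * (5 * σ * L) := by gcongr
    _ = 1000 * σ * t + 17382400 * σ * (t ^ 2 * q ^ 3 * L ^ 2) + 1550 * σ * (t * L) := by ring
    _ ≤ 1000 * σ * (t ^ 2 * q ^ 3 * L ^ 2) + 17382400 * σ * (t ^ 2 * q ^ 3 * L ^ 2) +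
        1550 * σ * (t ^ 2 * q ^ 3 * L ^ 2) := by gcongr
    _ = σ * (17384950 * (t ^ 2 * q ^ 3 * L ^ 2)) := by ring

end

section real

theorem ceil_le {ε : ℝ} (hε : 0 < ε) (hε1 : ε < 1) : (⌈1 / ε⌉₊ : ℝ) ≤ 2 / ε := by
  have h1 : 1 ≤ 1 / ε := by rw [le_div_iff₀ hε]; linarith
  have h2 := Nat.ceil_lt_add_one (show 0 ≤ 1 / ε by positivity)
  have h3 : 2 / ε = 1 / ε + 1 / ε := by ring
  linarith

theorem two_le_ceil {ε : ℝ} (hε : 0 < ε) (hε1 : ε < 1) : 2 ≤ ⌈1 / ε⌉₊ := by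
  have h1 : 1 < 1 / ε := by rw [lt_div_iff₀ hε]; linarith
  have : 1 < ⌈1 / ε⌉₊ := Nat.lt_ceil.2 (by simpa using h1)
  omega

/-- The exponent of a power of two is bounded by the logarithm. -/
theorem exponent_le {l : ℕ} {x : ℝ} (hx : 2 ^ l ≤ x) : l * Real.log 2 ≤ Real.log x := by
  rw [← Real.log_pow]
  exact Real.log_le_log (by positivity) hx

theorem exponent_le_log {n l : ℕ} (hn : 2 ≤ n) (hl : 2 ^ l ≤ n ^ 2) :
    (l : ℝ) + 1 ≤ 4.4 * Real.log n := by
  have h1 := exponent_le (l := l) (x := (n : ℝ) ^ 2) (by exact_mod_cast hl)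
  rw [Real.log_pow] at h1
  have h2 : Real.log 2 ≤ Real.log n := Real.log_le_log (by norm_num) (by exact_mod_cast hn)
  have h3 := Real.log_two_gt_d9
  push_cast at h1
  have h4 : ((l : ℝ) + 1) * 0.6931471803 ≤ ((l : ℝ) + 1) * Real.log 2 := by gcongr
  nlinarith

theorem capacity {n t Δ l : ℕ} {ε : ℝ} (hn : 2 ≤ n) (ht : 0 < t) (hε : 0 < ε) (hε1 : ε < 1)
    (h : 10 ^ 4 * Real.log n ^ 2 / ε ^ 2 ≤ (Δ : ℝ) / t) (hl : 2 ^ l ≤ n ^ 2) :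
    64 * (l + 1) * t * ⌈1 / ε⌉₊ ^ 2 ≤ Δ := by
  have h1 := exponent_le_log hn hl
  have h2 := ceil_le hε hε1
  have h3 : Real.log 2 ≤ Real.log n := Real.log_le_log (by norm_num) (by exact_mod_cast hn)
  have h4 := Real.log_two_gt_d9
  have ht' : (0 : ℝ) < t := by exact_mod_cast ht
  have h5 : (l : ℝ) + 1 ≤ 7 * Real.log n ^ 2 := by nlinarith
  have h6 : (⌈1 / ε⌉₊ : ℝ) ^ 2 ≤ 4 / ε ^ 2 := by
    calc (⌈1 / ε⌉₊ : ℝ) ^ 2 ≤ (2 / ε) ^ 2 := by gcongr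
      _ = 4 / ε ^ 2 := by ring
  rw [le_div_iff₀ ht'] at h
  have h7 : (64 * (l + 1) * t * ⌈1 / ε⌉₊ ^ 2 : ℝ) ≤ Δ := by
    calc (64 * (l + 1) * t * ⌈1 / ε⌉₊ ^ 2 : ℝ)
        ≤ 64 * (7 * Real.log n ^ 2) * t * (4 / ε ^ 2) := by gcongr
      _ = 1792 * (Real.log n ^ 2 / ε ^ 2 * t) := by ring
      _ ≤ 10 ^ 4 * (Real.log n ^ 2 / ε ^ 2 * t) := by
        gcongr
        norm_num
      _ = 10 ^ 4 * Real.log n ^ 2 / ε ^ 2 * t := by ring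
      _ ≤ Δ := h
  exact_mod_cast h7

/-- On at most one vertex there are no updates. -/
theorem eq_nil_of_lt_two {n Δ : ℕ} (hn : n < 2) {us : List (Update n)} (h : Valid Δ ⊥ us) :
    us = [] := by
  cases us with
  | nil => rfl
  | cons u us =>
    exfalso
    have hleg := h.1
    cases u with
    | insert u v => exact hleg.1 (Fin.ext (by omega))
    | delete u v => exact hleg

end real

end Splitter

open Splitter in
/-- One program and absolute constants serve all parameters. As every initial segment of a valid
update sequence is valid, the conclusion describes the situation after each single update. -/
theorem theorem1p2 :
    ∃ (p : WordRAM.Program) (a : ℕ) (C : ℝ),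
      ∀ (n t Δ : ℕ) (ε : ℝ), 0 < t → 0 < ε → ε < 1 →
        10 ^ 4 * Real.log n ^ 2 / ε ^ 2 ≤ (Δ : ℝ) / t →
        ∀ w : ℕ, (n + t + Δ + ⌈1 / ε⌉₊ + 2) ^ a ≤ 2 ^ w →
        ∀ us : List (DynGraph.Update n), DynGraph.Valid Δ ⊥ us →
          ∃ (M : WordRAM.Mem) (c : DynGraph.Table) (T R : ℕ),
            DynGraph.Maintains p w (DynGraph.initMem n t Δ ⌈1 / ε⌉₊) us M c T R ∧
            DynGraph.IsSplitter (DynGraph.graphAfter us) t ((1 + ε) * ((Δ : ℝ) / t)) c ∧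
            (T : ℝ) ≤ C * us.length *
              ((t : ℝ) ^ 3 * (1 / ε) ^ 4 *
                Real.log (max (DynGraph.peakEdges ⊥ us : ℝ) 2) ^ 3) ∧
            (R : ℝ) ≤ C * us.length * (Real.log n / ε ^ 2) := by
  refine ⟨Imp.compile 0 main, 13, 2 * 10 ^ 9, fun n t Δ ε ht hε hε1 hΔ w hw us hV => ?_⟩
  rcases Nat.lt_or_ge n 2 with hn | hn
  · obtain rfl := eq_nil_of_lt_two hn hV
    refine ⟨_, _, 0, 0, .init, ?_, by simp, by simp⟩
    refine ⟨fun e => absurd e.2 (by simp [DynGraph.graphAfter]), fun e =>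
      absurd e.2 (by simp [DynGraph.graphAfter]), fun i => ?_⟩
    have h0 : (0 : ℝ) ≤ (1 + ε) * ((Δ : ℝ) / t) := by positivity
    refine le_trans (le_of_eq ?_) h0
    rw [Nat.cast_eq_zero, ← Nat.le_zero]
    classical
    refine maxDeg_le fun v => ?_
    have : ∀ u, ¬ (DynGraph.graphAfter ([] : List (DynGraph.Update n))).Adj v u := by
      simp [DynGraph.graphAfter]
    rw [Nat.le_zero, SimpleGraph.degree_eq_zero]
    intro u hu
    exact this u (SimpleGraph.EdgeLabeling.labelGraph_le _ hu)
  set q := ⌈1 / ε⌉₊ with hqdef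
  have hq := two_le_ceil hε hε1
  have hqε := ceil_le hε hε1
  rw [← hqdef] at hq hqε
  have hF := fits_of_le (Δ := Δ) hn ht hq fun l hl => capacity hn ht hε hε1 hΔ hl
  obtain ⟨hw1, hw2⟩ := word_size (S := n + t + Δ + q + 2) (N := n + t) (W := 2 ^ w) (by
    have := (hF.large 0 (Nat.one_le_pow _ _ (by omega)) (fun _ => none)).Δ_pos
    dsimp only [par] at this
    omega) (by omega) hw
  obtain ⟨M, c, T, R, l, m, k, s, h⟩ := exists_history hF hq hw1 hw2 us hV
  refine ⟨M, c, T, R, h.maintains, h.rest.isSplitter hF hq hε (Nat.le_ceil _) h.linked, ?_, ?_⟩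
  · have hT : (T : ℝ) ≤ us.length * (17384950 * (t ^ 2 * q ^ 3 * (l + 1) ^ 2)) := by
      exact_mod_cast h.time_le hF
    set x : ℝ := max (DynGraph.peakEdges ⊥ us : ℝ) 2 with hx
    have hx2 : Real.log 2 ≤ Real.log x := Real.log_le_log (by norm_num) (le_max_right _ _)
    have h2 := Real.log_two_gt_d9
    have hl : (l : ℝ) + 1 ≤ 3 * Real.log x := by
      have h1 : (2 : ℝ) ^ l ≤ x := by
        have : ((2 ^ l : ℕ) : ℝ) ≤ ((max 1 (DynGraph.peakEdges ⊥ us) : ℕ) : ℝ) :=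
          Nat.cast_le.2 h.pow_le
        push_cast at this
        refine this.trans (max_le ?_ (le_max_left _ _))
        exact le_trans (by norm_num) (le_max_right _ _)
      have h3 := exponent_le h1
      have h4 : ((l : ℝ) + 1) * 0.6931471803 ≤ ((l : ℝ) + 1) * Real.log 2 := by gcongr
      nlinarith
    have hl2 : ((l : ℝ) + 1) ^ 2 ≤ 13 * Real.log x ^ 3 := by
      calc ((l : ℝ) + 1) ^ 2 ≤ (3 * Real.log x) ^ 2 := by gcongr
        _ = Real.log x ^ 2 * 9 := by ring
        _ ≤ Real.log x ^ 2 * (13 * Real.log x) := by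
          gcongr
          linarith
        _ = 13 * Real.log x ^ 3 := by ring
    have hεi : 1 ≤ 1 / ε := by rw [le_div_iff₀ hε]; linarith
    have hq3 : (q : ℝ) ^ 3 ≤ 8 * (1 / ε) ^ 4 := by
      calc (q : ℝ) ^ 3 ≤ (2 / ε) ^ 3 := by gcongr
        _ = 8 * (1 / ε) ^ 3 := by ring
        _ ≤ 8 * (1 / ε) ^ 4 := by
          gcongr
          norm_num
    have ht3 : (t : ℝ) ^ 2 ≤ t ^ 3 := by
      gcongr
      · exact_mod_cast ht
      · norm_num
    have hlx : 0 ≤ Real.log x := by linarith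
    calc (T : ℝ) ≤ us.length * (17384950 * (t ^ 2 * q ^ 3 * (l + 1) ^ 2)) := hT
      _ ≤ us.length * (17384950 * (t ^ 3 * (8 * (1 / ε) ^ 4) * (13 * Real.log x ^ 3))) := by gcongr
      _ = 1808034800 * us.length * (t ^ 3 * (1 / ε) ^ 4 * Real.log x ^ 3) := by ring
      _ ≤ 2 * 10 ^ 9 * us.length * (t ^ 3 * (1 / ε) ^ 4 * Real.log x ^ 3) := by
        gcongr
        norm_num
  · have hR : (R : ℝ) ≤ us.length * (194 * (q * (l + 1))) := by exact_mod_cast h.reports_le hF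
    have hl := exponent_le_log hn h.rest.le
    have hlog : 0 ≤ Real.log n := Real.log_natCast_nonneg n
    have hq2 : (q : ℝ) ≤ 2 / ε ^ 2 := by
      refine hqε.trans ?_
      gcongr
      nlinarith
    calc (R : ℝ) ≤ us.length * (194 * (q * (l + 1))) := hR
      _ ≤ us.length * (194 * (2 / ε ^ 2 * (4.4 * Real.log n))) := by gcongr
      _ = 1707.2 * us.length * (Real.log n / ε ^ 2) := by ring
      _ ≤ 2 * 10 ^ 9 * us.length * (Real.log n / ε ^ 2) := by
        gcongr
        norm_num
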